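/- Let $n\ge 3$, $p,q>1$, and set $$\Gamma_{GG}(n,p,q)=\max\Big\{\frac{p+1}{pq-1},\frac{q+1}{pq-1}\Big\}-\frac{n-1}{2}.$$ Assume $\Gamma_{GG}(n,p,q)\ge 0$. For $i=1,2$ let $D_i,V_i\in C(\mathbb R^n)$ be radial functions, each Hölder continuous with some exponent $\delta>0$ on the ball $B_\delta$ of radius $\delta$ about $0$, with $$0\le D_i(x)\le \alpha_1(1+|x|)^{-\beta},\qquad 0\le V_i(x)\le\alpha_2(1+|x|)^{-\omega},\qquad \alpha_1,\alpha_2\ge 0,\ \beta>1,\ \omega>2 .$$ Let $u_0,u_1,v_0,v_1\in C_c^\infty(\mathbb R^n)$ be nonnegative and supported in $\{|x|\le R\}$, $R>0$, with $(u_0,u_1)\ne(0,0)$ and $(v_0,v_1)\neq(0,0)$. For $\varepsilon>0$ consider $$\begin{cases}u_{tt}-\Delta u+D_1(x)u_t+V_1(x)u=|v_t|^p,\\ v_{tt}-\Delta v+D_2(x)v_t+V_2(x)v=|u_t|^q,\\ (u,u_t)(0,\cdot)=\varepsilon(u_0,u_1),\quad (v,v_t)(0,\cdot)=\varepsilon(v_0,v_1).\end{cases}$$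 A weak solution on $[0,T)$ is a pair $u,v\in C([0,T),H^1(\mathbb R^n))\cap C^1([0,T),L^2(\mathbb R^n))$ with these initial values, with $u_t\in L^q_{loc}((0,T)\times\mathbb R^n)$, $v_t\in L^p_{loc}((0,T)\times\mathbb R^n)$, with $u(t,x)=v(t,x)=0$ for $|x|>t+R$, and such that for every $\Psi\in C_0^\infty([0,T)\times\mathbb R^n)$ the integral of $|v_t|^p\Psi$ over $(0,T)\times\mathbb R^n$ converges absolutely and $$\varepsilon\int u_1\Psi(0,x)\,dx+\varepsilon\int u_0D_1\Psi(0,x)\,dx+\int_0^T\!\!\int|v_t|^p\Psi\,dx\,dt=\int_0^T\!\!\int\big(-u_t\Psi_t+\nabla u\cdot\nabla\Psi-D_1u\Psi_t+V_1u\Psi\big)\,dx\,dt,$$ together with the analogous condition for $v$ (with $v_0,v_1,D_2,V_2$ and $|u_t|^q$). The lifespan $T_\varepsilon\in[0,\infty]$ is the supremum of all $T>0$ for which a weak solution on $[0,T)$ exists. Then $T_\varepsilon<\infty$ for every $\varepsilon>0$. Moreover there are constants $\varepsilon_0>0$ and $C>0$, independent of $\varepsilon$, such that for all $\varepsilon\in(0,\varepsilon_0)$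 $$T_\varepsilon\le\begin{cases}C\,\varepsilon^{-1/\Gamma_{GG}(n,p,q)},&\Gamma_{GG}(n,p,q)>0,\\ \exp\big(C\varepsilon^{-(pq-1)}\big),&\Gamma_{GG}(n,p,q)=0,\ p\ne q,\\ \exp\big(C\varepsilon^{-(p-1)}\big),&\Gamma_{GG}(n,p,q)=0,\ p=q.\end{cases}$$ -/

import Mathlib

open MeasureTheory Set Filter
open scoped Topology ContDiff NNReal ENNReal

noncomputable section

namespace DampedWave

/-- The space `ℝⁿ` with its Euclidean norm. Space-time points are pairs `(t, x) : ℝ × Space n`. -/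
abbrev Space (n : ℕ) : Type := EuclideanSpace ℝ (Fin n)

/-! ### Coefficients and data -/

/-- A coefficient (damping or potential): a continuous radial function on `ℝⁿ`, Hölder continuous
of some exponent `δ > 0` on the ball `B_δ`, with `0 ≤ f(x) ≤ α (1 + |x|)^(-γ)`. -/
structure IsCoefficient {n : ℕ} (f : Space n → ℝ) (α γ : ℝ) : Prop where
  continuous : Continuous f
  holder : ∃ δ : ℝ≥0, 0 < δ ∧ ∃ C : ℝ≥0, HolderOnWith C δ f (Metric.closedBall 0 (δ : ℝ))
  radial : ∀ x y : Space n, ‖x‖ = ‖y‖ → f x = f y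
  nonneg : ∀ x, 0 ≤ f x
  le_decay : ∀ x, f x ≤ α * (1 + ‖x‖) ^ (-γ)

/-- An initial datum: smooth, nonnegative, and supported in the closed ball `B_R`. -/
structure IsDatum {n : ℕ} (R : ℝ) (f : Space n → ℝ) : Prop where
  smooth : ContDiff ℝ ∞ f
  nonneg : ∀ x, 0 ≤ f x
  support_subset : Function.support f ⊆ Metric.closedBall 0 R

/-! ### Function spaces -/

/-- The space-time slab `(0,T) × ℝⁿ`. -/
def slab (n : ℕ) (T : ℝ) : Set (ℝ × Space n) := Ioo 0 T ×ˢ univ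

/-- `g` is the weak (distributional) gradient of `f` on `ℝⁿ`:
`∫ f ∇φ = - ∫ φ g` for all `φ ∈ C_c^∞(ℝⁿ)`. -/
def HasWeakGradient {n : ℕ} (f : Space n → ℝ) (g : Space n → Space n) : Prop :=
  ∀ φ : Space n → ℝ, ContDiff ℝ ∞ φ → HasCompactSupport φ →
    ∫ x, f x • gradient φ x = - ∫ x, φ x • g x

/-- `f ∈ C([0,T), L²(ℝⁿ))`, where `f` is a (jointly measurable) function of `(t, x)`. -/
def ContL2 {n : ℕ} {F : Type} [NormedAddCommGroup F] (T : ℝ) (f : ℝ × Space n → F) : Prop :=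
  AEStronglyMeasurable f (volume.restrict (slab n T)) ∧
  ∃ U : ℝ → Lp F 2 (volume : Measure (Space n)),
    (∀ t ∈ Ico 0 T, U t =ᵐ[volume] fun x => f (t, x)) ∧ ContinuousOn U (Ico 0 T)

/-- `ft` is the time derivative of `f` as an `L²(ℝⁿ)`-valued function on `[0,T)`
(one-sided at `t = 0`). -/
def HasTimeDerivL2 {n : ℕ} (T : ℝ) (f ft : ℝ × Space n → ℝ) : Prop :=
  ∃ U U' : ℝ → Lp ℝ 2 (volume : Measure (Space n)),
    (∀ t ∈ Ico 0 T, U t =ᵐ[volume] fun x => f (t, x)) ∧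
    (∀ t ∈ Ico 0 T, U' t =ᵐ[volume] fun x => ft (t, x)) ∧
    ∀ t ∈ Ico 0 T, HasDerivWithinAt U (U' t) (Ico 0 T) t

/-- `u ∈ C([0,T), H¹(ℝⁿ)) ∩ C¹([0,T), L²(ℝⁿ))`, with time derivative `ut` and weak spatial
gradient `gu`. -/
structure EnergyClass {n : ℕ} (T : ℝ) (u ut : ℝ × Space n → ℝ) (gu : ℝ × Space n → Space n) :
    Prop where
  cont : ContL2 T u
  cont_time : ContL2 T ut
  cont_grad : ContL2 T gu
  time_deriv : HasTimeDerivL2 T u ut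
  weak_grad : ∀ t ∈ Ico 0 T, HasWeakGradient (fun x => u (t, x)) (fun x => gu (t, x))

/-- `f ∈ L^r_loc((0,T) × ℝⁿ)`. -/
def MemLpLoc {n : ℕ} (r T : ℝ) (f : ℝ × Space n → ℝ) : Prop :=
  ∀ K : Set (ℝ × Space n), IsCompact K → K ⊆ slab n T →
    MemLp f (ENNReal.ofReal r) (volume.restrict K)

/-! ### Weak solutions -/

/-- Test functions `Ψ ∈ C_c^∞([0,T) × ℝⁿ)`. They need not vanish at `t = 0`; they are given together
with a smooth extension to negative times. -/
structure IsTestFunction {n : ℕ} (T : ℝ) (Ψ : ℝ × Space n → ℝ) : Prop where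
  smooth : ContDiff ℝ ∞ Ψ
  compact : HasCompactSupport Ψ
  support_subset : tsupport Ψ ⊆ Iio T ×ˢ univ

/-- `∂ₜΨ`. -/
def dt {n : ℕ} (Ψ : ℝ × Space n → ℝ) (z : ℝ × Space n) : ℝ :=
  deriv (fun s => Ψ (s, z.2)) z.1

/-- The spatial gradient `∇Ψ`. -/
def dx {n : ℕ} (Ψ : ℝ × Space n → ℝ) (z : ℝ × Space n) : Space n :=
  gradient (fun y => Ψ (z.1, y)) z.2

/-- The weak form of `w_tt - Δw + D w_t + V w = N` on `(0,T) × ℝⁿ` with data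
`(w, w_t)(0) = (ε w₀, ε w₁)`. Convergence of the integral of `N Ψ` is part of the definition; all
the other integrals converge for `w` in the energy class. -/
def WeakEquation {n : ℕ} (T ε : ℝ) (D V w₀ w₁ : Space n → ℝ) (w wt : ℝ × Space n → ℝ)
    (gw : ℝ × Space n → Space n) (N : ℝ × Space n → ℝ) : Prop :=
  ∀ Ψ : ℝ × Space n → ℝ, IsTestFunction T Ψ →
    IntegrableOn (fun z => N z * Ψ z) (slab n T) ∧
    ε * (∫ x, w₁ x * Ψ (0, x)) + ε * (∫ x, w₀ x * D x * Ψ (0, x))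
        + (∫ z in slab n T, N z * Ψ z)
      = -(∫ z in slab n T, wt z * dt Ψ z)
        + (∫ z in slab n T, inner ℝ (gw z) (dx Ψ z))
        - (∫ z in slab n T, w z * D z.2 * dt Ψ z)
        + (∫ z in slab n T, V z.2 * w z * Ψ z)

/-- The initial conditions `w(0) = ε w₀`, `w_t(0) = ε w₁`. -/
def InitialConditions {n : ℕ} (ε : ℝ) (w₀ w₁ : Space n → ℝ) (w wt : ℝ × Space n → ℝ) : Prop :=
  (∀ᵐ x, w (0, x) = ε * w₀ x) ∧ (∀ᵐ x, wt (0, x) = ε * w₁ x)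

/-- Finite speed of propagation: `supp w ⊆ {(t, x) ∈ [0,T) × ℝⁿ : |x| ≤ t + R}`. -/
def FiniteSpeed {n : ℕ} (R T : ℝ) (w : ℝ × Space n → ℝ) : Prop :=
  ∀ t ∈ Ico 0 T, ∀ᵐ x, t + R < ‖x‖ → w (t, x) = 0

/-- `(u, v)`, with time derivatives `ut, vt` and gradients `gu, gv`, is a weak solution on `[0,T)` of
`u_tt - Δu + D₁ u_t + V₁ u = |v_t|^p`, `v_tt - Δv + D₂ v_t + V₂ v = |u_t|^q`,
`(u, u_t)(0) = ε (u₀, u₁)`, `(v, v_t)(0) = ε (v₀, v₁)`. -/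
structure IsWeakSolution {n : ℕ} (p q : ℝ) (D₁ D₂ V₁ V₂ : Space n → ℝ) (R : ℝ)
    (u₀ u₁ v₀ v₁ : Space n → ℝ) (ε T : ℝ)
    (u ut : ℝ × Space n → ℝ) (gu : ℝ × Space n → Space n)
    (v vt : ℝ × Space n → ℝ) (gv : ℝ × Space n → Space n) : Prop where
  energy_u : EnergyClass T u ut gu
  energy_v : EnergyClass T v vt gv
  loc_u : MemLpLoc q T ut
  loc_v : MemLpLoc p T vt
  initial_u : InitialConditions ε u₀ u₁ u ut
  initial_v : InitialConditions ε v₀ v₁ v vt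
  speed_u : FiniteSpeed R T u
  speed_v : FiniteSpeed R T v
  equation_u : WeakEquation T ε D₁ V₁ u₀ u₁ u ut gu (fun z => |vt z| ^ p)
  equation_v : WeakEquation T ε D₂ V₂ v₀ v₁ v vt gv (fun z => |ut z| ^ q)

/-- The set of existence times: all `T > 0` for which there is a weak solution on `[0,T)`. -/
def existenceTimes {n : ℕ} (p q : ℝ) (D₁ D₂ V₁ V₂ : Space n → ℝ) (R : ℝ)
    (u₀ u₁ v₀ v₁ : Space n → ℝ) (ε : ℝ) : Set ℝ :=
  {T | 0 < T ∧ ∃ (u ut : ℝ × Space n → ℝ) (gu : ℝ × Space n → Space n)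
    (v vt : ℝ × Space n → ℝ) (gv : ℝ × Space n → Space n),
    IsWeakSolution p q D₁ D₂ V₁ V₂ R u₀ u₁ v₀ v₁ ε T u ut gu v vt gv}

/-- The lifespan `T_ε ∈ [0,∞]`: the supremum of all existence times. -/
def lifespan {n : ℕ} (p q : ℝ) (D₁ D₂ V₁ V₂ : Space n → ℝ) (R : ℝ)
    (u₀ u₁ v₀ v₁ : Space n → ℝ) (ε : ℝ) : ℝ≥0∞ :=
  ⨆ T ∈ existenceTimes p q D₁ D₂ V₁ V₂ R u₀ u₁ v₀ v₁ ε, ENNReal.ofReal T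

/-- `Γ_GG(n,p,q) = max {(p+1)/(pq-1), (q+1)/(pq-1)} - (n-1)/2`. -/
def gammaGG (n : ℕ) (p q : ℝ) : ℝ :=
  max ((p + 1) / (p * q - 1)) ((q + 1) / (p * q - 1)) - ((n : ℝ) - 1) / 2

end DampedWave

end

open DampedWave

/-!
# Blow-up for weakly coupled damped wave systems with derivative nonlinearities

The proof tests both equations with a growing eigenfunction of the stationary operator and follows
the nonlinear masses over dyadic time intervals.

*The eigenfunction.* Since `D` and `V` are radial, `Δφ = (1 + D + V) φ` is an ordinary differential
equation in `r = |x|`, solved by a fixed point argument (`exists_radial_solution`). The perturbation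
`D + V` is integrable in `r`, which gives the two-sided bound
`φ ~ (1 + r)^{-(n-1)/2} e^r` (`exists_growth_bounds`). Moreover `e^{-t} φ(|x|)` is a positive solution of
the adjoint equation `Φ_tt - ΔΦ - D Φ_t + V Φ = 0`.

*From `u` to `u_t`.* The equation of `u` is tested with `-∂_t(ρ(t/τ) e^{-t}) φ`, where `ρ` is a cutoff
in time. Integrating by parts in time, every integral of `u` becomes one of `u_t`, and
all terms cancel except those in which `ρ` is differentiated
(`WeakEquation.eigenfunction_identity`, `IsCutoff.deriv_timeTest`); the data contribute with a
positive sign (`data_integral_pos`). This leaves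
`c ε + X(τ) ≤ K τ⁻¹ ∫ |u_t| e^{-t} φ` over times `t ~ τ`, where `X(τ)` is the mass of `|v_t|^p`, with
the weight `e^{-t} φ`, up to the time `τ` (`exists_linear_estimate`). The function `φ` need not be
smooth, so it is not itself a test function: it is approximated by polynomials in `|x|²` whose
Laplacians approximate `Δφ` (`exists_polynomial_near_solution`), which is enough because solutions
have bounded support at each time.

*The system of inequalities.* On the cone `|x| ≤ t + R` the weight `e^{-t} φ` has the mass
`O(τ^{(n+1)/2})` up to the time `τ` (`exists_setIntegral_coneWeight_le`). By Hölder's inequality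
(`exists_hoelder_estimate`) the integral of `|u_t|` is bounded by a power of the increment
`Y(τ) - Y(τ/2)` of the mass `Y` of `|u_t|^q`. The other equation gives the same with the roles
exchanged; this is the system `MassSystem`.

*Conclusion.* Eliminating `Y`, with `m = (n-1)/2`,
`(c ε + X(τ))^{pq} ≤ K τ^{m(pq-1) - (p+1)} (X(τ) - X(τ/2))`, and the exponent of `τ` is
`-(pq-1) Γ` if `(p+1)/(pq-1)` is the larger of the two quotients. If `Γ > 0` this alone bounds `τ` by a
multiple of `ε^{-1/Γ}`. If `Γ = 0`, the quantity `(c ε + X)^{-(pq-1)}` drops by a fixed amount over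
each dyadic interval (`le_exp_of_rpow_le_increment`), so that the number of dyadic intervals is
`O(ε^{-(pq-1)})`. If moreover `p = q`, both inequalities are critical, and the same argument for the
sum of the two masses, without elimination, gives the exponent `p - 1` in place of `pq - 1`.
-/

noncomputable section

namespace DampedWave

/-! ### Inverting the radial Laplacian -/

/-- The derivative `ρ ↦ ρ^{1-n} ∫₀^ρ τ^{n-1} g(τ) dτ` of the solution of `f'' + (n-1)/r f' = g`,
written after the substitution `τ = ρ θ`, in which form it makes sense on all of `ℝ`. -/
def radialFlux (n : ℕ) (g : ℝ → ℝ) (ρ : ℝ) : ℝ :=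
  ρ * ∫ θ in (0 : ℝ)..1, θ ^ (n - 1) * g (ρ * θ)

/-- The solution of `f'' + (n-1)/r f' = g` with `f(0) = 0`, `f'(0) = 0`. -/
def radialInverse (n : ℕ) (g : ℝ → ℝ) (r : ℝ) : ℝ :=
  r * ∫ μ in (0 : ℝ)..1, radialFlux n g (r * μ)

lemma continuous_radialFlux (n : ℕ) {g : ℝ → ℝ} (hg : Continuous g) :
    Continuous (radialFlux n g) := by
  unfold radialFlux
  refine continuous_id.mul ?_
  apply intervalIntegral.continuous_parametric_intervalIntegral_of_continuous' (μ := volume)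
  fun_prop

lemma continuous_radialInverse (n : ℕ) {g : ℝ → ℝ} (hg : Continuous g) :
    Continuous (radialInverse n g) := by
  unfold radialInverse
  refine continuous_id.mul ?_
  apply intervalIntegral.continuous_parametric_intervalIntegral_of_continuous' (μ := volume)
  have := continuous_radialFlux n hg
  fun_prop

lemma radialInverse_eq_integral (n : ℕ) (g : ℝ → ℝ) (r : ℝ) :
    radialInverse n g r = ∫ ρ in (0 : ℝ)..r, radialFlux n g ρ := by
  unfold radialInverse
  rw [intervalIntegral.mul_integral_comp_mul_left]
  simp

lemma hasDerivAt_radialInverse (n : ℕ) {g : ℝ → ℝ} (hg : Continuous g) (r : ℝ) :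
    HasDerivAt (radialInverse n g) (radialFlux n g r) r := by
  have h := continuous_radialFlux n hg
  have h2 : radialInverse n g = fun r => ∫ ρ in (0 : ℝ)..r, radialFlux n g ρ :=
    funext (radialInverse_eq_integral n g)
  rw [h2]
  exact intervalIntegral.integral_hasDerivAt_right (h.intervalIntegrable _ _)
    h.aestronglyMeasurable.stronglyMeasurableAtFilter h.continuousAt

lemma pow_mul_radialFlux (n : ℕ) (g : ℝ → ℝ) (ρ : ℝ) :
    ρ ^ (n - 1) * radialFlux n g ρ = ∫ τ in (0 : ℝ)..ρ, τ ^ (n - 1) * g τ := by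
  have h := intervalIntegral.mul_integral_comp_mul_left (a := 0) (b := 1) (c := ρ)
    (f := fun τ => τ ^ (n - 1) * g τ)
  simp only [mul_zero, mul_one] at h
  rw [← h, radialFlux, mul_left_comm, ← intervalIntegral.integral_const_mul]
  congr 2
  ext θ
  ring

/-- The equation `J' = g - (n-1)/r J` for the flux `J = f'`. -/
lemma hasDerivAt_radialFlux {n : ℕ} (hn : 1 ≤ n) {g : ℝ → ℝ} (hg : Continuous g) {r : ℝ}
    (hr : 0 < r) :
    HasDerivAt (radialFlux n g) (g r - ((n : ℝ) - 1) / r * radialFlux n g r) r := by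
  have h1 : HasDerivAt (fun r => ∫ τ in (0 : ℝ)..r, τ ^ (n - 1) * g τ) (r ^ (n - 1) * g r) r := by
    have h : Continuous fun τ : ℝ => τ ^ (n - 1) * g τ := by fun_prop
    exact intervalIntegral.integral_hasDerivAt_right (h.intervalIntegrable _ _)
      h.aestronglyMeasurable.stronglyMeasurableAtFilter h.continuousAt
  have hne : r ^ (n - 1) ≠ 0 := by positivity
  have h2 := h1.div (hasDerivAt_pow (n - 1) r) hne
  have h3 : radialFlux n g =ᶠ[𝓝 r]
      (fun r => ∫ τ in (0 : ℝ)..r, τ ^ (n - 1) * g τ) / fun x => x ^ (n - 1) := by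
    filter_upwards [lt_mem_nhds hr] with s hs
    rw [Pi.div_apply, ← pow_mul_radialFlux n, mul_div_cancel_left₀ _ (by positivity)]
  refine (h2.congr_of_eventuallyEq h3).congr_deriv ?_
  rw [← pow_mul_radialFlux n]
  obtain ⟨k, rfl⟩ : ∃ k, n = k + 1 := ⟨n - 1, by omega⟩
  rcases k with _ | k
  · simp
  · have : r ^ (k + 1) = r ^ k * r := pow_succ r k
    push_cast
    field_simp
    ring

lemma abs_radialFlux_le (n : ℕ) {g : ℝ → ℝ} (ρ B : ℝ)
    (h : ∀ θ ∈ Icc (0 : ℝ) 1, |g (ρ * θ)| ≤ B) : |radialFlux n g ρ| ≤ |ρ| * B := by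
  unfold radialFlux
  rw [abs_mul]
  refine mul_le_mul_of_nonneg_left ?_ (abs_nonneg _)
  have := intervalIntegral.norm_integral_le_of_norm_le_const (a := 0) (b := 1) (C := B)
    (f := fun θ => θ ^ (n - 1) * g (ρ * θ)) ?_
  · simpa using this
  · intro θ hθ
    rw [uIoc_of_le zero_le_one] at hθ
    have h1 := h θ ⟨hθ.1.le, hθ.2⟩
    have h2 : |θ| ^ (n - 1) ≤ 1 := pow_le_one₀ (abs_nonneg _) (by rw [abs_of_pos hθ.1]; exact hθ.2)
    rw [Real.norm_eq_abs, abs_mul, abs_pow]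
    calc |θ| ^ (n - 1) * |g (ρ * θ)| ≤ 1 * B :=
          mul_le_mul h2 h1 (abs_nonneg _) zero_le_one
      _ = B := one_mul B

lemma radialFlux_nonneg (n : ℕ) {g : ℝ → ℝ} (hg : ∀ s, 0 ≤ g s) {ρ : ℝ} (hρ : 0 ≤ ρ) :
    0 ≤ radialFlux n g ρ :=
  mul_nonneg hρ (intervalIntegral.integral_nonneg zero_le_one
    fun _ hθ => mul_nonneg (pow_nonneg hθ.1 _) (hg _))

lemma radialInverse_nonneg (n : ℕ) {g : ℝ → ℝ} (hg : ∀ s, 0 ≤ g s) (r : ℝ) :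
    0 ≤ radialInverse n g r := by
  unfold radialInverse
  rw [← intervalIntegral.integral_const_mul]
  refine intervalIntegral.integral_nonneg zero_le_one fun μ hμ => ?_
  unfold radialFlux
  rw [← mul_assoc]
  refine mul_nonneg ?_ (intervalIntegral.integral_nonneg zero_le_one
    fun _ hθ => mul_nonneg (pow_nonneg hθ.1 _) (hg _))
  nlinarith [mul_nonneg (sq_nonneg r) hμ.1]

lemma radialInverse_sub (n : ℕ) {g h : ℝ → ℝ} (hg : Continuous g) (hh : Continuous h) (r : ℝ) :
    radialInverse n (fun s => g s - h s) r = radialInverse n g r - radialInverse n h r := by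
  have h1 : ∀ ρ, radialFlux n (fun s => g s - h s) ρ = radialFlux n g ρ - radialFlux n h ρ := by
    intro ρ
    unfold radialFlux
    rw [← mul_sub, ← intervalIntegral.integral_sub]
    · simp only [mul_sub]
    · exact Continuous.intervalIntegrable (by fun_prop) _ _
    · exact Continuous.intervalIntegrable (by fun_prop) _ _
  have c1 := continuous_radialFlux n hg
  have c2 := continuous_radialFlux n hh
  unfold radialInverse
  simp only [h1]
  rw [← mul_sub, ← intervalIntegral.integral_sub]
  · exact Continuous.intervalIntegrable (by fun_prop) _ _
  · exact Continuous.intervalIntegrable (by fun_prop) _ _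

lemma abs_radialInverse_le (n : ℕ) {g : ℝ → ℝ} (r B : ℝ)
    (h : ∀ θ ∈ Icc (0 : ℝ) 1, |g (r * θ)| ≤ B) : |radialInverse n g r| ≤ r ^ 2 * B := by
  have hB : 0 ≤ B := (abs_nonneg _).trans (h 0 ⟨le_rfl, zero_le_one⟩)
  unfold radialInverse
  rw [abs_mul, ← sq_abs, sq, mul_assoc]
  refine mul_le_mul_of_nonneg_left ?_ (abs_nonneg _)
  have := intervalIntegral.norm_integral_le_of_norm_le_const (a := 0) (b := 1) (C := |r| * B)
    (f := fun μ => radialFlux n g (r * μ)) ?_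
  · simpa using this
  · intro μ hμ
    rw [uIoc_of_le zero_le_one] at hμ
    refine (abs_radialFlux_le n _ B ?_).trans ?_
    · intro θ hθ
      rw [mul_assoc]
      exact h _ ⟨mul_nonneg hμ.1.le hθ.1, mul_le_one₀ hμ.2 hθ.1 hθ.2⟩
    · rw [abs_mul, abs_of_pos hμ.1]
      have : |r| * μ ≤ |r| := mul_le_of_le_one_right (abs_nonneg _) hμ.2
      gcongr

/-- The radial inverse gains the factor `1/(2M)` on functions bounded by a multiple of the Gaussian
weight `exp (M s²)`. -/
lemma abs_radialInverse_le_exp (n : ℕ) {g : ℝ → ℝ} (hg : Continuous g) {M c : ℝ} (hM : 0 < M)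
    (hc : 0 ≤ c)
    (h : ∀ s, |g s| ≤ c * Real.exp (M * s ^ 2)) (r : ℝ) :
    |radialInverse n g r| ≤ c / (2 * M) * Real.exp (M * r ^ 2) := by
  have h1 : ∀ ρ, |radialFlux n g ρ| ≤ |ρ| * (c * Real.exp (M * ρ ^ 2)) := by
    intro ρ
    refine abs_radialFlux_le n _ _ fun θ hθ => (h _).trans ?_
    have : (ρ * θ) ^ 2 ≤ ρ ^ 2 := by
      rw [mul_pow]
      exact mul_le_of_le_one_right (sq_nonneg _) (pow_le_one₀ hθ.1 hθ.2)
    gcongr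
  have h2 : ∫ μ in (0 : ℝ)..1, |r| * (|r| * μ * (c * Real.exp (M * (r * μ) ^ 2)))
      = c / (2 * M) * Real.exp (M * r ^ 2) - c / (2 * M) := by
    have := intervalIntegral.integral_eq_sub_of_hasDerivAt (a := 0) (b := 1)
      (f := fun μ => c / (2 * M) * Real.exp (M * (r * μ) ^ 2))
      (f' := fun μ => |r| * (|r| * μ * (c * Real.exp (M * (r * μ) ^ 2)))) ?_ ?_
    · rw [this]; simp
    · intro μ _
      have e := ((((hasDerivAt_id μ).const_mul r).pow 2).const_mul M).exp.const_mul (c / (2 * M))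
      simp only [id] at e
      refine e.congr_deriv ?_
      have : |r| * (|r| * μ * (c * Real.exp (M * (r * μ) ^ 2)))
        = |r| * |r| * μ * (c * Real.exp (M * (r * μ) ^ 2)) := by ring
      rw [this, abs_mul_abs_self]
      simp only [Pi.pow_apply]
      field_simp
      push_cast
      ring
    · exact Continuous.intervalIntegrable (by fun_prop) _ _
  have c1 := continuous_radialFlux n hg
  calc |radialInverse n g r|
      = |∫ μ in (0 : ℝ)..1, r * radialFlux n g (r * μ)| := by
        rw [radialInverse, intervalIntegral.integral_const_mul]
    _ ≤ ∫ μ in (0 : ℝ)..1, |r| * (|r| * μ * (c * Real.exp (M * (r * μ) ^ 2))) := by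
        rw [← Real.norm_eq_abs]
        refine intervalIntegral.norm_integral_le_of_norm_le zero_le_one ?_ ?_
        · refine ae_of_all _ fun μ hμ => ?_
          rw [Real.norm_eq_abs, abs_mul]
          refine mul_le_mul_of_nonneg_left ((h1 _).trans ?_) (abs_nonneg _)
          rw [abs_mul, abs_of_pos hμ.1]
        · exact Continuous.intervalIntegrable (by fun_prop) _ _
    _ ≤ _ := by
        rw [h2]
        have : 0 ≤ c / (2 * M) := by positivity
        linarith

/-! ### The positive radial eigenfunction -/

/-- A continuous `φ ≥ 1` with `φ'' + (n-1)/r φ' = W φ` and `φ(0) = 1`, in integrated form: the fixed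
point of a contraction in the space of continuous functions bounded by a multiple of
`exp (M r²)`. -/
theorem exists_radial_solution (n : ℕ) {W : ℝ → ℝ} (hW : Continuous W) {M : ℝ} (hM : 0 < M)
    (hW0 : ∀ r, 0 ≤ W r) (hWM : ∀ r, W r ≤ M) :
    ∃ φ : ℝ → ℝ, Continuous φ ∧ (∀ r, 1 ≤ φ r) ∧
      ∀ r, φ r = 1 + radialInverse n (fun s => W s * φ s) r := by
  -- Writing `φ = e^{M r²} b`, the fixed point problem is solved for the bounded function `b`.
  let ex : ℝ → ℝ := fun r => Real.exp (M * r ^ 2)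
  have hex : Continuous ex := by fun_prop
  have hex1 : ∀ r, 1 ≤ ex r := fun r => Real.one_le_exp (by positivity)
  let G : (BoundedContinuousFunction ℝ ℝ) → ℝ → ℝ := fun b s => W s * (ex s * b s)
  have hG : ∀ b, Continuous (G b) := fun b => by
    have := b.continuous
    fun_prop
  have hGb : ∀ (b : BoundedContinuousFunction ℝ ℝ) s, |G b s| ≤ M * ‖b‖ * ex s := by
    intro b s
    have h1 := b.norm_coe_le_norm s
    rw [Real.norm_eq_abs] at h1
    have h2 := hex1 s
    simp only [G, abs_mul]
    rw [abs_of_nonneg (hW0 s), abs_of_nonneg (by linarith : 0 ≤ ex s)]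
    calc W s * (ex s * |b s|) ≤ M * (ex s * ‖b‖) := by gcongr; exact hWM s
      _ = _ := by ring
  let Φ : BoundedContinuousFunction ℝ ℝ → BoundedContinuousFunction ℝ ℝ := fun b =>
    BoundedContinuousFunction.ofNormedAddCommGroup
      (fun r => (ex r)⁻¹ * (1 + radialInverse n (G b) r))
      (by
        have h1 := continuous_radialInverse n (hG b)
        have h2 : Continuous fun r => (ex r)⁻¹ :=
          hex.inv₀ fun r => (lt_of_lt_of_le one_pos (hex1 r)).ne'
        fun_prop)
      (1 + M * ‖b‖ / (2 * M))
      (by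
        intro r
        have h0 : 0 < ex r := lt_of_lt_of_le one_pos (hex1 r)
        have h1 : |radialInverse n (G b) r| ≤ M * ‖b‖ / (2 * M) * ex r :=
          abs_radialInverse_le_exp n (hG b) hM (by positivity) (hGb b) r
        rw [Real.norm_eq_abs, abs_mul, abs_of_pos (inv_pos.2 h0), inv_mul_le_iff₀ h0]
        calc |1 + radialInverse n (G b) r| ≤ |1| + |radialInverse n (G b) r| := abs_add_le _ _
          _ ≤ ex r + M * ‖b‖ / (2 * M) * ex r := by
              rw [abs_one]; exact add_le_add (hex1 r) h1
          _ = _ := by ring)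
  have hΦ : ∀ b r, Φ b r = (ex r)⁻¹ * (1 + radialInverse n (G b) r) := fun b r => rfl
  have hcon : ContractingWith (1 / 2) Φ := by
    refine ⟨by norm_num, LipschitzWith.of_dist_le_mul fun b c => ?_⟩
    rw [BoundedContinuousFunction.dist_le (by positivity)]
    intro r
    have h0 : 0 < ex r := lt_of_lt_of_le one_pos (hex1 r)
    have hd : ∀ s, |G b s - G c s| ≤ M * dist b c * ex s := by
      intro s
      have : G b s - G c s = G (b - c) s := by simp [G]; ring
      rw [this, dist_eq_norm]
      exact hGb _ s
    have h1 : |radialInverse n (fun s => G b s - G c s) r| ≤ M * dist b c / (2 * M) * ex r :=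
      abs_radialInverse_le_exp n ((hG b).sub (hG c)) hM (by positivity) hd r
    rw [radialInverse_sub n (hG b) (hG c)] at h1
    rw [Real.dist_eq, hΦ, hΦ, ← mul_sub, abs_mul, abs_of_pos (inv_pos.2 h0), inv_mul_le_iff₀ h0]
    calc _ = |radialInverse n (G b) r - radialInverse n (G c) r| := by congr 1; ring
      _ ≤ _ := h1
      _ = _ := by
        push_cast
        field_simp
  obtain ⟨b, hb, hlim, -⟩ := hcon.exists_fixedPoint 0 (by
    rw [edist_dist]; exact ENNReal.ofReal_ne_top)
  -- The iterates of `0` are nonnegative, hence so is the fixed point, and then `φ ≥ 1`.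
  have hpos : ∀ k r, 0 ≤ (Φ^[k] 0) r := by
    intro k
    induction k with
    | zero => intro r; simp
    | succ k ih =>
      intro r
      rw [Function.iterate_succ_apply', hΦ]
      have h0 : 0 < ex r := lt_of_lt_of_le one_pos (hex1 r)
      have := radialInverse_nonneg n (g := G (Φ^[k] 0))
        (fun s => mul_nonneg (hW0 s) (mul_nonneg (by linarith [hex1 s]) (ih s))) r
      positivity
  have hb0 : ∀ r, 0 ≤ b r := by
    intro r
    have h := ((BoundedContinuousFunction.tendsto_iff_tendstoUniformly.1 hlim).tendsto_at r)
    exact ge_of_tendsto' h fun k => hpos k r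
  have hfix : ∀ r, ex r * b r = 1 + radialInverse n (fun s => W s * (ex s * b s)) r := by
    intro r
    have h0 : 0 < ex r := lt_of_lt_of_le one_pos (hex1 r)
    have h1 : Φ b r = b r := by rw [hb.eq]
    rw [← h1, hΦ, mul_inv_cancel_left₀ h0.ne']
  refine ⟨fun r => ex r * b r, hex.mul b.continuous, fun r => ?_, hfix⟩
  change 1 ≤ ex r * b r
  rw [hfix]
  have := radialInverse_nonneg n (g := fun s => W s * (ex s * b s))
    (fun s => mul_nonneg (hW0 s) (mul_nonneg (by linarith [hex1 s]) (hb0 s))) r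
  linarith

/-! ### Growth of the eigenfunction -/

/-- The common size `(1 + r)^{-(n-1)/2} e^r` of the radial eigenfunctions. -/
def growthWeight (n : ℕ) (r : ℝ) : ℝ := (1 + r) ^ (-(((n : ℝ) - 1) / 2)) * Real.exp r

lemma monotoneOn_Ici_of_hasDerivAt {f f' : ℝ → ℝ} {a : ℝ}
    (hf : ∀ r, a ≤ r → HasDerivAt f (f' r) r) (h0 : ∀ r, a ≤ r → 0 ≤ f' r) :
    MonotoneOn f (Ici a) := by
  refine monotoneOn_of_deriv_nonneg (convex_Ici a)
    (fun r hr => (hf r hr).continuousAt.continuousWithinAt) ?_ ?_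
  · intro r hr
    rw [interior_Ici] at hr
    exact (hf r (le_of_lt hr)).differentiableAt.differentiableWithinAt
  · intro r hr
    rw [interior_Ici] at hr
    rw [(hf r (le_of_lt hr)).deriv]
    exact h0 r (le_of_lt hr)

/-- A radial solution of `φ'' + (n-1)/r φ' = (1 + P) φ` with an integrable perturbation `P ≥ 0` is
comparable to `(1 + r)^{-(n-1)/2} e^r`. With `g = r^{(n-1)/2} φ` the equation becomes
`g'' = (1 + Q) g` with `Q ≥ 0` integrable at infinity, so that `E = g' + g` satisfies
`E ≤ E' ≤ (1 + Q) E`. -/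
theorem exists_growth_bounds {n : ℕ} (hn : 3 ≤ n) {φ P : ℝ → ℝ} (hφ : Continuous φ)
    (hP : Continuous P) (hφ1 : ∀ r, 1 ≤ φ r)
    (heq : ∀ r, φ r = 1 + radialInverse n (fun s => (1 + P s) * φ s) r)
    {α₁ β α₂ κ : ℝ} (hα₁ : 0 ≤ α₁) (hβ : 1 < β) (hα₂ : 0 ≤ α₂) (hκ : 1 < κ)
    (hP0 : ∀ r, 0 ≤ P r)
    (hPle : ∀ r, 0 ≤ r → P r ≤ α₁ * (1 + r) ^ (-β) + α₂ * (1 + r) ^ (-κ)) :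
    ∃ c > 0, ∃ C > 0, ∀ r, 0 ≤ r → c * growthWeight n r ≤ φ r ∧ φ r ≤ C * growthWeight n r := by
  set m : ℝ := ((n : ℝ) - 1) / 2 with hm
  have hm1 : 1 ≤ m := by
    have : (3 : ℝ) ≤ n := by exact_mod_cast hn
    rw [hm]; linarith
  set G : ℝ → ℝ := fun s => (1 + P s) * φ s with hGdef
  have hG : Continuous G := by fun_prop
  set J := radialFlux n G with hJ
  have hφ0 : ∀ r, 0 ≤ φ r := fun r => zero_le_one.trans (hφ1 r)
  have hJ0 : ∀ r, 0 ≤ r → 0 ≤ J r := fun r hr =>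
    radialFlux_nonneg n (fun s => mul_nonneg (by linarith [hP0 s]) (hφ0 s)) hr
  have dφ : ∀ r, HasDerivAt φ (J r) r := by
    intro r
    have h : φ = fun r => 1 + radialInverse n G r := funext heq
    rw [h]
    exact (hasDerivAt_radialInverse n hG r).const_add 1
  have dJ : ∀ r, 0 < r → HasDerivAt J (G r - 2 * m / r * J r) r := by
    intro r hr
    refine (hasDerivAt_radialFlux (by omega) hG hr).congr_deriv ?_
    rw [hm]; ring
  set g : ℝ → ℝ := fun r => r ^ m * φ r with hg
  set E : ℝ → ℝ := fun r => r ^ m * (J r + (m * r⁻¹ + 1) * φ r) with hE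
  set Q : ℝ → ℝ := fun r => P r + m * (m - 1) * r⁻¹ ^ 2 with hQ
  have hg0 : ∀ r, 0 < r → 0 ≤ g r := fun r hr => mul_nonneg (by positivity) (hφ0 r)
  have hQ0 : ∀ r, 0 ≤ Q r := fun r => by
    have := hP0 r
    have h2 : 0 ≤ m * (m - 1) := mul_nonneg (by linarith) (by linarith)
    positivity
  have hgE : ∀ r, 0 < r → g r ≤ E r := by
    intro r hr
    have h1 := hJ0 r hr.le
    have h2 : 0 ≤ m * r⁻¹ * φ r := by have := hφ0 r; positivity
    simp only [hg, hE]
    gcongr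
    linarith
  have hrm : ∀ r : ℝ, 0 < r → r ^ (m - 1) = r ^ m * r⁻¹ := fun r hr => by
    rw [Real.rpow_sub_one hr.ne', div_eq_mul_inv]
  have dg : ∀ r, 0 < r → HasDerivAt g (E r - g r) r := by
    intro r hr
    refine ((Real.hasDerivAt_rpow_const (Or.inl hr.ne')).mul (dφ r)).congr_deriv ?_
    rw [hrm r hr]
    simp only [hg, hE]
    ring
  have dE : ∀ r, 0 < r → HasDerivAt E (E r + Q r * g r) r := by
    intro r hr
    refine ((Real.hasDerivAt_rpow_const (Or.inl hr.ne')).mul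
      ((dJ r hr).add ((((hasDerivAt_inv hr.ne').const_mul m).add_const 1).mul (dφ r)))).congr_deriv
        ?_
    rw [hrm r hr]
    simp only [hg, hE, hQ, hGdef, Pi.add_apply, Pi.mul_apply]
    field_simp
    ring
  -- Lower bound: `E e^{-r}` and then `g e^r` minus half the lower bound are increasing.
  set k : ℝ := φ 1 / Real.exp 1 with hk
  have hφ1' : 0 < φ 1 := lt_of_lt_of_le one_pos (hφ1 1)
  have hk0 : 0 < k := by positivity
  have hE1 : φ 1 ≤ E 1 := by
    have := hgE 1 one_pos
    simpa [hg] using this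
  have lowE : ∀ r, 1 ≤ r → k * Real.exp r ≤ E r := by
    intro r hr
    have mono : MonotoneOn (fun r => E r * Real.exp (-r)) (Ici 1) := by
      refine monotoneOn_Ici_of_hasDerivAt (f' := fun r => Q r * g r * Real.exp (-r))
        (fun r hr => ?_) (fun r hr => ?_)
      · refine ((dE r (by linarith)).mul ((hasDerivAt_id r).neg.exp)).congr_deriv ?_
        simp only [id, Pi.neg_apply]
        ring
      · have := hQ0 r
        have := hg0 r (by linarith)
        positivity
    have h := mono (mem_Ici.2 le_rfl) (mem_Ici.2 hr) hr
    simp only at h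
    have h2 : k ≤ E 1 * Real.exp (-1) := by
      rw [hk, Real.exp_neg, div_eq_mul_inv]
      gcongr
    have h3 := mul_le_mul_of_nonneg_right (h2.trans h) (Real.exp_pos r).le
    rwa [mul_assoc, ← Real.exp_add, neg_add_cancel, Real.exp_zero, mul_one] at h3
  have lowg : ∀ r, 1 ≤ r → k / 2 * Real.exp r ≤ g r := by
    intro r hr
    have mono : MonotoneOn (fun r => g r * Real.exp r - k / 2 * Real.exp (2 * r)) (Ici 1) := by
      refine monotoneOn_Ici_of_hasDerivAt
        (f' := fun r => (E r - k * Real.exp r) * Real.exp r) (fun r hr => ?_) (fun r hr => ?_)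
      · refine (((dg r (by linarith)).mul (Real.hasDerivAt_exp r)).sub
          (((hasDerivAt_id r).const_mul 2).exp.const_mul (k / 2))).congr_deriv ?_
        have : Real.exp (2 * r) = Real.exp r * Real.exp r := by rw [← Real.exp_add]; ring_nf
        simp only [id, this]
        ring
      · exact mul_nonneg (by linarith [lowE r hr]) (Real.exp_pos _).le
    have h := mono (mem_Ici.2 le_rfl) (mem_Ici.2 hr) hr
    simp only at h
    have e1 : ∀ r : ℝ, Real.exp (2 * r) = Real.exp r * Real.exp r := fun r => by
      rw [← Real.exp_add]; ring_nf
    rw [e1, e1] at h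
    have h2 : k * Real.exp 1 = φ 1 := by rw [hk]; field_simp
    have h3 : g 1 = φ 1 := by simp [hg]
    have h4 : 0 ≤ g 1 * Real.exp 1 - k / 2 * (Real.exp 1 * Real.exp 1) := by
      rw [h3, ← h2]
      have : 0 ≤ k * (Real.exp 1 * Real.exp 1) := by positivity
      linarith
    have h5 : 0 ≤ (g r - k / 2 * Real.exp r) * Real.exp r := by linarith
    have := nonneg_of_mul_nonneg_left h5 (Real.exp_pos r)
    linarith
  -- Upper bound: `E e^{-r-H}` is decreasing, where `H ≤ 0` is an antiderivative of a majorant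
  -- of `Q` on `[1, ∞)`.
  set H : ℝ → ℝ := fun r => -(α₁ / (β - 1) * r ^ (1 - β) + α₂ / (κ - 1) * r ^ (1 - κ)
    + m * (m - 1) * r⁻¹) with hH
  have hβ1 : 0 < β - 1 := by linarith
  have hκ1 : 0 < κ - 1 := by linarith
  have hmm : 0 ≤ m * (m - 1) := mul_nonneg (by linarith) (by linarith)
  have hH0 : ∀ r, 1 ≤ r → H r ≤ 0 := by
    intro r hr
    have : 0 ≤ r := by linarith
    simp only [hH]
    rw [neg_nonpos]
    positivity
  have dH : ∀ r, 0 < r →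
      HasDerivAt H (α₁ * r ^ (-β) + α₂ * r ^ (-κ) + m * (m - 1) * r⁻¹ ^ 2) r := by
    intro r hr
    have h1 := (Real.hasDerivAt_rpow_const (p := 1 - β) (Or.inl hr.ne')).const_mul (α₁ / (β - 1))
    have h2 := (Real.hasDerivAt_rpow_const (p := 1 - κ) (Or.inl hr.ne')).const_mul (α₂ / (κ - 1))
    have h3 := (hasDerivAt_inv hr.ne').const_mul (m * (m - 1))
    refine ((h1.add h2).add h3).neg.congr_deriv ?_
    have e1 : 1 - β - 1 = -β := by ring
    have e2 : 1 - κ - 1 = -κ := by ring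
    rw [e1, e2]
    field_simp
    ring
  have hQH : ∀ r, 1 ≤ r → Q r ≤ α₁ * r ^ (-β) + α₂ * r ^ (-κ) + m * (m - 1) * r⁻¹ ^ 2 := by
    intro r hr
    have h1 : (1 + r) ^ (-β) ≤ r ^ (-β) :=
      Real.rpow_le_rpow_of_nonpos (by linarith) (by linarith) (by linarith)
    have h2 : (1 + r) ^ (-κ) ≤ r ^ (-κ) :=
      Real.rpow_le_rpow_of_nonpos (by linarith) (by linarith) (by linarith)
    have := hPle r (by linarith)
    simp only [hQ]
    have h3 : α₁ * (1 + r) ^ (-β) ≤ α₁ * r ^ (-β) := by gcongr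
    have h4 : α₂ * (1 + r) ^ (-κ) ≤ α₂ * r ^ (-κ) := by gcongr
    linarith
  set K : ℝ := E 1 * Real.exp (-1 - H 1) with hK
  have hE1' : 0 < E 1 := lt_of_lt_of_le hφ1' hE1
  have hK0 : 0 < K := by positivity
  have upg : ∀ r, 1 ≤ r → g r ≤ K * Real.exp r := by
    intro r hr
    have mono : MonotoneOn (fun r => -(E r * Real.exp (-r - H r))) (Ici 1) := by
      refine monotoneOn_Ici_of_hasDerivAt
        (f' := fun r => (E r * (α₁ * r ^ (-β) + α₂ * r ^ (-κ) + m * (m - 1) * r⁻¹ ^ 2)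
          - Q r * g r) * Real.exp (-r - H r)) (fun r hr => ?_) (fun r hr => ?_)
      · refine ((dE r (by linarith)).mul
          (((hasDerivAt_id r).neg.sub (dH r (by linarith))).exp)).neg.congr_deriv ?_
        simp only [id, Pi.neg_apply, Pi.sub_apply]
        ring
      · refine mul_nonneg (sub_nonneg.2 ?_) (Real.exp_pos _).le
        have h1 := hgE r (by linarith)
        have h2 := hg0 r (by linarith)
        rw [mul_comm]
        exact mul_le_mul h1 (hQH r hr) (hQ0 r) (h2.trans h1)
    have h := neg_le_neg_iff.1 (mono (mem_Ici.2 le_rfl) (mem_Ici.2 hr) hr)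
    have h1 : E r * Real.exp (-r) ≤ K := by
      refine le_trans ?_ h
      have : 0 ≤ E r := (hg0 r (by linarith)).trans (hgE r (by linarith))
      gcongr
      linarith [hH0 r hr]
    have h3 := mul_le_mul_of_nonneg_right h1 (Real.exp_pos r).le
    rw [mul_assoc, ← Real.exp_add, neg_add_cancel, Real.exp_zero, mul_one] at h3
    exact (hgE r (by linarith)).trans h3
  -- Passage from `r^{-m}` to `(1+r)^{-m}`, and the bounded range of `r`.
  obtain ⟨B, hB⟩ := isCompact_Icc.exists_bound_of_continuousOn
    (s := Icc (0 : ℝ) 1) hφ.continuousOn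
  have hB' : ∀ r ∈ Icc (0 : ℝ) 1, φ r ≤ B := fun r hr => (le_abs_self _).trans (hB r hr)
  have hB1 : 1 ≤ B := (hφ1 0).trans (hB' 0 ⟨le_rfl, zero_le_one⟩)
  have h2m : (0 : ℝ) < 2 ^ m := by positivity
  have w0 : ∀ r, 0 ≤ r → 0 < growthWeight n r := fun r hr => by
    unfold growthWeight
    positivity
  refine ⟨min (1 / Real.exp 1) (k / 2), lt_min (by positivity) (by positivity),
    max (B * 2 ^ m) (K * 2 ^ m), lt_max_of_lt_left (by positivity), fun r hr => ?_⟩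
  rcases le_total r 1 with hr1 | hr1
  · constructor
    · calc _ ≤ 1 / Real.exp 1 * growthWeight n r := by
            have := (w0 r hr).le
            gcongr
            exact min_le_left _ _
        _ ≤ 1 / Real.exp 1 * (1 * Real.exp 1) := by
            unfold growthWeight
            gcongr
            exact Real.rpow_le_one_of_one_le_of_nonpos (by linarith) (by linarith)
        _ = 1 := by field_simp
        _ ≤ φ r := hφ1 r
    · calc φ r ≤ B := hB' r ⟨hr, hr1⟩
        _ = B * 2 ^ m * (2 ^ (-m) * 1) := by
            rw [Real.rpow_neg (by norm_num)]
            field_simp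
        _ ≤ B * 2 ^ m * growthWeight n r := by
            unfold growthWeight
            have h1 : (2 : ℝ) ^ (-m) ≤ (1 + r) ^ (-m) :=
              Real.rpow_le_rpow_of_nonpos (by linarith) (by linarith) (by linarith)
            have h2 : 1 ≤ Real.exp r := Real.one_le_exp hr
            gcongr
        _ ≤ _ := by
            have := (w0 r hr).le
            gcongr
            exact le_max_left _ _
  · have hr0 : 0 < r := by linarith
    have hgφ : φ r = r ^ (-m) * g r := by
      simp only [hg]
      rw [← mul_assoc, ← Real.rpow_add hr0]
      simp
    constructor
    · calc _ ≤ k / 2 * growthWeight n r := by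
            have := (w0 r hr).le
            gcongr
            exact min_le_right _ _
        _ ≤ k / 2 * (r ^ (-m) * Real.exp r) := by
            unfold growthWeight
            have h1 : (1 + r) ^ (-m) ≤ r ^ (-m) :=
              Real.rpow_le_rpow_of_nonpos (by linarith) (by linarith) (by linarith)
            gcongr
        _ = r ^ (-m) * (k / 2 * Real.exp r) := by ring
        _ ≤ r ^ (-m) * g r := by
            have := lowg r hr1
            gcongr
        _ = φ r := hgφ.symm
    · calc φ r = r ^ (-m) * g r := hgφ
        _ ≤ r ^ (-m) * (K * Real.exp r) := by
            have := upg r hr1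
            gcongr
        _ = K * 2 ^ m * ((2 * r) ^ (-m) * Real.exp r) := by
            rw [Real.mul_rpow (by norm_num) hr, Real.rpow_neg (by norm_num : (0:ℝ) ≤ 2)]
            field_simp
        _ ≤ K * 2 ^ m * growthWeight n r := by
            unfold growthWeight
            have h1 : (2 * r) ^ (-m) ≤ (1 + r) ^ (-m) :=
              Real.rpow_le_rpow_of_nonpos (by linarith) (by linarith) (by linarith)
            gcongr
        _ ≤ _ := by
            have := (w0 r hr).le
            gcongr
            exact le_max_right _ _

/-! ### Polynomial approximation -/

lemma radialInverse_even_pow {n : ℕ} (hn : 1 ≤ n) (a : ℝ) (j : ℕ) (r : ℝ) :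
    radialInverse n (fun s => a * (s ^ 2) ^ j) r
      = a / ((n + 2 * j) * (2 * j + 2)) * (r ^ 2) ^ (j + 1) := by
  have h1 : ∀ ρ, radialFlux n (fun s => a * (s ^ 2) ^ j) ρ
      = a / (n + 2 * j) * ρ ^ (2 * j + 1) := by
    intro ρ
    unfold radialFlux
    have : ∀ θ : ℝ, θ ^ (n - 1) * (a * ((ρ * θ) ^ 2) ^ j)
        = a * ρ ^ (2 * j) * θ ^ (n - 1 + 2 * j) := by intro θ; ring
    simp only [this]
    rw [intervalIntegral.integral_const_mul, integral_pow]
    have h2 : ((n - 1 + 2 * j : ℕ) : ℝ) + 1 = n + 2 * j := by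
      have : n - 1 + 2 * j + 1 = n + 2 * j := by omega
      exact_mod_cast this
    rw [h2]
    simp
    ring
  unfold radialInverse
  simp only [h1, mul_pow]
  have : ∀ θ : ℝ, a / (n + 2 * j) * (r ^ (2 * j + 1) * θ ^ (2 * j + 1))
        = a / (n + 2 * j) * r ^ (2 * j + 1) * θ ^ (2 * j + 1) := by intro θ; ring
  simp only [this]
  rw [intervalIntegral.integral_const_mul, integral_pow]
  have : (n : ℝ) + 2 * j ≠ 0 := by positivity
  simp
  field_simp
  ring

/-- On functions that are polynomial in `s = r²` the radial Laplacian is `4 s ∂ₛ² + 2 n ∂ₛ`, and the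
radial inverse preserves this class. -/
lemma exists_polynomial_radialInverse {n : ℕ} (hn : 1 ≤ n) (P : Polynomial ℝ) :
    ∃ Q : Polynomial ℝ,
      (∀ s, 4 * s * Q.derivative.derivative.eval s + 2 * n * Q.derivative.eval s = P.eval s) ∧
      ∀ r, radialInverse n (fun s => P.eval (s ^ 2)) r = Q.eval (r ^ 2) := by
  induction P using Polynomial.induction_on' with
  | add P₁ P₂ h₁ h₂ =>
    obtain ⟨Q₁, d₁, e₁⟩ := h₁
    obtain ⟨Q₂, d₂, e₂⟩ := h₂
    refine ⟨Q₁ + Q₂, fun s => ?_, fun r => ?_⟩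
    · simp only [Polynomial.derivative_add, Polynomial.eval_add]
      rw [← d₁, ← d₂]
      ring
    · have := radialInverse_sub n (g := fun s => P₁.eval (s ^ 2) + P₂.eval (s ^ 2))
        (h := fun s => P₂.eval (s ^ 2)) (by fun_prop) (by fun_prop) r
      simp only [add_sub_cancel_right] at this
      simp only [Polynomial.eval_add]
      rw [← e₁, ← e₂]
      linarith
  | monomial j a =>
    refine ⟨Polynomial.monomial (j + 1) (a / ((n + 2 * j) * (2 * j + 2))), fun s => ?_,
      fun r => ?_⟩
    · have : (n : ℝ) + 2 * j ≠ 0 := by positivity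
      simp only [Polynomial.derivative_monomial, Polynomial.eval_monomial]
      rcases j with _ | j
      · simp
        field_simp
      · simp
        push_cast at this
        field_simp
        ring
    · simp only [Polynomial.eval_monomial]
      exact radialInverse_even_pow hn a j r

/-- The radial solution `φ` and its radial Laplacian `W φ` are simultaneously uniform limits on
`[0, L]` of functions `Q(r²)` and their radial Laplacians `P(r²)`, with polynomials `Q`, `P`. -/
lemma exists_polynomial_near_solution {n : ℕ} (hn : 1 ≤ n) {φ W : ℝ → ℝ} (hφ : Continuous φ)
    (hW : Continuous W) (heq : ∀ r, φ r = 1 + radialInverse n (fun s => W s * φ s) r)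
    (L : ℝ) {δ : ℝ} (hδ : 0 < δ) :
    ∃ P Q : Polynomial ℝ,
      (∀ s, 4 * s * Q.derivative.derivative.eval s + 2 * n * Q.derivative.eval s = P.eval s) ∧
      ∀ r ∈ Icc 0 L, |P.eval (r ^ 2) - W r * φ r| ≤ δ ∧ |Q.eval (r ^ 2) - φ r| ≤ δ := by
  set δ' := δ / (1 + L ^ 2) with hδ'
  have hδ0 : 0 < δ' := by positivity
  have hδ1 : δ' ≤ δ := div_le_self hδ.le (by nlinarith [sq_nonneg L])
  have hδ2 : L ^ 2 * δ' ≤ δ := by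
    rw [hδ', mul_div_assoc', div_le_iff₀ (by positivity)]
    nlinarith [sq_nonneg L]
  obtain ⟨P, hP⟩ := exists_polynomial_near_of_continuousOn 0 (L ^ 2)
    (fun s => W (√s) * φ (√s)) (by fun_prop) δ' hδ0
  have hP' : ∀ r ∈ Icc 0 L, |P.eval (r ^ 2) - W r * φ r| ≤ δ' := by
    intro r hr
    have := (hP (r ^ 2) ⟨sq_nonneg r, pow_le_pow_left₀ hr.1 hr.2 2⟩).le
    rwa [Real.sqrt_sq hr.1] at this
  obtain ⟨Q, hQ, hQK⟩ := exists_polynomial_radialInverse hn P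
  refine ⟨P, 1 + Q, fun s => ?_, fun r hr => ⟨(hP' r hr).trans hδ1, ?_⟩⟩
  · simpa using hQ s
  · rw [Polynomial.eval_add, ← hQK, heq r, Polynomial.eval_one, add_sub_add_left_eq_sub,
      ← radialInverse_sub n (by fun_prop) (by fun_prop)]
    refine (abs_radialInverse_le n r δ' fun θ hθ => hP' _ ⟨mul_nonneg hr.1 hθ.1, ?_⟩).trans ?_
    · exact (mul_le_of_le_one_right hr.1 hθ.2).trans hr.2
    · refine le_trans ?_ hδ2
      have := pow_le_pow_left₀ hr.1 hr.2 2
      gcongr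

/-! ### The weak gradient and the Laplacian -/

/-- The Laplacian of a smooth function, as the sum of its second partial derivatives. -/
def lap {n : ℕ} (ψ : Space n → ℝ) (x : Space n) : ℝ :=
  ∑ i, fderiv ℝ (fun y => fderiv ℝ ψ y (EuclideanSpace.basisFun (Fin n) ℝ i)) x
    (EuclideanSpace.basisFun (Fin n) ℝ i)

lemma inner_gradient {n : ℕ} (ψ : Space n → ℝ) (x v : Space n) :
    inner ℝ v (gradient ψ x) = fderiv ℝ ψ x v := by
  rw [real_inner_comm, gradient, InnerProductSpace.toDual_symm_apply]

lemma contDiff_fderiv_apply {n : ℕ} {ψ : Space n → ℝ} (hψ : ContDiff ℝ ∞ ψ) (v : Space n) :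
    ContDiff ℝ ∞ fun x => fderiv ℝ ψ x v :=
  (hψ.fderiv_right (m := ∞) (by simp)).clm_apply contDiff_const

/-- Green's formula for a function with a weak gradient. -/
lemma HasWeakGradient.integral_inner_gradient {n : ℕ} {f : Space n → ℝ} {g : Space n → Space n}
    (h : HasWeakGradient f g) (hf : LocallyIntegrable f) (hg : LocallyIntegrable g)
    {ψ : Space n → ℝ} (hψ : ContDiff ℝ ∞ ψ) (hc : HasCompactSupport ψ) :
    ∫ x, inner ℝ (g x) (gradient ψ x) = -∫ x, f x * lap ψ x := by
  set b := EuclideanSpace.basisFun (Fin n) ℝ with hb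
  have hψi : ∀ i, ContDiff ℝ ∞ fun x => fderiv ℝ ψ x (b i) := fun i => contDiff_fderiv_apply hψ _
  have hci : ∀ i, HasCompactSupport fun x => fderiv ℝ ψ x (b i) := fun i => hc.fderiv_apply ℝ _
  have e1 : ∀ x, inner ℝ (g x) (gradient ψ x)
      = ∑ i, inner ℝ (b i) (fderiv ℝ ψ x (b i) • g x) := by
    intro x
    rw [← b.sum_inner_mul_inner]
    refine Finset.sum_congr rfl fun i _ => ?_
    rw [inner_gradient, inner_smul_right, real_inner_comm, mul_comm]
  have i1 : ∀ i, Integrable fun x => fderiv ℝ ψ x (b i) • g x := fun i =>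
    hg.integrable_smul_left_of_hasCompactSupport (hψi i).continuous (hci i)
  have i2 : ∀ i, Integrable fun x =>
      f x * fderiv ℝ (fun y => fderiv ℝ ψ y (b i)) x (b i) := fun i => by
    have h1 := hf.integrable_smul_right_of_hasCompactSupport
      (contDiff_fderiv_apply (hψi i) (b i)).continuous ((hci i).fderiv_apply ℝ _)
    simpa using h1
  have i3 : ∀ i, Integrable fun x => f x • gradient (fun y => fderiv ℝ ψ y (b i)) x := fun i => by
    have hcont : Continuous (gradient (fun y => fderiv ℝ ψ y (b i))) := by
      unfold gradient
      exact (LinearIsometryEquiv.continuous _).comp ((hψi i).continuous_fderiv (by simp))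
    refine hf.integrable_smul_right_of_hasCompactSupport hcont ?_
    exact ((hci i).fderiv ℝ).comp_left (map_zero _)
  simp only [e1]
  rw [integral_finsetSum _ fun i _ => (i1 i).const_inner _]
  have e2 : ∀ i, ∫ x, inner ℝ (b i) (fderiv ℝ ψ x (b i) • g x)
      = -∫ x, f x * fderiv ℝ (fun y => fderiv ℝ ψ y (b i)) x (b i) := by
    intro i
    rw [integral_inner (i1 i), ← neg_neg (∫ x, fderiv ℝ ψ x (b i) • g x),
      ← h _ (hψi i) (hci i), inner_neg_right, ← integral_inner (i3 i)]
    congr 2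
    ext x
    rw [inner_smul_right, inner_gradient]
  simp only [e2]
  rw [Finset.sum_neg_distrib, ← integral_finsetSum _ fun i _ => i2 i]
  congr 2
  ext x
  rw [lap, Finset.mul_sum]

lemma lap_congr {n : ℕ} {ψ ψ' : Space n → ℝ} {x : Space n} (h : ψ =ᶠ[𝓝 x] ψ') :
    lap ψ x = lap ψ' x := by
  unfold lap
  refine Finset.sum_congr rfl fun i _ => ?_
  have h1 : (fun y => fderiv ℝ ψ y (EuclideanSpace.basisFun (Fin n) ℝ i)) =ᶠ[𝓝 x]
      fun y => fderiv ℝ ψ' y (EuclideanSpace.basisFun (Fin n) ℝ i) := by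
    filter_upwards [h.fderiv (𝕜 := ℝ)] with y hy
    rw [hy]
  rw [h1.fderiv_eq]

lemma fderiv_polynomial_norm_sq {n : ℕ} (Q : Polynomial ℝ) (x v : Space n) :
    fderiv ℝ (fun y : Space n => Q.eval (‖y‖ ^ 2)) x v
      = Q.derivative.eval (‖x‖ ^ 2) * (2 * inner ℝ x v) := by
  have h1 : HasFDerivAt (fun y : Space n => ‖y‖ ^ 2) _ x := (hasFDerivAt_id x).norm_sq
  have h2 := (Q.hasDerivAt (‖x‖ ^ 2)).comp_hasFDerivAt x h1
  have h3 : fderiv ℝ (fun y : Space n => Q.eval (‖y‖ ^ 2)) x = _ := h2.fderiv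
  rw [h3]
  simp

lemma lap_polynomial_norm_sq {n : ℕ} (Q : Polynomial ℝ) (x : Space n) :
    lap (fun y : Space n => Q.eval (‖y‖ ^ 2)) x
      = 4 * ‖x‖ ^ 2 * Q.derivative.derivative.eval (‖x‖ ^ 2)
        + 2 * n * Q.derivative.eval (‖x‖ ^ 2) := by
  unfold lap
  set b := EuclideanSpace.basisFun (Fin n) ℝ with hb
  have h1 : ∀ i, fderiv ℝ (fun y : Space n =>
        fderiv ℝ (fun y : Space n => Q.eval (‖y‖ ^ 2)) y (b i)) x (b i)
      = Q.derivative.derivative.eval (‖x‖ ^ 2) * 4 * (inner ℝ x (b i) * inner ℝ (b i) x)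
        + 2 * Q.derivative.eval (‖x‖ ^ 2) := by
    intro i
    simp only [fderiv_polynomial_norm_sq]
    have d1 : DifferentiableAt ℝ (fun y : Space n => Q.derivative.eval (‖y‖ ^ 2)) x :=
      (Q.derivative.differentiable.comp (contDiff_norm_sq ℝ (n := 1) |>.differentiable
        (by simp))).differentiableAt
    have d2 : HasFDerivAt (fun y : Space n => 2 * inner ℝ y (b i))
        ((2 : ℝ) • (innerSL ℝ (b i))) x := by
      have : (fun y : Space n => 2 * inner ℝ y (b i)) = fun y => 2 * innerSL ℝ (b i) y := by
        ext y; rw [innerSL_apply_apply, real_inner_comm]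
      rw [this]
      exact (innerSL ℝ (b i)).hasFDerivAt.const_mul 2
    have d3 : fderiv ℝ (fun y : Space n => Q.derivative.eval (‖y‖ ^ 2) * (2 * inner ℝ y (b i))) x
        = _ := (d1.hasFDerivAt.mul d2).fderiv
    rw [d3]
    simp only [_root_.add_apply, _root_.smul_apply, innerSL_apply_apply,
      fderiv_polynomial_norm_sq, smul_eq_mul]
    rw [real_inner_self_eq_norm_sq, b.norm_eq_one, real_inner_comm x (b i)]
    ring
  simp only [h1]
  rw [Finset.sum_add_distrib, ← Finset.mul_sum, b.sum_inner_mul_inner, real_inner_self_eq_norm_sq]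
  simp
  ring

/-! ### Local integrability up to the initial time -/

/-- Local integrability on `[0,T) × ℝⁿ`: integrability on `(0,τ] × B_L` for all `τ < T` and `L`. -/
def IntegrableUpToZero {n : ℕ} {F : Type*} [NormedAddCommGroup F] (T : ℝ)
    (f : ℝ × Space n → F) : Prop :=
  ∀ τ < T, ∀ L : ℝ, IntegrableOn f (Ioc 0 τ ×ˢ Metric.closedBall 0 L)

lemma measurableSet_slab (n : ℕ) (T : ℝ) : MeasurableSet (slab n T) :=
  measurableSet_Ioo.prod MeasurableSet.univ

lemma ContL2.exists_bound {n : ℕ} {F : Type} [NormedAddCommGroup F] {T τ : ℝ}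
    {U : ℝ → Lp F 2 (volume : Measure (Space n))} (hU : ContinuousOn U (Ico 0 T)) (hτ : τ < T) :
    ∃ B : ℝ, ∀ t ∈ Icc 0 τ, ‖U t‖ ≤ B :=
  isCompact_Icc.exists_bound_of_continuousOn (hU.mono (Icc_subset_Ico_right hτ))

lemma ContL2.memLp {n : ℕ} {F : Type} [NormedAddCommGroup F] {T : ℝ} {f : ℝ × Space n → F}
    (h : ContL2 T f) {t : ℝ} (ht : t ∈ Ico 0 T) : MemLp (fun x => f (t, x)) 2 volume := by
  obtain ⟨-, U, hU, -⟩ := h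
  exact (memLp_congr_ae (hU t ht)).1 (Lp.memLp _)

lemma ContL2.locallyIntegrable {n : ℕ} {F : Type} [NormedAddCommGroup F] {T : ℝ}
    {f : ℝ × Space n → F} (h : ContL2 T f) {t : ℝ} (ht : t ∈ Ico 0 T) :
    LocallyIntegrable (fun x => f (t, x)) volume :=
  (h.memLp ht).locallyIntegrable (by norm_num)

lemma ContL2.integrableUpToZero {n : ℕ} {F : Type} [NormedAddCommGroup F] {T : ℝ}
    {f : ℝ × Space n → F} (h : ContL2 T f) : IntegrableUpToZero T f := by
  intro τ hτ L
  obtain ⟨hm, U, hU, hcont⟩ := h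
  obtain ⟨B, hB⟩ := ContL2.exists_bound hcont hτ
  have hsub : Ioc 0 τ ×ˢ Metric.closedBall (0 : Space n) L ⊆ slab n T := by
    rintro ⟨t, x⟩ ⟨ht, -⟩
    exact ⟨⟨ht.1, ht.2.trans_lt hτ⟩, mem_univ _⟩
  have hm' := hm.mono_measure (Measure.restrict_mono hsub le_rfl)
  refine ⟨hm', ?_⟩
  rw [Measure.volume_eq_prod, ← Measure.prod_restrict] at hm' ⊢
  rw [hasFiniteIntegral_iff_enorm, lintegral_prod _ hm'.enorm]
  set μ := (volume : Measure (Space n)).restrict (Metric.closedBall 0 L) with hμ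
  have hμfin : μ univ < ⊤ := by
    rw [hμ, Measure.restrict_apply_univ]
    exact measure_closedBall_lt_top
  have hle : ∀ t ∈ Ioc 0 τ, ∫⁻ x, ‖f (t, x)‖ₑ ∂μ
      ≤ ENNReal.ofReal B * μ univ ^ (1 / (1 : ℝ≥0∞).toReal - 1 / (2 : ℝ≥0∞).toReal) := by
    intro t ht
    have ht' : t ∈ Ico 0 T := ⟨ht.1.le, ht.2.trans_lt hτ⟩
    have hae : U t =ᵐ[μ] fun x => f (t, x) := ae_restrict_of_ae (hU t ht')
    rw [← eLpNorm_one_eq_lintegral_enorm (f := fun x => f (t, x)), ← eLpNorm_congr_ae hae]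
    refine (eLpNorm_le_eLpNorm_mul_rpow_measure_univ (p := 1) (q := 2) (by norm_num)
      ((Lp.aestronglyMeasurable _).mono_measure Measure.restrict_le_self)).trans ?_
    gcongr
    refine (eLpNorm_mono_measure _ Measure.restrict_le_self).trans ?_
    have := hB t ⟨ht.1.le, ht.2⟩
    rw [Lp.norm_def] at this
    rw [← ENNReal.ofReal_toReal (Lp.eLpNorm_ne_top (U t))]
    exact ENNReal.ofReal_le_ofReal this
  refine (setLIntegral_mono' measurableSet_Ioc hle).trans_lt ?_
  rw [lintegral_const, Measure.restrict_apply_univ]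
  refine ENNReal.mul_lt_top (ENNReal.mul_lt_top ENNReal.ofReal_lt_top ?_) (by simp)
  refine ENNReal.rpow_lt_top_of_nonneg ?_ measure_closedBall_lt_top.ne
  norm_num

/-- Products with a function that is bounded, and zero outside a set `(0,τ] × B_L`, are integrable
on the slab. -/
lemma IntegrableUpToZero.integrableOn_smul {n : ℕ} {F : Type*} [NormedAddCommGroup F]
    [NormedSpace ℝ F] {T τ : ℝ} {f : ℝ × Space n → F} (h : IntegrableUpToZero T f) (hτ : τ < T)
    {b : ℝ → ℝ} {g : Space n → ℝ} (hb : Continuous b) (hb0 : ∀ t, τ ≤ t → b t = 0)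
    (hg : Continuous g) (hg0 : HasCompactSupport g) :
    IntegrableOn (fun z => (b z.1 * g z.2) • f z) (slab n T) := by
  obtain ⟨L, hL⟩ := hg0.isCompact.isBounded.subset_closedBall 0
  have hzero : ∀ z ∈ slab n T \ (Ioc 0 τ ×ˢ Metric.closedBall 0 L), (b z.1 * g z.2) • f z = 0 := by
    rintro ⟨t, x⟩ ⟨hz, hz'⟩
    have ht : 0 < t := hz.1.1
    by_cases h1 : t ≤ τ
    · have hx : x ∉ Metric.closedBall 0 L := fun hx => hz' ⟨⟨ht, h1⟩, hx⟩
      have : g x = 0 := by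
        by_contra hne
        exact hx (hL (subset_tsupport _ hne))
      simp [this]
    · simp [hb0 t (not_le.1 h1).le]
  refine IntegrableOn.of_forall_sdiff_eq_zero ?_ (measurableSet_slab n T) hzero
  obtain ⟨B, hB⟩ := (isCompact_Icc (a := (0 : ℝ)) (b := τ)).exists_bound_of_continuousOn
    hb.continuousOn
  obtain ⟨C, hC⟩ := hg0.exists_bound_of_continuous hg
  refine Integrable.bdd_smul (φ := fun z : ℝ × Space n => b z.1 * g z.2) (h τ hτ L) (B * C) ?_ ?_
  · exact Continuous.aestronglyMeasurable (by fun_prop)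
  · refine (ae_restrict_iff' (measurableSet_Ioc.prod measurableSet_closedBall)).2
      (ae_of_all _ ?_)
    rintro ⟨t, x⟩ ⟨ht, -⟩
    rw [norm_mul]
    exact mul_le_mul (hB t ⟨ht.1.le, ht.2⟩) (hC x) (norm_nonneg _)
      ((norm_nonneg _).trans (hB t ⟨ht.1.le, ht.2⟩))

lemma setIntegral_slab {n : ℕ} {F : Type*} [NormedAddCommGroup F] [NormedSpace ℝ F] {T : ℝ}
    {f : ℝ × Space n → F} (h : IntegrableOn f (slab n T)) :
    ∫ z in slab n T, f z = ∫ t in Ioo 0 T, ∫ x, f (t, x) := by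
  unfold slab at *
  rw [Measure.volume_eq_prod] at *
  rw [setIntegral_prod _ h]
  simp

/-! ### Calculus in time -/

/-- The time derivative inherits the finite speed of propagation. -/
lemma HasTimeDerivL2.finiteSpeed {n : ℕ} {T R : ℝ} {u ut : ℝ × Space n → ℝ}
    (h : HasTimeDerivL2 T u ut) (hs : FiniteSpeed R T u) : FiniteSpeed R T ut := by
  obtain ⟨U, U', hU, hU', hd⟩ := h
  intro t ht
  have key : ∀ k : ℕ, ∀ᵐ x, t + 1 / ((k : ℝ) + 1) + R < ‖x‖ → ut (t, x) = 0 := by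
    intro k
    have hδ : 0 < 1 / ((k : ℝ) + 1) := by positivity
    set δ := 1 / ((k : ℝ) + 1)
    set S : Set (Space n) := {x | t + δ + R < ‖x‖} with hS
    have hSm : MeasurableSet S := measurableSet_lt measurable_const measurable_norm
    set L := LpToLpRestrictCLM (Space n) ℝ ℝ volume 2 S
    have hsub : Ico 0 (min T (t + δ)) ⊆ Ico 0 T := Ico_subset_Ico_right (min_le_left _ _)
    have ht' : t ∈ Ico 0 (min T (t + δ)) := ⟨ht.1, lt_min ht.2 (by linarith)⟩
    have hL0 : ∀ s ∈ Ico 0 (min T (t + δ)), L (U s) = 0 := by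
      intro s hs'
      rw [Lp.eq_zero_iff_ae_eq_zero]
      have hsT := hsub hs'
      have hsδ : s < t + δ := hs'.2.trans_le (min_le_right _ _)
      filter_upwards [LpToLpRestrictCLM_coeFn ℝ S (U s), ae_restrict_of_ae (hU s hsT),
        ae_restrict_of_ae (hs s hsT), ae_restrict_mem hSm] with x h1 h2 h3 h4
      have h5 : t + δ + R < ‖x‖ := h4
      rw [h1, h2, h3 (by linarith)]
      rfl
    have hder : HasDerivWithinAt (fun s => L (U s)) (L (U' t)) (Ico 0 (min T (t + δ))) t :=
      L.hasFDerivAt.comp_hasDerivWithinAt t ((hd t ht).mono hsub)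
    have hder0 : HasDerivWithinAt (fun s => L (U s)) 0 (Ico 0 (min T (t + δ))) t :=
      (hasDerivWithinAt_const t _ (0 : Lp ℝ 2 (volume.restrict S))).congr hL0 (hL0 t ht')
    have hz : L (U' t) = 0 := (uniqueDiffOn_Ico _ _ t ht').eq_deriv _ hder hder0
    have hz' := (Lp.eq_zero_iff_ae_eq_zero).1 hz
    have : ∀ᵐ x ∂(volume.restrict S), ut (t, x) = 0 := by
      filter_upwards [LpToLpRestrictCLM_coeFn ℝ S (U' t), ae_restrict_of_ae (hU' t ht), hz']
        with x h1 h2 h3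
      rw [← h2, ← h1, h3]
      rfl
    exact (ae_restrict_iff' hSm).1 this
  filter_upwards [ae_all_iff.2 key] with x hx hlt
  obtain ⟨k, hk⟩ := exists_nat_one_div_lt (sub_pos.2 hlt)
  exact hx k (by linarith)

lemma pairing_eq_inner {n : ℕ} {g : Space n → ℝ} (hg : MemLp g 2 volume)
    {U : Lp ℝ 2 (volume : Measure (Space n))} {f : Space n → ℝ} (hU : U =ᵐ[volume] f) :
    ∫ x, g x * f x = inner ℝ (hg.toLp g) U := by
  rw [L2.inner_def]
  refine integral_congr_ae ?_
  filter_upwards [hU, hg.coeFn_toLp] with x h1 h2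
  rw [h1, h2]
  simp [mul_comm]

lemma HasTimeDerivL2.hasDerivWithinAt_pairing {n : ℕ} {T : ℝ} {u ut : ℝ × Space n → ℝ}
    (h : HasTimeDerivL2 T u ut) {g : Space n → ℝ} (hg : MemLp g 2 volume) {t : ℝ}
    (ht : t ∈ Ico 0 T) :
    HasDerivWithinAt (fun t => ∫ x, g x * u (t, x)) (∫ x, g x * ut (t, x)) (Ico 0 T) t := by
  obtain ⟨U, U', hU, hU', hd⟩ := h
  rw [pairing_eq_inner hg (hU' t ht)]
  have h1 : HasDerivWithinAt (fun t => inner ℝ (hg.toLp g) (U t)) (inner ℝ (hg.toLp g) (U' t))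
      (Ico 0 T) t := by
    have := (hasDerivWithinAt_const t (Ico 0 T) (hg.toLp g)).inner ℝ (hd t ht)
    simpa using this
  exact h1.congr (fun s hs => pairing_eq_inner hg (hU s hs)) (pairing_eq_inner hg (hU t ht))

lemma ContL2.continuousOn_pairing {n : ℕ} {T : ℝ} {f : ℝ × Space n → ℝ}
    (h : ContL2 T f) {g : Space n → ℝ} (hg : MemLp g 2 volume) :
    ContinuousOn (fun t => ∫ x, g x * f (t, x)) (Ico 0 T) := by
  obtain ⟨-, U, hU, hc⟩ := h
  exact (continuousOn_const.inner hc).congr fun s hs => pairing_eq_inner hg (hU s hs)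

lemma setIntegral_slab_mul {n : ℕ} {T τ : ℝ} {f : ℝ × Space n → ℝ} (hf : IntegrableUpToZero T f)
    (hτ0 : 0 ≤ τ) (hτ : τ < T) {b : ℝ → ℝ} {g : Space n → ℝ} (hb : Continuous b)
    (hb0 : ∀ t, τ ≤ t → b t = 0) (hg : Continuous g) (hg0 : HasCompactSupport g) :
    ∫ z in slab n T, (b z.1 * g z.2) * f z = ∫ t in (0 : ℝ)..τ, b t * ∫ x, g x * f (t, x) := by
  have h := setIntegral_slab (hf.integrableOn_smul hτ hb hb0 hg hg0)
  simp only [smul_eq_mul] at h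
  rw [h, intervalIntegral.integral_of_le hτ0]
  simp only [mul_assoc, integral_const_mul]
  refine setIntegral_eq_of_subset_of_forall_sdiff_eq_zero measurableSet_Ioo
    (fun t ht => ⟨ht.1, ht.2.trans_lt hτ⟩) ?_
  rintro t ⟨ht, ht'⟩
  have : τ ≤ t := by
    by_contra hlt
    exact ht' ⟨ht.1, (not_le.1 hlt).le⟩
  simp [hb0 t this]

/-- Integration by parts in time: if `A' = -a` and `A = 0` from the time `τ` on, an integral of `a w`
becomes an integral of `A w_t` and a boundary term at `t = 0`. -/
lemma EnergyClass.integral_by_parts {n : ℕ} {T τ : ℝ} {w wt : ℝ × Space n → ℝ}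
    {gw : ℝ × Space n → Space n} (hE : EnergyClass T w wt gw) (hτ0 : 0 ≤ τ) (hτ : τ < T)
    {a A : ℝ → ℝ} (ha : Continuous a) (hA : Continuous A) (ha0 : ∀ t, τ ≤ t → a t = 0)
    (hA0 : ∀ t, τ ≤ t → A t = 0) (hd : ∀ t ∈ Ioo 0 τ, HasDerivAt A (-a t) t)
    {g : Space n → ℝ} (hg : Continuous g) (hg0 : HasCompactSupport g) :
    ∫ z in slab n T, (a z.1 * g z.2) * w z
      = A 0 * (∫ x, g x * w (0, x)) + ∫ z in slab n T, (A z.1 * g z.2) * wt z := by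
  have hgL : MemLp g 2 volume := hg.memLp_of_hasCompactSupport hg0
  rw [setIntegral_slab_mul hE.cont.integrableUpToZero hτ0 hτ ha ha0 hg hg0,
    setIntegral_slab_mul hE.cont_time.integrableUpToZero hτ0 hτ hA hA0 hg hg0]
  have hsub : Icc 0 τ ⊆ Ico 0 T := Icc_subset_Ico_right hτ
  have cF : ContinuousOn (fun t => ∫ x, g x * w (t, x)) (Icc 0 τ) :=
    (hE.cont.continuousOn_pairing hgL).mono hsub
  have cG : ContinuousOn (fun t => ∫ x, g x * wt (t, x)) (Icc 0 τ) :=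
    (hE.cont_time.continuousOn_pairing hgL).mono hsub
  have dF : ∀ t ∈ Ioo 0 τ, HasDerivAt (fun t => ∫ x, g x * w (t, x)) (∫ x, g x * wt (t, x)) t :=
    fun t ht => (hE.time_deriv.hasDerivWithinAt_pairing hgL (hsub ⟨ht.1.le, ht.2.le⟩)).hasDerivAt
      (Ico_mem_nhds ht.1 (ht.2.trans hτ))
  have i1 : IntervalIntegrable (fun t => a t * ∫ x, g x * w (t, x)) volume 0 τ :=
    ContinuousOn.intervalIntegrable (by rw [uIcc_of_le hτ0]; exact ha.continuousOn.mul cF)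
  have i2 : IntervalIntegrable (fun t => A t * ∫ x, g x * wt (t, x)) volume 0 τ :=
    ContinuousOn.intervalIntegrable (by rw [uIcc_of_le hτ0]; exact hA.continuousOn.mul cG)
  have key := intervalIntegral.integral_eq_sub_of_hasDerivAt_of_le hτ0
    (f := fun t => A t * ∫ x, g x * w (t, x))
    (f' := fun t => A t * (∫ x, g x * wt (t, x)) - a t * ∫ x, g x * w (t, x))
    (hA.continuousOn.mul cF)
    (fun t ht => ((hd t ht).mul (dF t ht)).congr_deriv (by ring)) (i2.sub i1)
  rw [intervalIntegral.integral_sub i2 i1, hA0 τ le_rfl] at key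
  linarith

/-! ### Test functions -/

lemma isTestFunction_mul {n : ℕ} {T τ : ℝ} (hτ : τ < T) {a : ℝ → ℝ} {ψ : Space n → ℝ}
    (ha : ContDiff ℝ ∞ a) (hac : HasCompactSupport a) (ha0 : ∀ t, τ ≤ t → a t = 0)
    (hψ : ContDiff ℝ ∞ ψ) (hψc : HasCompactSupport ψ) :
    IsTestFunction T fun z : ℝ × Space n => a z.1 * ψ z.2 where
  smooth := (ha.comp contDiff_fst).mul (hψ.comp contDiff_snd)
  compact := by
    refine HasCompactSupport.intro (hac.isCompact.prod hψc.isCompact) fun z hz => ?_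
    by_cases h : z.1 ∈ tsupport a
    · have : z.2 ∉ tsupport ψ := fun h' => hz ⟨h, h'⟩
      rw [image_eq_zero_of_notMem_tsupport this, mul_zero]
    · rw [image_eq_zero_of_notMem_tsupport h, zero_mul]
  support_subset := by
    have h1 : tsupport (fun z : ℝ × Space n => a z.1 * ψ z.2) ⊆ Iic τ ×ˢ univ := by
      refine closure_minimal (fun z hz => ⟨?_, mem_univ _⟩) (isClosed_Iic.prod isClosed_univ)
      by_contra hlt
      exact hz (by simp [ha0 z.1 (not_le.1 hlt).le])
    exact h1.trans (prod_mono (Iic_subset_Iio.2 hτ) le_rfl)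

lemma dt_mul {n : ℕ} (a : ℝ → ℝ) (ψ : Space n → ℝ) (z : ℝ × Space n) :
    dt (fun z : ℝ × Space n => a z.1 * ψ z.2) z = deriv a z.1 * ψ z.2 := by
  simp [dt]

lemma inner_dx_mul {n : ℕ} (a : ℝ → ℝ) {ψ : Space n → ℝ} (hψ : ContDiff ℝ ∞ ψ)
    (z : ℝ × Space n) (v : Space n) :
    inner ℝ v (dx (fun z : ℝ × Space n => a z.1 * ψ z.2) z)
      = a z.1 * inner ℝ v (gradient ψ z.2) := by
  have : DifferentiableAt ℝ ψ z.2 := (hψ.differentiable (by simp)).differentiableAt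
  rw [dx, inner_gradient, inner_gradient]
  change fderiv ℝ (fun y => a z.1 * ψ y) z.2 v = _
  rw [fderiv_const_mul this]
  rfl

/-- The nonlinearity of a weak solution is integrable up to the initial time, since test functions
may be equal to `1` on `[0,τ] × B_L`. -/
lemma WeakEquation.integrableUpToZero {n : ℕ} {T ε : ℝ} {D V w₀ w₁ : Space n → ℝ}
    {w wt : ℝ × Space n → ℝ} {gw : ℝ × Space n → Space n} {N : ℝ × Space n → ℝ}
    (h : WeakEquation T ε D V w₀ w₁ w wt gw N) : IntegrableUpToZero T N := by
  intro τ hτ L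
  rcases le_or_gt τ 0 with h0 | h0
  · simp [Ioc_eq_empty (not_lt.2 h0)]
  let a : ContDiffBump (0 : ℝ) := ⟨τ, (τ + T) / 2, h0, by linarith⟩
  let χ : ContDiffBump (0 : Space n) := ⟨max L 1, max L 1 + 1, by positivity, by linarith⟩
  have hT : IsTestFunction T fun z : ℝ × Space n => a z.1 * χ z.2 :=
    isTestFunction_mul (τ := (τ + T) / 2) (by linarith) a.contDiff a.hasCompactSupport
      (fun t ht => a.zero_of_le_dist (by
        rw [Real.dist_eq, sub_zero]; exact ht.trans (le_abs_self t)))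
      χ.contDiff χ.hasCompactSupport
  have hsub : Ioc 0 τ ×ˢ Metric.closedBall (0 : Space n) L ⊆ slab n T := by
    rintro ⟨t, x⟩ ⟨ht, -⟩
    exact ⟨⟨ht.1, ht.2.trans_lt hτ⟩, mem_univ _⟩
  refine ((h _ hT).1.mono_set hsub).congr_fun ?_ (measurableSet_Ioc.prod measurableSet_closedBall)
  rintro ⟨t, x⟩ ⟨ht, hx⟩
  have h1 : a t = 1 := a.one_of_mem_closedBall (by
    rw [Metric.mem_closedBall, Real.dist_eq, sub_zero, abs_of_pos ht.1]; exact ht.2)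
  have h2 : χ x = 1 := χ.one_of_mem_closedBall (Metric.closedBall_subset_closedBall
    (le_max_left L 1) hx)
  simp [h1, h2]

/-! ### The identity for solutions tested with the eigenfunction -/

lemma tendsto_integral_mul_of_approx {α : Type*} [MeasurableSpace α] {μ : Measure α}
    {F h : α → ℝ} {hk : ℕ → α → ℝ} (hF : Integrable F μ) (hFh : Integrable (fun z => F z * h z) μ)
    (hm : ∀ k, AEStronglyMeasurable (hk k) μ)
    (happ : ∀ k z, F z ≠ 0 → |hk k z - h z| ≤ 1 / ((k : ℝ) + 1)) :
    Tendsto (fun k => ∫ z, F z * hk k z ∂μ) atTop (𝓝 (∫ z, F z * h z ∂μ)) := by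
  refine tendsto_integral_of_dominated_convergence (fun z => ‖F z * h z‖ + ‖F z‖)
    (fun k => hF.aestronglyMeasurable.mul (hm k)) (hFh.norm.add hF.norm) ?_ ?_
  · refine fun k => ae_of_all _ fun z => ?_
    by_cases hz : F z = 0
    · simp [hz]
    have h1 := happ k z hz
    have h2 : 1 / ((k : ℝ) + 1) ≤ 1 := by
      rw [div_le_one (by positivity)]
      have : (0 : ℝ) ≤ k := k.cast_nonneg
      linarith
    have h3 : F z * hk k z = F z * h z + F z * (hk k z - h z) := by ring
    rw [h3]
    refine (norm_add_le _ _).trans ?_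
    gcongr
    rw [norm_mul]
    exact mul_le_of_le_one_right (norm_nonneg _) (h1.trans h2)
  · refine ae_of_all _ fun z => ?_
    by_cases hz : F z = 0
    · simp [hz]
    refine Tendsto.const_mul _ ?_
    rw [tendsto_iff_norm_sub_tendsto_zero]
    exact squeeze_zero (fun _ => norm_nonneg _) (fun k => happ k z hz)
      tendsto_one_div_add_atTop_nhds_zero_nat

lemma tendsto_slab_of_approx {n : ℕ} {T τ : ℝ} {f : ℝ × Space n → ℝ} (hf : IntegrableUpToZero T f)
    (hτ : τ < T) {b : ℝ → ℝ} {c h : Space n → ℝ} {hk : ℕ → Space n → ℝ} (hb : Continuous b)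
    (hb0 : ∀ t, τ ≤ t → b t = 0) (hc : Continuous c) (hc0 : HasCompactSupport c)
    (hh : Continuous h) (hhk : ∀ k, Continuous (hk k))
    (happ : ∀ k x, c x ≠ 0 → |hk k x - h x| ≤ 1 / ((k : ℝ) + 1)) :
    Tendsto (fun k => ∫ z in slab n T, (b z.1 * c z.2 * f z) * hk k z.2) atTop
      (𝓝 (∫ z in slab n T, (b z.1 * c z.2 * f z) * h z.2)) := by
  refine tendsto_integral_mul_of_approx (h := fun z : ℝ × Space n => h z.2)
    (hk := fun k z => hk k z.2) ?_ ?_ (fun k => ?_) ?_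
  · exact hf.integrableOn_smul hτ hb hb0 hc hc0
  · refine (hf.integrableOn_smul hτ hb hb0 (hc.mul hh) hc0.mul_right).congr_fun (fun z _ => ?_)
      (measurableSet_slab n T)
    simp only [Pi.mul_apply, smul_eq_mul]
    ring
  · exact ((hhk k).comp continuous_snd).aestronglyMeasurable
  · intro k z hz
    refine happ k z.2 fun h0 => hz ?_
    simp [h0]

lemma contDiff_polynomial_norm_sq {n : ℕ} (Q : Polynomial ℝ) :
    ContDiff ℝ ∞ fun x : Space n => Q.eval (‖x‖ ^ 2) := by
  have h : ContDiff ℝ ∞ fun s : ℝ => Q.eval s := by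
    simpa using Polynomial.contDiff_aeval (𝕜 := ℝ) Q ∞
  exact h.comp (contDiff_norm_sq ℝ)

/-- The gradient term of the weak formulation for the test function `a(t) χ(x) Q(|x|²)`, where
`χ = 1` on the support of the solution. -/
lemma EnergyClass.integral_inner_dx {n : ℕ} {T τ R : ℝ} {w wt : ℝ × Space n → ℝ}
    {gw : ℝ × Space n → Space n} (hE : EnergyClass T w wt gw) (hs : FiniteSpeed R T w)
    (hτ : τ < T) {a : ℝ → ℝ} (ha : Continuous a) (ha0 : ∀ t, τ ≤ t → a t = 0)
    {χ : Space n → ℝ} (hχ : ContDiff ℝ ∞ χ) (hχc : HasCompactSupport χ)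
    (hχ1 : ∀ x, ‖x‖ < T + R → χ x = 1) {P Q : Polynomial ℝ}
    (hPQ : ∀ s, 4 * s * Q.derivative.derivative.eval s + 2 * n * Q.derivative.eval s = P.eval s) :
    ∫ z in slab n T, inner ℝ (gw z)
        (dx (fun z : ℝ × Space n => a z.1 * (χ z.2 * Q.eval (‖z.2‖ ^ 2))) z)
      = -∫ z in slab n T, (a z.1 * χ z.2 * w z) * P.eval (‖z.2‖ ^ 2) := by
  set ψ : Space n → ℝ := fun x => χ x * Q.eval (‖x‖ ^ 2) with hψdef
  have hQc : ContDiff ℝ ∞ fun x : Space n => Q.eval (‖x‖ ^ 2) :=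
    contDiff_polynomial_norm_sq Q
  have hψ : ContDiff ℝ ∞ ψ := hχ.mul hQc
  have hψc : HasCompactSupport ψ := hχc.mul_right
  have hdx : ∀ z : ℝ × Space n, inner ℝ (gw z) (dx (fun z : ℝ × Space n => a z.1 * ψ z.2) z)
      = a z.1 * inner ℝ (gw z) (gradient ψ z.2) := fun z => inner_dx_mul a hψ z (gw z)
  have hlap : ∀ x : Space n, ‖x‖ < T + R → lap ψ x = χ x * P.eval (‖x‖ ^ 2) := by
    intro x hx
    have h1 : ψ =ᶠ[𝓝 x] fun y => Q.eval (‖y‖ ^ 2) := by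
      filter_upwards [continuous_norm.continuousAt.eventually_lt continuousAt_const hx] with y hy
      rw [hψdef]
      simp only
      rw [hχ1 y hy, one_mul]
    rw [lap_congr h1, lap_polynomial_norm_sq, hPQ, hχ1 x hx, one_mul]
  have hint : IntegrableOn (fun z => a z.1 * inner ℝ (gw z) (gradient ψ z.2)) (slab n T) := by
    set b := EuclideanSpace.basisFun (Fin n) ℝ
    have h1 : ∀ z : ℝ × Space n, a z.1 * inner ℝ (gw z) (gradient ψ z.2)
        = ∑ i, inner ℝ (b i) ((a z.1 * fderiv ℝ ψ z.2 (b i)) • gw z) := by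
      intro z
      rw [← b.sum_inner_mul_inner, Finset.mul_sum]
      refine Finset.sum_congr rfl fun i _ => ?_
      rw [inner_gradient, inner_smul_right, real_inner_comm]
      ring
    simp only [h1]
    refine integrable_finsetSum _ fun i _ => Integrable.const_inner _ ?_
    exact hE.cont_grad.integrableUpToZero.integrableOn_smul hτ ha ha0
      (contDiff_fderiv_apply hψ _).continuous (hψc.fderiv_apply ℝ _)
  have hPcont : Continuous fun x : Space n => P.eval (‖x‖ ^ 2) := by fun_prop
  have hint2 : IntegrableOn (fun z : ℝ × Space n => (a z.1 * χ z.2 * w z) * P.eval (‖z.2‖ ^ 2))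
      (slab n T) := by
    refine (hE.cont.integrableUpToZero.integrableOn_smul hτ ha ha0 (hχ.continuous.mul hPcont)
      hχc.mul_right).congr_fun (fun z _ => ?_) (measurableSet_slab n T)
    simp only [Pi.mul_apply, smul_eq_mul]
    ring
  have e : ∫ z in slab n T, inner ℝ (gw z) (dx (fun z : ℝ × Space n => a z.1 * ψ z.2) z)
      = ∫ z in slab n T, a z.1 * inner ℝ (gw z) (gradient ψ z.2) :=
    integral_congr_ae (ae_of_all _ hdx)
  rw [e, setIntegral_slab hint, setIntegral_slab hint2, ← integral_neg]
  refine setIntegral_congr_fun measurableSet_Ioo fun t ht => ?_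
  have ht' : t ∈ Ico 0 T := ⟨ht.1.le, ht.2⟩
  change ∫ x, a t * inner ℝ (gw (t, x)) (gradient ψ x)
    = -∫ x, a t * χ x * w (t, x) * P.eval (‖x‖ ^ 2)
  rw [integral_const_mul, (hE.weak_grad t ht').integral_inner_gradient (hE.cont.locallyIntegrable ht')
    (hE.cont_grad.locallyIntegrable ht') hψ hψc, mul_neg, ← integral_const_mul]
  congr 1
  refine integral_congr_ae ?_
  filter_upwards [hs t ht'] with x hx
  by_cases hlt : t + R < ‖x‖
  · simp [hx hlt]
  · rw [hlap x (by linarith [ht.2])]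
    ring

/-- Testing a weak solution with `a(t) φ(|x|)`, where `Δφ = (1 + D + V) φ`: the integrals of the
solution itself are turned into integrals of its time derivative by means of the antiderivative
`-A` of `a`. The cutoff `χ` is `1` on the support of the solution. -/
theorem WeakEquation.eigenfunction_identity {n : ℕ} (hn : 1 ≤ n) {T τ ε R : ℝ} (hτ0 : 0 ≤ τ)
    (hτ : τ < T) {D V w₀ w₁ : Space n → ℝ} (hD : Continuous D) (hV : Continuous V)
    (hw₀ : Continuous w₀) (hw₁ : Continuous w₁) {w wt : ℝ × Space n → ℝ}
    {gw : ℝ × Space n → Space n} {N : ℝ × Space n → ℝ} (hE : EnergyClass T w wt gw)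
    (hI : InitialConditions ε w₀ w₁ w wt) (hs : FiniteSpeed R T w)
    (h : WeakEquation T ε D V w₀ w₁ w wt gw N) {φ W : ℝ → ℝ} (hφ : Continuous φ)
    (hW : Continuous W) (heq : ∀ r, φ r = 1 + radialInverse n (fun s => W s * φ s) r)
    (hWD : ∀ x : Space n, W ‖x‖ = 1 + D x + V x)
    {χ : Space n → ℝ} (hχ : ContDiff ℝ ∞ χ) (hχc : HasCompactSupport χ)
    (hχ1 : ∀ x, ‖x‖ < T + R → χ x = 1) {a A : ℝ → ℝ} (ha : ContDiff ℝ ∞ a)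
    (hac : HasCompactSupport a) (ha0 : ∀ t, τ ≤ t → a t = 0) (hA : Continuous A)
    (hA0 : ∀ t, τ ≤ t → A t = 0) (hAa : ∀ t ∈ Ioo 0 τ, HasDerivAt A (-a t) t) :
    ε * (a 0 * ∫ x, w₁ x * (χ x * φ ‖x‖)) + ε * (A 0 * ∫ x, (1 + D x) * w₀ x * (χ x * φ ‖x‖))
        + ∫ z in slab n T, (a z.1 * (χ z.2 * φ ‖z.2‖)) * N z
      = ∫ z in slab n T, (-deriv a z.1 - A z.1 + (a z.1 - A z.1) * D z.2)
          * (χ z.2 * φ ‖z.2‖) * wt z := by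
  have hN := h.integrableUpToZero
  have hw := hE.cont.integrableUpToZero
  have hwt := hE.cont_time.integrableUpToZero
  have hχ' := hχ.continuous
  have hac' := ha.continuous
  have ha' : Continuous (deriv a) := ha.continuous_deriv (by simp)
  have hda0 : ∀ t, τ ≤ t → deriv a t = 0 := by
    have h1 : ∀ t, τ < t → deriv a t = 0 := by
      intro t ht
      have : a =ᶠ[𝓝 t] fun _ => 0 := by
        filter_upwards [lt_mem_nhds ht] with s hs
        exact ha0 s hs.le
      rw [this.deriv_eq, deriv_const]
    intro t ht
    rcases ht.eq_or_lt with rfl | ht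
    · refine tendsto_nhds_unique (f := deriv a) (l := 𝓝[>] τ) (ha'.tendsto τ |>.mono_left
        nhdsWithin_le_nhds) ?_
      refine tendsto_const_nhds.congr' ?_
      filter_upwards [self_mem_nhdsWithin] with s hs
      exact (h1 s hs).symm
    · exact h1 t ht
  obtain ⟨L, hL⟩ := hχc.isCompact.isBounded.subset_closedBall 0
  choose P Q hPQ happ using fun k : ℕ =>
    exists_polynomial_near_solution hn hφ hW heq L (δ := 1 / ((k : ℝ) + 1)) (by positivity)
  have hrange : ∀ x : Space n, χ x ≠ 0 → ‖x‖ ∈ Icc 0 L := fun x hx =>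
    ⟨norm_nonneg x, by simpa using hL (subset_tsupport _ hx)⟩
  have hQφ : ∀ k (x : Space n), χ x ≠ 0 →
      |(Q k).eval (‖x‖ ^ 2) - φ ‖x‖| ≤ 1 / ((k : ℝ) + 1) := fun k x hx =>
    (happ k _ (hrange x hx)).2
  have hPφ : ∀ k (x : Space n), χ x ≠ 0 →
      |(P k).eval (‖x‖ ^ 2) - W ‖x‖ * φ ‖x‖| ≤ 1 / ((k : ℝ) + 1) := fun k x hx =>
    (happ k _ (hrange x hx)).1
  have cφ : Continuous fun x : Space n => φ ‖x‖ := by fun_prop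
  have cWφ : Continuous fun x : Space n => W ‖x‖ * φ ‖x‖ := by fun_prop
  have cQ : ∀ k, Continuous fun x : Space n => (Q k).eval (‖x‖ ^ 2) := fun k => by fun_prop
  have cP : ∀ k, Continuous fun x : Space n => (P k).eval (‖x‖ ^ 2) := fun k => by fun_prop
  -- The weak formulation for the approximate eigenfunctions.
  have stage : ∀ k : ℕ,
      ε * (∫ x, (a 0 * w₁ x * χ x) * (Q k).eval (‖x‖ ^ 2))
        + ε * (∫ x, (a 0 * w₀ x * D x * χ x) * (Q k).eval (‖x‖ ^ 2))
        + (∫ z in slab n T, (a z.1 * χ z.2 * N z) * (Q k).eval (‖z.2‖ ^ 2))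
      = -(∫ z in slab n T, (deriv a z.1 * χ z.2 * wt z) * (Q k).eval (‖z.2‖ ^ 2))
        + -(∫ z in slab n T, (a z.1 * χ z.2 * w z) * (P k).eval (‖z.2‖ ^ 2))
        - (∫ z in slab n T, (deriv a z.1 * (χ z.2 * D z.2) * w z) * (Q k).eval (‖z.2‖ ^ 2))
        + (∫ z in slab n T, (a z.1 * (χ z.2 * V z.2) * w z) * (Q k).eval (‖z.2‖ ^ 2)) := by
    intro k
    have hQc : ContDiff ℝ ∞ fun x : Space n => (Q k).eval (‖x‖ ^ 2) :=
      contDiff_polynomial_norm_sq (Q k)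
    have hΨ := isTestFunction_mul hτ ha hac ha0
      (hχ.mul hQc) hχc.mul_right
    have key := (h _ hΨ).2
    have hdt : ∀ z, dt (fun z : ℝ × Space n => a z.1 * (χ z.2 * (Q k).eval (‖z.2‖ ^ 2))) z
        = deriv a z.1 * (χ z.2 * (Q k).eval (‖z.2‖ ^ 2)) :=
      dt_mul a fun x => χ x * (Q k).eval (‖x‖ ^ 2)
    rw [hE.integral_inner_dx hs hτ hac' ha0 hχ hχc hχ1 (hPQ k)] at key
    simp only [hdt] at key
    have r1 : ∫ x, (a 0 * w₁ x * χ x) * (Q k).eval (‖x‖ ^ 2)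
        = ∫ x, w₁ x * (a 0 * (χ x * (Q k).eval (‖x‖ ^ 2))) := by congr 1; ext x; ring
    have r2 : ∫ x, (a 0 * w₀ x * D x * χ x) * (Q k).eval (‖x‖ ^ 2)
        = ∫ x, w₀ x * D x * (a 0 * (χ x * (Q k).eval (‖x‖ ^ 2))) := by congr 1; ext x; ring
    have r3 : ∫ z in slab n T, (a z.1 * χ z.2 * N z) * (Q k).eval (‖z.2‖ ^ 2)
        = ∫ z in slab n T, N z * (a z.1 * (χ z.2 * (Q k).eval (‖z.2‖ ^ 2))) := by
      congr 1; ext z; ring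
    have r4 : ∫ z in slab n T, (deriv a z.1 * χ z.2 * wt z) * (Q k).eval (‖z.2‖ ^ 2)
        = ∫ z in slab n T, wt z * (deriv a z.1 * (χ z.2 * (Q k).eval (‖z.2‖ ^ 2))) := by
      congr 1; ext z; ring
    have r6 : ∫ z in slab n T, (deriv a z.1 * (χ z.2 * D z.2) * w z) * (Q k).eval (‖z.2‖ ^ 2)
        = ∫ z in slab n T, w z * D z.2 * (deriv a z.1 * (χ z.2 * (Q k).eval (‖z.2‖ ^ 2))) := by
      congr 1; ext z; ring
    have r7 : ∫ z in slab n T, (a z.1 * (χ z.2 * V z.2) * w z) * (Q k).eval (‖z.2‖ ^ 2)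
        = ∫ z in slab n T, V z.2 * w z * (a z.1 * (χ z.2 * (Q k).eval (‖z.2‖ ^ 2))) := by
      congr 1; ext z; ring
    rw [r1, r2, r3, r4, r6, r7]
    exact key
  have intx : ∀ c : Space n → ℝ, Continuous c →
      Tendsto (fun k => ∫ x, (c x * χ x) * (Q k).eval (‖x‖ ^ 2)) atTop
        (𝓝 (∫ x, (c x * χ x) * φ ‖x‖)) := by
    intro c hc
    refine tendsto_integral_mul_of_approx (h := fun x : Space n => φ ‖x‖) ?_ ?_
      (fun k => (cQ k).aestronglyMeasurable) ?_
    · exact (hc.mul hχ').integrable_of_hasCompactSupport hχc.mul_left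
    · exact ((hc.mul hχ').mul cφ).integrable_of_hasCompactSupport (hχc.mul_left.mul_right)
    · exact fun k x hx => hQφ k x fun h0 => hx (by simp [h0])
  have l1 := intx (fun x => a 0 * w₁ x) (by fun_prop)
  have l2 := intx (fun x => a 0 * w₀ x * D x) (by fun_prop)
  have l3 := tendsto_slab_of_approx hN hτ hac' ha0 hχ' hχc cφ cQ hQφ
  have l4 := tendsto_slab_of_approx hwt hτ ha' hda0 hχ' hχc cφ cQ hQφ
  have l5 := tendsto_slab_of_approx hw hτ hac' ha0 hχ' hχc cWφ cP hPφ
  have l6 := tendsto_slab_of_approx hw hτ ha' hda0 (hχ'.mul hD) hχc.mul_right cφ cQ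
    fun k x hx => hQφ k x fun h0 => hx (by simp [h0])
  have l7 := tendsto_slab_of_approx hw hτ hac' ha0 (hχ'.mul hV) hχc.mul_right cφ cQ
    fun k x hx => hQφ k x fun h0 => hx (by simp [h0])
  have lim := tendsto_nhds_unique (((l1.const_mul ε).add (l2.const_mul ε)).add l3)
    ((((l4.neg.add l5.neg).sub l6).add l7).congr fun k => (stage k).symm)
  simp only [Pi.mul_apply] at lim
  -- Integration by parts in time.
  set g : Space n → ℝ := fun x => χ x * φ ‖x‖ with hg
  have cg : Continuous g := by fun_prop
  have cg0 : HasCompactSupport g := hχc.mul_right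
  have c1D : Continuous fun x => (1 + D x) * g x := by fun_prop
  have c1D0 : HasCompactSupport fun x => (1 + D x) * g x := cg0.mul_left
  have cDg : Continuous fun x => D x * g x := by fun_prop
  have cDg0 : HasCompactSupport fun x => D x * g x := cg0.mul_left
  have ibp1 := hE.integral_by_parts hτ0 hτ hac' hA ha0 hA0 hAa c1D c1D0
  have ibp2 := hE.integral_by_parts hτ0 hτ (a := fun t => -deriv a t) (A := a) ha'.neg hac'
    (fun t ht => by simp [hda0 t ht]) ha0
    (fun t _ => by
      rw [neg_neg]
      exact ((ha.differentiable (by simp)) t).hasDerivAt) cDg cDg0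
  have init : ∀ c : Space n → ℝ, ∫ x, c x * w (0, x) = ε * ∫ x, c x * w₀ x := by
    intro c
    rw [← integral_const_mul]
    refine integral_congr_ae ?_
    filter_upwards [hI.1] with x hx
    rw [hx]; ring
  rw [init] at ibp1 ibp2
  have comb : (∫ z in slab n T, a z.1 * χ z.2 * w z * (W ‖z.2‖ * φ ‖z.2‖))
      - (∫ z in slab n T, a z.1 * (χ z.2 * V z.2) * w z * φ ‖z.2‖)
      = ∫ z in slab n T, (a z.1 * ((1 + D z.2) * g z.2)) * w z := by
    rw [← integral_sub]
    · refine integral_congr_ae (ae_of_all _ fun z => ?_)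
      simp only [hWD, hg]
      ring
    · refine (hw.integrableOn_smul hτ hac' ha0 (hχ'.mul cWφ) hχc.mul_right).congr_fun
        (fun z _ => ?_) (measurableSet_slab n T)
      simp only [Pi.mul_apply, smul_eq_mul]
      ring
    · refine (hw.integrableOn_smul hτ hac' ha0 (cg.mul hV) cg0.mul_right).congr_fun
        (fun z _ => ?_) (measurableSet_slab n T)
      simp only [Pi.mul_apply, smul_eq_mul, hg]
      ring
  have e6 : (∫ z in slab n T, deriv a z.1 * (χ z.2 * D z.2) * w z * φ ‖z.2‖)
      = -∫ z in slab n T, (-deriv a z.1 * (D z.2 * g z.2)) * w z := by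
    rw [← integral_neg]
    refine integral_congr_ae (ae_of_all _ fun z => ?_)
    simp only [hg]
    ring
  have e1 : ∫ x, a 0 * w₁ x * χ x * φ ‖x‖ = a 0 * ∫ x, w₁ x * g x := by
    rw [← integral_const_mul]
    refine integral_congr_ae (ae_of_all _ fun z => ?_)
    simp only [hg]
    ring
  have e2 : ∫ x, a 0 * w₀ x * D x * χ x * φ ‖x‖ = a 0 * ∫ x, D x * g x * w₀ x := by
    rw [← integral_const_mul]
    refine integral_congr_ae (ae_of_all _ fun z => ?_)
    simp only [hg]
    ring
  have e3 : ∫ z in slab n T, a z.1 * χ z.2 * N z * φ ‖z.2‖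
      = ∫ z in slab n T, (a z.1 * g z.2) * N z := by
    refine integral_congr_ae (ae_of_all _ fun z => ?_)
    simp only [hg]
    ring
  have e0 : ∫ x, (1 + D x) * w₀ x * g x = ∫ x, (1 + D x) * g x * w₀ x := by
    refine integral_congr_ae (ae_of_all _ fun z => ?_)
    simp only
    ring
  have i4 : IntegrableOn (fun z => (deriv a z.1 * χ z.2 * wt z) * φ ‖z.2‖) (slab n T) := by
    refine (hwt.integrableOn_smul hτ ha' hda0 cg cg0).congr_fun
      (fun z _ => ?_) (measurableSet_slab n T)
    simp only [smul_eq_mul, hg]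
    ring
  have i5 : IntegrableOn (fun z => (A z.1 * ((1 + D z.2) * g z.2)) * wt z) (slab n T) :=
    hwt.integrableOn_smul hτ hA hA0 c1D c1D0
  have i6 : IntegrableOn (fun z => (a z.1 * (D z.2 * g z.2)) * wt z) (slab n T) :=
    hwt.integrableOn_smul hτ hac' ha0 cDg cDg0
  have e4 : ∫ z in slab n T, (-deriv a z.1 - A z.1 + (a z.1 - A z.1) * D z.2) * g z.2 * wt z
      = -(∫ z in slab n T, (deriv a z.1 * χ z.2 * wt z) * φ ‖z.2‖)
        - (∫ z in slab n T, (A z.1 * ((1 + D z.2) * g z.2)) * wt z)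
        + ∫ z in slab n T, (a z.1 * (D z.2 * g z.2)) * wt z := by
    have i4' : IntegrableOn (fun z => -((deriv a z.1 * χ z.2 * wt z) * φ ‖z.2‖)) (slab n T) :=
      i4.neg
    have i45 : IntegrableOn (fun z => -((deriv a z.1 * χ z.2 * wt z) * φ ‖z.2‖)
        - (A z.1 * ((1 + D z.2) * g z.2)) * wt z) (slab n T) := i4'.sub i5
    rw [← integral_neg, ← integral_sub i4' i5, ← integral_add i45 i6]
    refine integral_congr_ae (ae_of_all _ fun z => ?_)
    simp only [hg]
    ring
  rw [e1, e2, e3, e6] at lim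
  rw [e4, e0]
  linarith

/-! ### Cutoff functions in time -/

/-- A smooth decreasing cutoff, from `1` on `(-∞, 1/2]` to `0` on `[1, ∞)`, whose first two
derivatives are bounded by a multiple of the power `r < 1` of the function itself. -/
structure IsCutoff (r B : ℝ) (ρ : ℝ → ℝ) : Prop where
  smooth : ContDiff ℝ ∞ ρ
  antitone : Antitone ρ
  eq_one : ∀ t, t ≤ 1 / 2 → ρ t = 1
  eq_zero : ∀ t, 1 ≤ t → ρ t = 0
  deriv_le : ∀ t, |deriv ρ t| ≤ B * ρ t ^ r
  deriv_deriv_le : ∀ t, |deriv (deriv ρ) t| ≤ B * ρ t ^ r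

lemma IsCutoff.nonneg {r B : ℝ} {ρ : ℝ → ℝ} (h : IsCutoff r B ρ) (t : ℝ) : 0 ≤ ρ t := by
  rw [← h.eq_zero (max t 1) (le_max_right _ _)]
  exact h.antitone (le_max_left _ _)

lemma IsCutoff.le_one {r B : ℝ} {ρ : ℝ → ℝ} (h : IsCutoff r B ρ) (t : ℝ) : ρ t ≤ 1 := by
  rw [← h.eq_one (min t (1 / 2)) (min_le_right _ _)]
  exact h.antitone (min_le_left _ _)

lemma IsCutoff.deriv_nonpos {r B : ℝ} {ρ : ℝ → ℝ} (h : IsCutoff r B ρ) (t : ℝ) :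
    deriv ρ t ≤ 0 := h.antitone.deriv_nonpos

lemma IsCutoff.deriv_eq_zero {r B : ℝ} {ρ : ℝ → ℝ} (h : IsCutoff r B ρ) {t : ℝ} (ht : t < 1 / 2) :
    deriv ρ t = 0 ∧ deriv (deriv ρ) t = 0 := by
  have h1 : ∀ t : ℝ, t < 1 / 2 → deriv ρ t = 0 := by
    intro t ht
    have : ρ =ᶠ[𝓝 t] fun _ => 1 := by
      filter_upwards [gt_mem_nhds ht] with s hs
      exact h.eq_one s hs.le
    rw [this.deriv_eq, deriv_const]
  refine ⟨h1 t ht, ?_⟩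
  have : deriv ρ =ᶠ[𝓝 t] fun _ => 0 := by
    filter_upwards [gt_mem_nhds ht] with s hs
    exact h1 s hs
  rw [this.deriv_eq, deriv_const]

/-- A high power of any smooth transition function is such a cutoff. -/
lemma exists_isCutoff {r : ℝ} (hr : r < 1) : ∃ B, 0 < B ∧ ∃ ρ, IsCutoff r B ρ := by
  set h : ℝ → ℝ := fun t => Real.smoothTransition (2 - 2 * t) with hh
  have hsm : ContDiff ℝ ∞ h := Real.smoothTransition.contDiff.comp (by fun_prop)
  have hsm' : ContDiff ℝ ∞ (deriv h) := (contDiff_infty_iff_deriv.1 hsm).2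
  have hsm'' : Continuous (deriv (deriv h)) := hsm'.continuous_deriv (by simp)
  have hanti : Antitone h := fun s t hst =>
    Real.smoothTransition.monotone (by linarith)
  have h1 : ∀ t, t ≤ 1 / 2 → h t = 1 := fun t ht =>
    Real.smoothTransition.one_of_one_le (by linarith)
  have h0 : ∀ t, 1 ≤ t → h t = 0 := fun t ht =>
    Real.smoothTransition.zero_of_nonpos (by linarith)
  have hnn : ∀ t, 0 ≤ h t := fun t => Real.smoothTransition.nonneg _
  have hle : ∀ t, h t ≤ 1 := fun t => Real.smoothTransition.le_one _
  -- Outside `[0, 2]` both derivatives vanish.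
  have hd : ∀ t, t ∉ Icc (0 : ℝ) 2 → deriv h t = 0 ∧ deriv (deriv h) t = 0 := by
    have : ∀ t, t ∉ Icc (0 : ℝ) 2 → deriv h =ᶠ[𝓝 t] fun _ => 0 := by
      intro t ht
      filter_upwards [isClosed_Icc.isOpen_compl.mem_nhds ht] with s hs
      have hs' : s < 0 ∨ 2 < s := by
        by_contra hcon
        push Not at hcon
        exact hs hcon
      rcases hs' with hs' | hs'
      · have : h =ᶠ[𝓝 s] fun _ => 1 := by
          filter_upwards [gt_mem_nhds hs'] with y hy
          exact h1 y (by linarith)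
        rw [this.deriv_eq, deriv_const]
      · have : h =ᶠ[𝓝 s] fun _ => 0 := by
          filter_upwards [lt_mem_nhds hs'] with y hy
          exact h0 y (by linarith)
        rw [this.deriv_eq, deriv_const]
    intro t ht
    exact ⟨(this t ht).eq_of_nhds, by rw [(this t ht).deriv_eq, deriv_const]⟩
  obtain ⟨B₁, hB₁⟩ := (isCompact_Icc (a := (0 : ℝ)) (b := 2)).exists_bound_of_continuousOn
    hsm'.continuous.continuousOn
  obtain ⟨B₂, hB₂⟩ := (isCompact_Icc (a := (0 : ℝ)) (b := 2)).exists_bound_of_continuousOn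
    hsm''.continuousOn
  set B := max 1 (max B₁ B₂) with hB
  have hB1 : 1 ≤ B := le_max_left _ _
  have b1 : ∀ t, |deriv h t| ≤ B := by
    intro t
    by_cases ht : t ∈ Icc (0 : ℝ) 2
    · exact (hB₁ t ht).trans ((le_max_left _ _).trans (le_max_right _ _))
    · rw [(hd t ht).1, abs_zero]; linarith
  have b2 : ∀ t, |deriv (deriv h) t| ≤ B := by
    intro t
    by_cases ht : t ∈ Icc (0 : ℝ) 2
    · exact (hB₂ t ht).trans ((le_max_right _ _).trans (le_max_right _ _))
    · rw [(hd t ht).2, abs_zero]; linarith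
  -- Two derivatives of `h^(k+2)` leave a factor `h^k`, and `h^k ≤ (h^(k+2))^r` if `(k + 2) r ≤ k`.
  obtain ⟨k, hk⟩ := exists_nat_ge (2 / (1 - r))
  have hk' : ((k : ℝ) + 2) * r ≤ k := by
    rw [div_le_iff₀ (by linarith)] at hk
    linarith
  have hpow : ∀ t, h t ^ k ≤ (h t ^ (k + 2)) ^ r := by
    intro t
    rcases (hnn t).eq_or_lt with h00 | hpos
    · rw [← h00]
      rcases Nat.eq_zero_or_pos k with rfl | hkpos
      · have h2 : 2 / (1 - r) ≤ 0 := by simpa using hk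
        have : 0 < 2 / (1 - r) := div_pos two_pos (by linarith)
        linarith
      · rw [zero_pow hkpos.ne']
        positivity
    · rw [← Real.rpow_natCast, ← Real.rpow_natCast, ← Real.rpow_mul hpos.le]
      refine Real.rpow_le_rpow_of_exponent_ge hpos (hle t) ?_
      push_cast
      exact hk'
  have d1 : ∀ t, HasDerivAt (fun t => h t ^ (k + 2)) ((k + 2) * h t ^ (k + 1) * deriv h t) t := by
    intro t
    have := ((hsm.differentiable (by simp)) t).hasDerivAt.pow (k + 2)
    refine this.congr_deriv ?_
    push_cast
    simp
  have e1 : deriv (fun t => h t ^ (k + 2)) = fun t => (k + 2) * h t ^ (k + 1) * deriv h t :=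
    funext fun t => (d1 t).deriv
  have d2 : ∀ t, deriv (deriv fun t => h t ^ (k + 2)) t
      = h t ^ k * ((k + 2) * (k + 1) * deriv h t ^ 2 + (k + 2) * h t * deriv (deriv h) t) := by
    intro t
    rw [e1]
    have h1 := ((hsm.differentiable (by simp)) t).hasDerivAt.pow (k + 1)
    have h2 := ((hsm'.differentiable (by simp)) t).hasDerivAt
    have h3 : HasDerivAt (fun t => (k + 2) * h t ^ (k + 1) * deriv h t) _ t :=
      (h1.const_mul ((k : ℝ) + 2)).mul h2
    rw [h3.deriv]
    push_cast
    simp only [Pi.pow_apply]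
    ring
  have hk0 : (0 : ℝ) ≤ k := k.cast_nonneg
  refine ⟨((k : ℝ) + 2) ^ 2 * B ^ 2 * 2, by positivity, fun t => h t ^ (k + 2), hsm.pow _,
    fun s t hst => pow_le_pow_left₀ (hnn t) (hanti hst) _, fun t ht => by simp [h1 t ht],
    fun t ht => by simp [h0 t ht], fun t => ?_, fun t => ?_⟩
  · rw [e1]
    have hq := pow_nonneg (hnn t) k
    calc |(k + 2) * h t ^ (k + 1) * deriv h t|
        = (k + 2) * (h t ^ k * h t) * |deriv h t| := by
          rw [abs_mul, abs_mul, abs_of_nonneg (by positivity : (0 : ℝ) ≤ k + 2),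
            abs_of_nonneg (pow_nonneg (hnn t) _), pow_succ]
      _ ≤ (k + 2) * (h t ^ k * 1) * B := by
          have := hle t
          have := b1 t
          have := hnn t
          gcongr
      _ = ((k + 2) * B) * h t ^ k := by ring
      _ ≤ (((k : ℝ) + 2) ^ 2 * B ^ 2 * 2) * h t ^ k := by
          refine mul_le_mul_of_nonneg_right ?_ hq
          have : 1 ≤ (k + 2) * B := by nlinarith
          nlinarith
      _ ≤ _ := by
          have := hpow t
          gcongr
  · rw [d2]
    have hq := pow_nonneg (hnn t) k
    rw [abs_mul, abs_of_nonneg hq]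
    calc h t ^ k * |(k + 2) * (k + 1) * deriv h t ^ 2 + (k + 2) * h t * deriv (deriv h) t|
        ≤ h t ^ k * (((k : ℝ) + 2) ^ 2 * B ^ 2 * 2) := by
          gcongr
          have s1 : deriv h t ^ 2 ≤ B ^ 2 := by
            rw [← sq_abs]
            exact pow_le_pow_left₀ (abs_nonneg _) (b1 t) 2
          have s2 : h t * |deriv (deriv h) t| ≤ 1 * B :=
            mul_le_mul (hle t) (b2 t) (abs_nonneg _) zero_le_one
          have s3 : (k + 2) * (k + 1) * deriv h t ^ 2 ≤ (k + 2) * (k + 2) * B ^ 2 := by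
            gcongr
            linarith
          have s4 : ((k : ℝ) + 2) * (h t * |deriv (deriv h) t|) ≤ (k + 2) * (k + 2) * B ^ 2 := by
            calc ((k : ℝ) + 2) * (h t * |deriv (deriv h) t|) ≤ (k + 2) * (1 * B) := by gcongr
              _ ≤ (k + 2) * ((k + 2) * B ^ 2) := by gcongr <;> nlinarith
              _ = _ := by ring
          refine (abs_add_le _ _).trans ?_
          rw [abs_of_nonneg (by positivity), abs_mul, abs_mul, abs_of_nonneg (hnn t),
            abs_of_nonneg (by positivity : (0 : ℝ) ≤ k + 2), mul_assoc ((k : ℝ) + 2)]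
          linarith
      _ ≤ _ := by
          rw [mul_comm]
          have := hpow t
          gcongr

/-- The increment `ρ(t/τ) - ρ(2t/τ)` of the rescaled cutoff; it is supported in `τ/4 ≤ t ≤ τ` and
equal to `ρ(t/τ)` for `t ≥ τ/2`. -/
def cutoffIncrement (ρ : ℝ → ℝ) (τ t : ℝ) : ℝ := ρ (t / τ) - ρ (t / (τ / 2))

lemma IsCutoff.increment_nonneg {r B : ℝ} {ρ : ℝ → ℝ} (h : IsCutoff r B ρ) {τ t : ℝ} (hτ : 0 < τ)
    (ht : 0 ≤ t) : 0 ≤ cutoffIncrement ρ τ t := by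
  refine sub_nonneg.2 (h.antitone ?_)
  exact div_le_div_of_nonneg_left ht (by linarith) (by linarith)

lemma IsCutoff.increment_le_one {r B : ℝ} {ρ : ℝ → ℝ} (h : IsCutoff r B ρ) (τ t : ℝ) :
    cutoffIncrement ρ τ t ≤ 1 := by
  have h1 := h.le_one (t / τ)
  have h2 := h.nonneg (t / (τ / 2))
  unfold cutoffIncrement
  linarith

lemma IsCutoff.increment_eq_zero {r B : ℝ} {ρ : ℝ → ℝ} (h : IsCutoff r B ρ) {τ t : ℝ} (hτ : 0 < τ)
    (ht : τ ≤ t) : cutoffIncrement ρ τ t = 0 := by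
  unfold cutoffIncrement
  rw [h.eq_zero _ ((one_le_div hτ).2 ht), h.eq_zero _ ((one_le_div (by linarith)).2 (by linarith)),
    sub_zero]

/-- A smooth function of time with compact support, tested against the solution: it is equal to
`-(e^{-t} ρ(t/τ))'` for `t ≥ 0`. -/
def timeTest (ρ : ℝ → ℝ) (τ t : ℝ) : ℝ :=
  Real.smoothTransition (2 + 2 * t) * (Real.exp (-t) * (ρ (t / τ) - deriv ρ (t / τ) / τ))

lemma timeTest_of_nonneg (ρ : ℝ → ℝ) (τ : ℝ) {t : ℝ} (ht : -(1 / 2) ≤ t) :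
    timeTest ρ τ t = Real.exp (-t) * (ρ (t / τ) - deriv ρ (t / τ) / τ) := by
  rw [timeTest, Real.smoothTransition.one_of_one_le (by linarith), one_mul]

lemma IsCutoff.deriv_eq_zero_of_le {r B : ℝ} {ρ : ℝ → ℝ} (h : IsCutoff r B ρ) (hr : r ≠ 0) {t : ℝ}
    (ht : 1 ≤ t) : deriv ρ t = 0 := by
  have := h.deriv_le t
  rw [h.eq_zero t ht, Real.zero_rpow hr, mul_zero] at this
  exact abs_eq_zero.1 (le_antisymm this (abs_nonneg _))

lemma IsCutoff.contDiff_timeTest {r B : ℝ} {ρ : ℝ → ℝ} (h : IsCutoff r B ρ) (τ : ℝ) :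
    ContDiff ℝ ∞ (timeTest ρ τ) := by
  have h1 : ContDiff ℝ ∞ (deriv ρ) := (contDiff_infty_iff_deriv.1 h.smooth).2
  have h2 : ContDiff ℝ ∞ fun t : ℝ => t / τ := contDiff_id.div_const τ
  have h3 : ContDiff ℝ ∞ fun t : ℝ => Real.smoothTransition (2 + 2 * t) :=
    Real.smoothTransition.contDiff.comp (by fun_prop)
  exact h3.mul ((Real.contDiff_exp.comp contDiff_neg).mul
    ((h.smooth.comp h2).sub ((h1.comp h2).div_const τ)))

lemma IsCutoff.timeTest_eq_zero {r B : ℝ} {ρ : ℝ → ℝ} (h : IsCutoff r B ρ) (hr : r ≠ 0) {τ t : ℝ}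
    (hτ : 0 < τ) (ht : τ ≤ t) : timeTest ρ τ t = 0 := by
  have h1 : 1 ≤ t / τ := (one_le_div hτ).2 ht
  rw [timeTest, h.eq_zero _ h1, h.deriv_eq_zero_of_le hr h1]
  simp

lemma IsCutoff.hasCompactSupport_timeTest {r B : ℝ} {ρ : ℝ → ℝ} (h : IsCutoff r B ρ) (hr : r ≠ 0)
    {τ : ℝ} (hτ : 0 < τ) : HasCompactSupport (timeTest ρ τ) := by
  refine HasCompactSupport.intro (isCompact_Icc (a := (-1 : ℝ)) (b := τ)) fun t ht => ?_
  by_cases h1 : t < -1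
  · rw [timeTest, Real.smoothTransition.zero_of_nonpos (by linarith), zero_mul]
  · refine h.timeTest_eq_zero hr hτ ?_
    by_contra h2
    exact ht ⟨not_lt.1 h1, (not_le.1 h2).le⟩

lemma IsCutoff.hasDerivAt_exp_mul {r B : ℝ} {ρ : ℝ → ℝ} (h : IsCutoff r B ρ) {τ : ℝ} {t : ℝ}
    (ht : -(1 / 2) ≤ t) :
    HasDerivAt (fun t => Real.exp (-t) * ρ (t / τ)) (-timeTest ρ τ t) t := by
  have h1 := ((h.smooth.differentiable (by simp)) (t / τ)).hasDerivAt
  have h2 : HasDerivAt (fun t => ρ (t / τ)) _ t :=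
    h1.comp t ((hasDerivAt_id t).div_const τ)
  have h3 := (hasDerivAt_id t).neg.exp
  refine (h3.mul h2).congr_deriv ?_
  rw [timeTest_of_nonneg ρ τ ht]
  simp only [id, Pi.neg_apply]
  ring

/-- The exponential `e^{-t}` solves the equation in time up to derivatives of the cutoff. -/
lemma IsCutoff.deriv_timeTest {r B : ℝ} {ρ : ℝ → ℝ} (h : IsCutoff r B ρ) {τ : ℝ} {t : ℝ}
    (ht : 0 < t) (d : ℝ) :
    -deriv (timeTest ρ τ) t - Real.exp (-t) * ρ (t / τ)
        + (timeTest ρ τ t - Real.exp (-t) * ρ (t / τ)) * d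
      = Real.exp (-t) * (deriv (deriv ρ) (t / τ) / τ / τ - (2 + d) * (deriv ρ (t / τ) / τ)) := by
  have h1 := ((h.smooth.differentiable (by simp)) (t / τ)).hasDerivAt
  have hs : ContDiff ℝ ∞ (deriv ρ) := (contDiff_infty_iff_deriv.1 h.smooth).2
  have h1' := ((hs.differentiable (by simp)) (t / τ)).hasDerivAt
  have h2 : HasDerivAt (fun t => ρ (t / τ)) _ t :=
    h1.comp t ((hasDerivAt_id t).div_const τ)
  have h2' : HasDerivAt (fun t => deriv ρ (t / τ)) (deriv (deriv ρ) (t / τ) * (1 / τ)) t :=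
    HasDerivAt.comp (h₂ := deriv ρ) (h := fun t => t / τ) t h1' ((hasDerivAt_id t).div_const τ)
  have h3 := (hasDerivAt_id t).neg.exp
  have h4 : timeTest ρ τ =ᶠ[𝓝 t]
      fun t => Real.exp (-t) * (ρ (t / τ) - deriv ρ (t / τ) / τ) := by
    filter_upwards [lt_mem_nhds ht] with s hs
    exact timeTest_of_nonneg ρ τ (by linarith)
  have h5 : HasDerivAt (fun t => Real.exp (-t) * (ρ (t / τ) - deriv ρ (t / τ) / τ)) _ t :=
    h3.mul (h2.sub (h2'.div_const τ))
  rw [h4.deriv_eq, h5.deriv, timeTest_of_nonneg ρ τ (by linarith)]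
  simp only [id, Pi.neg_apply]
  ring

/-- The multiplier of `w_t` that the cutoff leaves is small and supported in `τ/2 ≤ t ≤ τ`. -/
lemma IsCutoff.abs_multiplier_le {r B : ℝ} {ρ : ℝ → ℝ} (h : IsCutoff r B ρ) (hB : 0 ≤ B) {τ : ℝ}
    (hτ : 1 ≤ τ) {t : ℝ} (ht : 0 < t) {d α : ℝ} (hd0 : 0 ≤ d) (hd : d ≤ α) :
    |-deriv (timeTest ρ τ) t - Real.exp (-t) * ρ (t / τ)
        + (timeTest ρ τ t - Real.exp (-t) * ρ (t / τ)) * d|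
      ≤ (3 + α) * B / τ * (Real.exp (-t) * cutoffIncrement ρ τ t ^ r) := by
  have hτ0 : 0 < τ := by linarith
  rw [h.deriv_timeTest ht, abs_mul, abs_of_pos (Real.exp_pos _)]
  rcases lt_or_ge (t / τ) (1 / 2) with h1 | h1
  · obtain ⟨e1, e2⟩ := h.deriv_eq_zero h1
    rw [e1, e2]
    have := h.increment_nonneg hτ0 ht.le
    simp only [zero_div, mul_zero, sub_zero, abs_zero]
    have hα : 0 ≤ α := hd0.trans hd
    positivity
  · have e : cutoffIncrement ρ τ t = ρ (t / τ) := by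
      unfold cutoffIncrement
      rw [h.eq_zero (t / (τ / 2)), sub_zero]
      rw [div_div_eq_mul_div, mul_comm, mul_div_assoc]
      linarith
    rw [e]
    have hα : 0 ≤ α := hd0.trans hd
    have b1 := h.deriv_le (t / τ)
    have b2 := h.deriv_deriv_le (t / τ)
    set P := B * ρ (t / τ) ^ r with hP
    have hP0 : 0 ≤ P := (abs_nonneg _).trans b1
    have c1 : |deriv (deriv ρ) (t / τ) / τ / τ| ≤ P / τ := by
      rw [abs_div, abs_div, abs_of_pos hτ0]
      have : |deriv (deriv ρ) (t / τ)| / τ ≤ P := (div_le_self (abs_nonneg _) hτ).trans b2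
      gcongr
    have c2 : |(2 + d) * (deriv ρ (t / τ) / τ)| ≤ (2 + α) * (P / τ) := by
      rw [abs_mul, abs_div, abs_of_pos hτ0, abs_of_nonneg (by linarith : 0 ≤ 2 + d)]
      gcongr
    calc _ ≤ Real.exp (-t) * (P / τ + (2 + α) * (P / τ)) := by
          gcongr
          exact (abs_sub _ _).trans (add_le_add c1 c2)
      _ = _ := by rw [hP]; ring

/-! ### The weight on the light cone -/

/-- The region `|x| ≤ t + R` that contains the support of a solution. -/
def cone (n : ℕ) (R : ℝ) : Set (ℝ × Space n) := {z | ‖z.2‖ ≤ z.1 + R}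

/-- The weight `e^{-t} (1 + |x|)^{-(n-1)/2} e^{|x|}`, comparable to all `e^{-t} φ(|x|)` with `φ` a
radial eigenfunction. -/
def coneWeight (n : ℕ) (z : ℝ × Space n) : ℝ := Real.exp (-z.1) * growthWeight n ‖z.2‖

lemma measurableSet_cone (n : ℕ) (R : ℝ) : MeasurableSet (cone n R) :=
  (isClosed_le (by fun_prop) (by fun_prop)).measurableSet

lemma continuous_growthWeight_norm (n : ℕ) : Continuous fun x : Space n => growthWeight n ‖x‖ := by
  unfold growthWeight
  refine Continuous.mul (Continuous.rpow_const (by fun_prop) fun x => Or.inl ?_) (by fun_prop)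
  positivity

lemma continuous_coneWeight (n : ℕ) : Continuous (coneWeight n) := by
  have h := continuous_growthWeight_norm n
  have h2 : Continuous fun z : ℝ × Space n => growthWeight n ‖z.2‖ := h.comp continuous_snd
  unfold coneWeight
  fun_prop

lemma growthWeight_pos (n : ℕ) {r : ℝ} (hr : 0 ≤ r) : 0 < growthWeight n r := by
  unfold growthWeight
  positivity

lemma coneWeight_pos (n : ℕ) (z : ℝ × Space n) : 0 < coneWeight n z :=
  mul_pos (Real.exp_pos _) (growthWeight_pos n (norm_nonneg _))

/-- `∫_{|x| ≤ s} (1 + |x|)^{-(n-1)/2} e^{|x|} dx` is of size `s^{(n-1)/2} e^s`. -/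
lemma exists_setIntegral_growthWeight_le {n : ℕ} (hn : 1 ≤ n) :
    ∃ K > 0, ∀ s : ℝ, 0 ≤ s → ∫ x : Space n in Metric.closedBall 0 s, growthWeight n ‖x‖
      ≤ K * ((1 + s) ^ (((n : ℝ) - 1) / 2) * Real.exp s) := by
  have : Nontrivial (Space n) := by
    have : Nonempty (Fin n) := ⟨⟨0, by omega⟩⟩
    infer_instance
  set m : ℝ := ((n : ℝ) - 1) / 2 with hm
  have hm0 : 0 ≤ m := by
    have : (1 : ℝ) ≤ n := by exact_mod_cast hn
    rw [hm]; linarith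
  set v : ℝ := volume.real (Metric.ball (0 : Space n) 1) with hv
  have hv0 : 0 ≤ v := measureReal_nonneg
  refine ⟨n * v + 1, by positivity, fun s hs => ?_⟩
  have e1 : ∫ x : Space n in Metric.closedBall 0 s, growthWeight n ‖x‖
      = ∫ x : Space n, (Iic s).indicator (growthWeight n) ‖x‖ := by
    rw [← integral_indicator measurableSet_closedBall]
    refine integral_congr_ae (ae_of_all _ fun x => ?_)
    simp only [indicator, mem_Iic, Metric.mem_closedBall, dist_zero_right]
  rw [e1, integral_fun_norm_addHaar]
  have hpt : ∀ y ∈ Ioc 0 s, y ^ (n - 1) * growthWeight n y ≤ (1 + s) ^ m * Real.exp y := by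
    intro y hy
    have hy0 : 0 < 1 + y := by linarith [hy.1]
    unfold growthWeight
    have h1 : y ^ (n - 1) ≤ (1 + y) ^ (2 * m) := by
      have : (2 * m : ℝ) = ((n - 1 : ℕ) : ℝ) := by
        rw [hm, Nat.cast_sub hn]; push_cast; ring
      rw [this, Real.rpow_natCast]
      exact pow_le_pow_left₀ hy.1.le (by linarith) _
    calc y ^ (n - 1) * ((1 + y) ^ (-m) * Real.exp y)
        ≤ (1 + y) ^ (2 * m) * ((1 + y) ^ (-m) * Real.exp y) := by gcongr
      _ = (1 + y) ^ m * Real.exp y := by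
          rw [← mul_assoc, ← Real.rpow_add hy0]
          congr 2; ring
      _ ≤ (1 + s) ^ m * Real.exp y := by
          have := hy.2
          gcongr
  have e2 : ∫ y in Ioi (0 : ℝ), y ^ (Module.finrank ℝ (Space n) - 1) •
        (Iic s).indicator (growthWeight n) y
      = ∫ y in Ioc 0 s, y ^ (n - 1) * growthWeight n y := by
    rw [← Ioi_inter_Iic, ← setIntegral_indicator measurableSet_Iic]
    refine integral_congr_ae (ae_of_all _ fun y => ?_)
    simp only [indicator, smul_eq_mul, finrank_euclideanSpace_fin]
    split_ifs <;> simp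
  have i2 : IntegrableOn (fun y => (1 + s) ^ m * Real.exp y) (Ioc 0 s) :=
    (Continuous.integrableOn_Icc (by fun_prop)).mono_set Ioc_subset_Icc_self
  have hle : ∫ y in Ioc 0 s, y ^ (n - 1) * growthWeight n y ≤ (1 + s) ^ m * Real.exp s := by
    calc _ ≤ ∫ y in Ioc 0 s, (1 + s) ^ m * Real.exp y := by
          refine integral_mono_of_nonneg ?_ i2 ?_
          · refine (ae_restrict_iff' measurableSet_Ioc).2 (ae_of_all _ fun y hy => ?_)
            exact mul_nonneg (pow_nonneg hy.1.le _) (growthWeight_pos n hy.1.le).le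
          · exact (ae_restrict_iff' measurableSet_Ioc).2 (ae_of_all _ hpt)
      _ = (1 + s) ^ m * (Real.exp s - 1) := by
          rw [integral_const_mul, ← intervalIntegral.integral_of_le hs, integral_exp, Real.exp_zero]
      _ ≤ _ := by
          gcongr
          linarith
  rw [e2, finrank_euclideanSpace_fin, nsmul_eq_mul, smul_eq_mul, ← mul_assoc]
  have hp : 0 ≤ (1 + s) ^ m * Real.exp s := by positivity
  calc (n : ℝ) * v * ∫ y in Ioc 0 s, y ^ (n - 1) * growthWeight n y
      ≤ (n : ℝ) * v * ((1 + s) ^ m * Real.exp s) := by gcongr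
    _ ≤ _ := by gcongr; linarith

lemma integrableOn_coneWeight (n : ℕ) (R τ : ℝ) :
    IntegrableOn (coneWeight n) ((Ioc 0 τ ×ˢ univ) ∩ cone n R) := by
  have hc : IsCompact (Icc 0 τ ×ˢ Metric.closedBall (0 : Space n) (τ + R)) :=
    isCompact_Icc.prod (isCompact_closedBall _ _)
  refine ((continuous_coneWeight n).continuousOn.integrableOn_compact hc).mono_set ?_
  rintro ⟨t, x⟩ ⟨⟨ht, -⟩, hx⟩
  refine ⟨⟨ht.1.le, ht.2⟩, ?_⟩
  have hx' : ‖x‖ ≤ t + R := hx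
  rw [mem_closedBall_zero_iff]
  have := ht.2
  simp only at this
  linarith

/-- The mass of the weight up to the time `τ` is of size `τ^{(n+1)/2}`. -/
lemma exists_setIntegral_coneWeight_le {n : ℕ} (hn : 1 ≤ n) {R : ℝ} (hR : 0 < R) :
    ∃ K > 0, ∀ τ : ℝ, 1 ≤ τ → ∫ z in (Ioc 0 τ ×ˢ univ) ∩ cone n R, coneWeight n z
      ≤ K * τ ^ (((n : ℝ) - 1) / 2 + 1) := by
  obtain ⟨K, hK, hle⟩ := exists_setIntegral_growthWeight_le hn
  set m : ℝ := ((n : ℝ) - 1) / 2 with hm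
  have hm0 : 0 ≤ m := by
    have : (1 : ℝ) ≤ n := by exact_mod_cast hn
    rw [hm]; linarith
  refine ⟨K * ((2 + R) ^ m * Real.exp R), by positivity, fun τ hτ => ?_⟩
  have hτ0 : 0 < τ := by linarith
  have hint := integrableOn_coneWeight n R τ
  rw [inter_comm, ← integrableOn_indicator_iff (measurableSet_cone n R)] at hint
  rw [← setIntegral_indicator (measurableSet_cone n R), Measure.volume_eq_prod] at *
  rw [setIntegral_prod _ hint]
  simp only [Measure.restrict_univ]
  have hslice : ∀ t ∈ Ioc 0 τ, ∫ x : Space n, (cone n R).indicator (coneWeight n) (t, x)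
      ≤ K * ((2 + R) ^ m * Real.exp R) * τ ^ m := by
    intro t ht
    have e1 : ∀ x : Space n, (cone n R).indicator (coneWeight n) (t, x)
        = Real.exp (-t) * (Metric.closedBall 0 (t + R)).indicator
          (fun x : Space n => growthWeight n ‖x‖) x := by
      intro x
      by_cases h : ‖x‖ ≤ t + R
      · rw [indicator_of_mem (show (t, x) ∈ cone n R from h), indicator_of_mem (by simpa using h)]
        rfl
      · rw [indicator_of_notMem (show (t, x) ∉ cone n R from h),
          indicator_of_notMem (by simpa using h), mul_zero]
    simp only [e1]
    rw [integral_const_mul, integral_indicator measurableSet_closedBall]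
    have h0 : 0 ≤ t + R := by linarith [ht.1]
    have h1 : (1 + (t + R)) ^ m ≤ (2 + R) ^ m * τ ^ m := by
      rw [← Real.mul_rpow (by linarith) hτ0.le]
      refine Real.rpow_le_rpow (by linarith) ?_ hm0
      nlinarith [ht.2]
    calc _ ≤ Real.exp (-t) * (K * ((1 + (t + R)) ^ m * Real.exp (t + R))) := by
          gcongr
          exact hle _ h0
      _ = K * (1 + (t + R)) ^ m * (Real.exp (-t) * Real.exp (t + R)) := by ring
      _ = K * (1 + (t + R)) ^ m * Real.exp R := by
          rw [← Real.exp_add, neg_add_cancel_left]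
      _ ≤ K * ((2 + R) ^ m * τ ^ m) * Real.exp R := by gcongr
      _ = _ := by ring
  calc _ ≤ ∫ _ in Ioc 0 τ, K * ((2 + R) ^ m * Real.exp R) * τ ^ m := by
        refine integral_mono_of_nonneg (ae_of_all _ fun t => ?_)
          (integrableOn_const measure_Ioc_lt_top.ne) ?_
        · exact integral_nonneg fun x => indicator_nonneg (fun z _ => (coneWeight_pos n z).le) _
        · exact (ae_restrict_iff' measurableSet_Ioc).2 (ae_of_all _ hslice)
    _ = _ := by
        rw [setIntegral_const, Real.volume_real_Ioc_of_le hτ0.le, sub_zero, smul_eq_mul,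
          Real.rpow_add_one hτ0.ne']
        ring

/-! ### The estimate for one equation -/

/-- Existence of the radial eigenfunction `Δφ = (1 + D + V) φ`, with two-sided bounds. -/
theorem exists_eigenfunction {n : ℕ} (hn : 3 ≤ n) {D V : Space n → ℝ} {α₁ β α₂ κ : ℝ}
    (hα₁ : 0 ≤ α₁) (hβ : 1 < β) (hα₂ : 0 ≤ α₂) (hκ : 1 < κ) (hD : IsCoefficient D α₁ β)
    (hV : IsCoefficient V α₂ κ) :
    ∃ φ W : ℝ → ℝ, Continuous φ ∧ Continuous W ∧ (∀ r, 1 ≤ φ r) ∧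
      (∀ r, φ r = 1 + radialInverse n (fun s => W s * φ s) r) ∧
      (∀ x : Space n, W ‖x‖ = 1 + D x + V x) ∧
      ∃ c > 0, ∃ C > 0, ∀ r, 0 ≤ r → c * growthWeight n r ≤ φ r ∧ φ r ≤ C * growthWeight n r := by
  -- The radial profiles of the coefficients, read off along a unit vector.
  set e : Space n := EuclideanSpace.single ⟨0, by omega⟩ 1 with he
  have hen : ‖e‖ = 1 := by rw [he, PiLp.norm_single, norm_one]
  have hre : ∀ r : ℝ, ‖r • e‖ = |r| := fun r => by rw [norm_smul, hen, mul_one, Real.norm_eq_abs]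
  set P : ℝ → ℝ := fun r => D (r • e) + V (r • e) with hP
  have hPc : Continuous P := by
    have h1 := hD.continuous
    have h2 := hV.continuous
    fun_prop
  have hP0 : ∀ r, 0 ≤ P r := fun r => add_nonneg (hD.nonneg _) (hV.nonneg _)
  have hPd : ∀ r, P r ≤ α₁ * (1 + |r|) ^ (-β) + α₂ * (1 + |r|) ^ (-κ) := fun r => by
    have h1 := hD.le_decay (r • e)
    have h2 := hV.le_decay (r • e)
    rw [hre] at h1 h2
    exact add_le_add h1 h2
  have hPM : ∀ r, P r ≤ α₁ + α₂ := fun r => by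
    have h0 : (1 : ℝ) ≤ 1 + |r| := by linarith [abs_nonneg r]
    have h1 : (1 + |r|) ^ (-β) ≤ 1 := Real.rpow_le_one_of_one_le_of_nonpos h0 (by linarith)
    have h2 : (1 + |r|) ^ (-κ) ≤ 1 := Real.rpow_le_one_of_one_le_of_nonpos h0 (by linarith)
    nlinarith [hPd r]
  have hWc : Continuous fun r => 1 + P r := by fun_prop
  obtain ⟨φ, hφ, hφ1, heq⟩ := exists_radial_solution n hWc (M := 1 + (α₁ + α₂)) (by linarith)
    (fun r => by linarith [hP0 r]) (fun r => by linarith [hPM r])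
  refine ⟨φ, fun r => 1 + P r, hφ, hWc, hφ1, heq, fun x => ?_,
    exists_growth_bounds hn hφ hPc hφ1 heq hα₁ hβ hα₂ hκ hP0 fun r hr => ?_⟩
  · have : ‖‖x‖ • e‖ = ‖x‖ := by rw [hre, abs_norm]
    simp only [hP]
    rw [hD.radial _ x this, hV.radial _ x this]
    ring
  · simpa [abs_of_nonneg hr] using hPd r

lemma IsDatum.eq_zero {n : ℕ} {R : ℝ} {f : Space n → ℝ} (h : IsDatum R f) {x : Space n}
    (hx : R < ‖x‖) : f x = 0 := by
  by_contra hne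
  have := h.support_subset hne
  rw [mem_closedBall_zero_iff] at this
  linarith

lemma IsDatum.hasCompactSupport {n : ℕ} {R : ℝ} {f : Space n → ℝ} (h : IsDatum R f) :
    HasCompactSupport f :=
  HasCompactSupport.intro (isCompact_closedBall 0 R) fun x hx => h.eq_zero (by
    rw [mem_closedBall_zero_iff] at hx
    exact not_le.1 hx)

/-- The data enter the estimate with a positive coefficient. -/
lemma data_integral_pos {n : ℕ} {R : ℝ} {D w₀ w₁ : Space n → ℝ} {φ : ℝ → ℝ} (hD : Continuous D)
    (hD0 : ∀ x, 0 ≤ D x) (hφ : Continuous φ) (hφ1 : ∀ r, 1 ≤ φ r) (hw₀ : IsDatum R w₀)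
    (hw₁ : IsDatum R w₁) (hw : w₀ ≠ 0 ∨ w₁ ≠ 0) :
    0 < (∫ x, w₁ x * φ ‖x‖) + ∫ x, (1 + D x) * w₀ x * φ ‖x‖ := by
  have c₀ := hw₀.smooth.continuous
  have c₁ := hw₁.smooth.continuous
  have hφ0 : ∀ r, 0 < φ r := fun r => lt_of_lt_of_le one_pos (hφ1 r)
  have n1 : ∀ x, 0 ≤ w₁ x * φ ‖x‖ := fun x => mul_nonneg (hw₁.nonneg x) (hφ0 _).le
  have n0 : ∀ x, 0 ≤ (1 + D x) * w₀ x * φ ‖x‖ := fun x =>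
    mul_nonneg (mul_nonneg (by linarith [hD0 x]) (hw₀.nonneg x)) (hφ0 _).le
  rcases hw with h | h
  · obtain ⟨x, hx⟩ := Function.ne_iff.1 h
    refine add_pos_of_nonneg_of_pos (integral_nonneg n1) ?_
    refine Continuous.integral_pos_of_hasCompactSupport_nonneg_nonzero (x := x) (by fun_prop)
      hw₀.hasCompactSupport.mul_left.mul_right n0 ?_
    have := hD0 x
    have h2 := (hφ0 ‖x‖).ne'
    exact mul_ne_zero (mul_ne_zero (by linarith) hx) h2
  · obtain ⟨x, hx⟩ := Function.ne_iff.1 h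
    refine add_pos_of_pos_of_nonneg ?_ (integral_nonneg n0)
    exact Continuous.integral_pos_of_hasCompactSupport_nonneg_nonzero (x := x) (by fun_prop)
      hw₁.hasCompactSupport.mul_right n1 (mul_ne_zero hx (hφ0 ‖x‖).ne')

lemma exists_spatial_cutoff (n : ℕ) {L : ℝ} (hL : 0 < L) :
    ∃ χ : Space n → ℝ, ContDiff ℝ ∞ χ ∧ HasCompactSupport χ ∧ (∀ x, 0 ≤ χ x) ∧ (∀ x, χ x ≤ 1) ∧
      ∀ x, ‖x‖ ≤ L → χ x = 1 := by
  let χ : ContDiffBump (0 : Space n) := ⟨L, L + 1, hL, by linarith⟩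
  refine ⟨χ, χ.contDiff, χ.hasCompactSupport, fun x => χ.nonneg, fun x => χ.le_one, fun x hx => ?_⟩
  exact χ.one_of_mem_closedBall (mem_closedBall_zero_iff.2 hx)

lemma mem_slab_inter_cone {n : ℕ} {T R : ℝ} {z : ℝ × Space n} (hz : z ∈ slab n T ∩ cone n R) :
    0 < z.1 ∧ z.1 < T ∧ ‖z.2‖ < T + R := by
  have h1 : z.1 ∈ Ioo 0 T := hz.1.1
  have h2 : ‖z.2‖ ≤ z.1 + R := hz.2
  exact ⟨h1.1, h1.2, by linarith [h1.2]⟩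

lemma measurableSet_slab_inter_cone (n : ℕ) (T R : ℝ) : MeasurableSet (slab n T ∩ cone n R) :=
  (measurableSet_slab n T).inter (measurableSet_cone n R)

lemma IntegrableUpToZero.integrableOn_cone {n : ℕ} {T τ R : ℝ} {N : ℝ × Space n → ℝ}
    (hN : IntegrableUpToZero T N) (hR : 0 < R) (hT : 0 < T) (hτ : τ < T) {b : ℝ → ℝ}
    (hb : Continuous b) (hb0 : ∀ t, τ ≤ t → b t = 0) :
    IntegrableOn (fun z => b z.1 * coneWeight n z * N z) (slab n T ∩ cone n R) := by
  obtain ⟨χ, hχ, hχc, -, -, hχ1⟩ := exists_spatial_cutoff n (L := T + R) (by linarith)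
  have hc := hχ.continuous
  have hg := continuous_growthWeight_norm n
  have h := (hN.integrableOn_smul hτ (b := fun t => b t * Real.exp (-t))
    (g := fun x => χ x * growthWeight n ‖x‖) (by fun_prop)
    (fun t ht => by simp [hb0 t ht]) (by fun_prop) hχc.mul_right).mono_set
      (inter_subset_left (t := cone n R))
  refine h.congr_fun (fun z hz => ?_) (measurableSet_slab_inter_cone n T R)
  simp only [smul_eq_mul]
  rw [hχ1 z.2 (mem_slab_inter_cone hz).2.2.le, coneWeight]
  ring

lemma IntegrableUpToZero.abs {n : ℕ} {T : ℝ} {f : ℝ × Space n → ℝ}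
    (hf : IntegrableUpToZero T f) : IntegrableUpToZero T fun z => |f z| :=
  fun τ hτ L => (hf τ hτ L).abs

/-- Integrals of functions carried by a solution may be restricted to the cone. -/
lemma setIntegral_slab_eq_cone {n : ℕ} {T R : ℝ} {f F : ℝ × Space n → ℝ} (hs : FiniteSpeed R T f)
    (hF : IntegrableOn F (slab n T)) (hFf : ∀ z, f z = 0 → F z = 0) :
    ∫ z in slab n T, F z = ∫ z in slab n T ∩ cone n R, F z := by
  rw [← setIntegral_indicator (measurableSet_cone n R), setIntegral_slab hF,
    setIntegral_slab (hF.indicator (measurableSet_cone n R))]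
  refine setIntegral_congr_fun measurableSet_Ioo fun t ht => integral_congr_ae ?_
  filter_upwards [hs t ⟨ht.1.le, ht.2⟩] with x hx
  by_cases h : (t, x) ∈ cone n R
  · rw [indicator_of_mem h]
  · rw [indicator_of_notMem h]
    have h' : ¬‖x‖ ≤ t + R := h
    exact hFf _ (hx (not_le.1 h'))

/-- The weighted mass `∫ ρ(t/τ) w N` of a nonlinearity up to the time `τ`. -/
def mass (n : ℕ) (R T : ℝ) (ρ : ℝ → ℝ) (N : ℝ × Space n → ℝ) (τ : ℝ) : ℝ :=
  ∫ z in slab n T ∩ cone n R, ρ (z.1 / τ) * coneWeight n z * N z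

/-- The mass of the nonlinearity and the size of the data are controlled by a weighted integral of
`|w_t|` over times close to `τ`. -/
theorem exists_linear_estimate {n : ℕ} (hn : 3 ≤ n) {D V : Space n → ℝ} {α₁ β α₂ κ : ℝ}
    (hα₁ : 0 ≤ α₁) (hβ : 1 < β) (hα₂ : 0 ≤ α₂) (hκ : 1 < κ) (hD : IsCoefficient D α₁ β)
    (hV : IsCoefficient V α₂ κ) {R : ℝ} (hR : 0 < R) {w₀ w₁ : Space n → ℝ} (hw₀ : IsDatum R w₀)
    (hw₁ : IsDatum R w₁) (hw : w₀ ≠ 0 ∨ w₁ ≠ 0) {r B : ℝ} (hr : 0 < r) (hB : 0 ≤ B) {ρ : ℝ → ℝ}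
    (hρ : IsCutoff r B ρ) :
    ∃ c > 0, ∃ K > 0, ∀ (T τ ε : ℝ) (w wt : ℝ × Space n → ℝ) (gw : ℝ × Space n → Space n)
      (N : ℝ × Space n → ℝ), 1 ≤ τ → τ < T → (∀ z, 0 ≤ N z) → EnergyClass T w wt gw →
      InitialConditions ε w₀ w₁ w wt → FiniteSpeed R T w →
      WeakEquation T ε D V w₀ w₁ w wt gw N →
      ε * c + mass n R T ρ N τ
        ≤ K / τ * ∫ z in slab n T ∩ cone n R,
            cutoffIncrement ρ τ z.1 ^ r * coneWeight n z * |wt z| := by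
  obtain ⟨φ, W, hφ, hW, hφ1, heq, hWD, c, hc, C, hC, hbd⟩ :=
    exists_eigenfunction hn hα₁ hβ hα₂ hκ hD hV
  have hφ0 : ∀ r, 0 < φ r := fun r => lt_of_lt_of_le one_pos (hφ1 r)
  have hDc := hD.continuous
  set I := (∫ x, w₁ x * φ ‖x‖) + ∫ x, (1 + D x) * w₀ x * φ ‖x‖ with hI
  have hI0 : 0 < I := data_integral_pos hDc hD.nonneg hφ hφ1 hw₀ hw₁ hw
  refine ⟨I / c, by positivity, ((3 + α₁) * B * C) / c + 1, by positivity, ?_⟩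
  intro T τ ε w wt gw N hτ hτT hN0 hE hinit hs heqn
  have hτ0 : 0 < τ := by linarith
  have hT : 0 < T := by linarith
  have hDα : ∀ x, D x ≤ α₁ := fun x => by
    have h1 : (1 : ℝ) ≤ 1 + ‖x‖ := by linarith [norm_nonneg x]
    have h2 : (1 + ‖x‖) ^ (-β) ≤ 1 := Real.rpow_le_one_of_one_le_of_nonpos h1 (by linarith)
    exact (hD.le_decay x).trans (mul_le_of_le_one_right hα₁ h2)
  obtain ⟨χ, hχ, hχc, hχ0, hχle, hχ1⟩ := exists_spatial_cutoff n (L := T + R) (by linarith)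
  have hχ' := hχ.continuous
  set a := timeTest ρ τ with ha
  set A : ℝ → ℝ := fun t => Real.exp (-t) * ρ (t / τ) with hA
  have hac : ContDiff ℝ ∞ a := hρ.contDiff_timeTest τ
  have ha' : Continuous (deriv a) := hac.continuous_deriv (by simp)
  have hac' := hac.continuous
  have ha0 : ∀ t, τ ≤ t → a t = 0 := fun t ht => hρ.timeTest_eq_zero hr.ne' hτ0 ht
  have hρc := hρ.smooth.continuous
  have hAc : Continuous A := by fun_prop
  have hA0 : ∀ t, τ ≤ t → A t = 0 := fun t ht => by
    simp only [hA]
    rw [hρ.eq_zero _ ((one_le_div hτ0).2 ht), mul_zero]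
  have hNint := heqn.integrableUpToZero
  have hwt := hE.cont_time.integrableUpToZero
  have cφ : Continuous fun x : Space n => φ ‖x‖ := by fun_prop
  have ident := heqn.eigenfunction_identity (by omega) hτ0.le hτT hDc hV.continuous
    hw₀.smooth.continuous hw₁.smooth.continuous hE hinit hs hφ hW heq hWD hχ hχc
    (fun x hx => hχ1 x hx.le) hac (hρ.hasCompactSupport_timeTest hr.ne' hτ0) ha0 hAc hA0
    (fun t ht => hρ.hasDerivAt_exp_mul (by linarith [ht.1]))
  -- The data terms: near `t = 0` the cutoff is `1`, so that `a = A = e^{-t}`.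
  have a_zero : a 0 = 1 := by
    rw [ha, timeTest_of_nonneg ρ τ (by norm_num), zero_div, (hρ.deriv_eq_zero (by norm_num)).1,
      hρ.eq_one 0 (by norm_num)]
    simp
  have A_zero : A 0 = 1 := by
    simp only [hA]
    rw [zero_div, hρ.eq_one 0 (by norm_num)]
    simp
  have drop : ∀ f : Space n → ℝ, (∀ x, R < ‖x‖ → f x = 0) →
      ∫ x, f x * (χ x * φ ‖x‖) = ∫ x, f x * φ ‖x‖ := by
    intro f hf
    congr 1
    ext x
    by_cases h : R < ‖x‖
    · rw [hf x h]; ring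
    · rw [hχ1 x (by linarith), one_mul]
  rw [a_zero, A_zero, drop w₁ fun x hx => hw₁.eq_zero hx,
    drop (fun x => (1 + D x) * w₀ x) fun x hx => by rw [hw₀.eq_zero hx, mul_zero]] at ident
  -- The nonlinear term: `a ≥ e^{-t} ρ(t/τ)`, since `ρ` is decreasing.
  have hint1 : IntegrableOn (fun z => (a z.1 * (χ z.2 * φ ‖z.2‖)) * N z) (slab n T) :=
    hNint.integrableOn_smul hτT hac' ha0 (hχ'.mul cφ) hχc.mul_right
  have hmass : IntegrableOn (fun z => ρ (z.1 / τ) * coneWeight n z * N z)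
      (slab n T ∩ cone n R) :=
    hNint.integrableOn_cone hR hT hτT (b := fun t => ρ (t / τ)) (by fun_prop)
      fun t ht => hρ.eq_zero _ ((one_le_div hτ0).2 ht)
  have ha_ge : ∀ t, 0 ≤ t → Real.exp (-t) * ρ (t / τ) ≤ a t := by
    intro t ht
    rw [ha, timeTest_of_nonneg ρ τ (by linarith)]
    have : deriv ρ (t / τ) / τ ≤ 0 := div_nonpos_of_nonpos_of_nonneg (hρ.deriv_nonpos _) hτ0.le
    gcongr
    linarith
  have ha_nn : ∀ t, 0 ≤ t → 0 ≤ a t := fun t ht =>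
    (mul_nonneg (Real.exp_pos _).le (hρ.nonneg _)).trans (ha_ge t ht)
  have low : c * mass n R T ρ N τ ≤ ∫ z in slab n T, (a z.1 * (χ z.2 * φ ‖z.2‖)) * N z := by
    rw [mass, ← integral_const_mul]
    calc _ ≤ ∫ z in slab n T ∩ cone n R, (a z.1 * (χ z.2 * φ ‖z.2‖)) * N z := by
          refine setIntegral_mono_on (hmass.const_mul c) (hint1.mono_set inter_subset_left)
            (measurableSet_slab_inter_cone n T R) fun z hz => ?_
          obtain ⟨h1, h2, h3⟩ := mem_slab_inter_cone hz
          rw [hχ1 z.2 h3.le, one_mul, ← mul_assoc]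
          refine mul_le_mul_of_nonneg_right ?_ (hN0 z)
          calc c * (ρ (z.1 / τ) * coneWeight n z)
              = (Real.exp (-z.1) * ρ (z.1 / τ)) * (c * growthWeight n ‖z.2‖) := by
                rw [coneWeight]; ring
            _ ≤ a z.1 * φ ‖z.2‖ :=
                mul_le_mul (ha_ge _ h1.le) (hbd _ (norm_nonneg _)).1
                  (mul_nonneg hc.le (growthWeight_pos n (norm_nonneg _)).le) (ha_nn _ h1.le)
      _ ≤ _ := by
          refine setIntegral_mono_set hint1 ?_ (LE.le.eventuallyLE inter_subset_left)
          refine (ae_restrict_iff' (measurableSet_slab n T)).2 (ae_of_all _ fun z hz => ?_)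
          have hz1 : z.1 ∈ Ioo 0 T := hz.1
          exact mul_nonneg (mul_nonneg (ha_nn _ hz1.1.le)
            (mul_nonneg (hχ0 _) (hφ0 _).le)) (hN0 z)
  -- The right-hand side contains only terms in which the cutoff in time is differentiated.
  have hda0 : ∀ t, τ ≤ t → -deriv a t - A t = 0 := by
    intro t ht
    have h := hρ.deriv_timeTest (τ := τ) (hτ0.trans_le ht) 0
    have h1 : 1 ≤ t / τ := (one_le_div hτ0).2 ht
    have h2 : deriv (deriv ρ) (t / τ) = 0 := by
      have := hρ.deriv_deriv_le (t / τ)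
      rw [hρ.eq_zero _ h1, Real.zero_rpow hr.ne', mul_zero] at this
      exact abs_eq_zero.1 (le_antisymm this (abs_nonneg _))
    rw [h2, hρ.deriv_eq_zero_of_le hr.ne' h1] at h
    simpa using h
  have hF : IntegrableOn (fun z => (-deriv a z.1 - A z.1 + (a z.1 - A z.1) * D z.2)
      * (χ z.2 * φ ‖z.2‖) * wt z) (slab n T) := by
    have i1 := hwt.integrableOn_smul hτT (b := fun t => -deriv a t - A t)
      (g := fun x => χ x * φ ‖x‖) (by fun_prop) hda0 (by fun_prop) hχc.mul_right
    have i2 := hwt.integrableOn_smul hτT (b := fun t => a t - A t)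
      (g := fun x => χ x * φ ‖x‖ * D x) (by fun_prop)
      (fun t ht => by rw [ha0 t ht, hA0 t ht, sub_zero]) (by fun_prop) hχc.mul_right.mul_right
    refine (i1.add i2).congr_fun (fun z _ => ?_) (measurableSet_slab n T)
    simp only [Pi.add_apply, smul_eq_mul]
    ring
  rw [setIntegral_slab_eq_cone (hE.time_deriv.finiteSpeed hs) hF
    fun z hz => by rw [hz, mul_zero]] at ident
  have hσ : Continuous (cutoffIncrement ρ τ) := by
    unfold cutoffIncrement
    fun_prop
  have hG : IntegrableOn (fun z => cutoffIncrement ρ τ z.1 ^ r * coneWeight n z * |wt z|)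
      (slab n T ∩ cone n R) := by
    refine hwt.abs.integrableOn_cone hR hT hτT (b := fun t => cutoffIncrement ρ τ t ^ r)
      (hσ.rpow_const fun _ => Or.inr hr.le) fun t ht => ?_
    rw [hρ.increment_eq_zero hτ0 ht, Real.zero_rpow hr.ne']
  have up : ∫ z in slab n T ∩ cone n R, (-deriv a z.1 - A z.1 + (a z.1 - A z.1) * D z.2)
        * (χ z.2 * φ ‖z.2‖) * wt z
      ≤ (3 + α₁) * B / τ * C * ∫ z in slab n T ∩ cone n R,
          cutoffIncrement ρ τ z.1 ^ r * coneWeight n z * |wt z| := by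
    rw [← integral_const_mul]
    refine setIntegral_mono_on (hF.mono_set inter_subset_left) (hG.const_mul _)
      (measurableSet_slab_inter_cone n T R) fun z hz => ?_
    obtain ⟨h1, h2, h3⟩ := mem_slab_inter_cone hz
    have b1 := hρ.abs_multiplier_le hB hτ h1 (hD.nonneg z.2) (hDα z.2)
    have b2 : |χ z.2 * φ ‖z.2‖| ≤ C * growthWeight n ‖z.2‖ := by
      rw [hχ1 z.2 h3.le, one_mul, abs_of_pos (hφ0 _)]
      exact (hbd _ (norm_nonneg _)).2
    calc _ ≤ |(-deriv a z.1 - A z.1 + (a z.1 - A z.1) * D z.2)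
            * (χ z.2 * φ ‖z.2‖) * wt z| := le_abs_self _
      _ = |-deriv a z.1 - A z.1 + (a z.1 - A z.1) * D z.2| * |χ z.2 * φ ‖z.2‖| * |wt z| := by
          rw [abs_mul, abs_mul]
      _ ≤ ((3 + α₁) * B / τ * (Real.exp (-z.1) * cutoffIncrement ρ τ z.1 ^ r))
            * (C * growthWeight n ‖z.2‖) * |wt z| := by
          refine mul_le_mul_of_nonneg_right ?_ (abs_nonneg _)
          exact mul_le_mul b1 b2 (abs_nonneg _) ((abs_nonneg _).trans b1)
      _ = _ := by rw [coneWeight]; ring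
  set J := ∫ z in slab n T ∩ cone n R, cutoffIncrement ρ τ z.1 ^ r * coneWeight n z * |wt z|
    with hJ
  have hJ0 : 0 ≤ J := by
    refine setIntegral_nonneg (measurableSet_slab_inter_cone n T R) fun z hz => ?_
    obtain ⟨h1, h2, h3⟩ := mem_slab_inter_cone hz
    have e1 := hρ.increment_nonneg hτ0 h1.le
    have e2 := coneWeight_pos n z
    positivity
  have fin : ε * I + c * mass n R T ρ N τ ≤ (3 + α₁) * B / τ * C * J := by
    rw [hI]
    linarith
  calc ε * (I / c) + mass n R T ρ N τ = (ε * I + c * mass n R T ρ N τ) / c := by field_simp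
    _ ≤ ((3 + α₁) * B / τ * C * J) / c := by gcongr
    _ = ((3 + α₁) * B * C / c) / τ * J := by ring
    _ ≤ _ := by
        gcongr
        linarith

/-- Hölder's inequality for the weighted integral of `|f|` over times close to `τ`: the power of `τ`
comes from the mass of the weight, and the mass of `|f|^q` enters only through its increment. -/
theorem exists_hoelder_estimate {n : ℕ} (hn : 1 ≤ n) {R : ℝ} (hR : 0 < R) {q r B : ℝ} (hq : 1 < q)
    (hr : 1 / q ≤ r) {ρ : ℝ → ℝ} (hρ : IsCutoff r B ρ) :
    ∃ K > 0, ∀ (T τ : ℝ) (f : ℝ × Space n → ℝ), 1 ≤ τ → τ < T →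
      AEStronglyMeasurable f (volume.restrict (slab n T)) → IntegrableUpToZero T f →
      IntegrableUpToZero T (fun z => |f z| ^ q) →
      0 ≤ mass n R T ρ (fun z => |f z| ^ q) τ - mass n R T ρ (fun z => |f z| ^ q) (τ / 2) ∧
      ∫ z in slab n T ∩ cone n R, cutoffIncrement ρ τ z.1 ^ r * coneWeight n z * |f z|
        ≤ K * τ ^ ((((n : ℝ) - 1) / 2 + 1) * (1 - 1 / q))
          * (mass n R T ρ (fun z => |f z| ^ q) τ
              - mass n R T ρ (fun z => |f z| ^ q) (τ / 2)) ^ (1 / q) := by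
  obtain ⟨K, hK, hmass⟩ := exists_setIntegral_coneWeight_le hn hR
  have hpq : q.HolderConjugate (q / (q - 1)) := Real.HolderConjugate.conjExponent hq
  set q' := q / (q - 1) with hq'
  have hinv : 1 / q' = 1 - 1 / q := by
    rw [hq']
    have : q - 1 ≠ 0 := by linarith
    field_simp
  have hq0 : 0 < q := by linarith
  have hq'0 : 0 < q' := hpq.symm.pos
  have hr0 : 0 < r := lt_of_lt_of_le (by positivity) hr
  refine ⟨K ^ (1 - 1 / q), by positivity, ?_⟩
  intro T τ f hτ hτT hfm hf hfq
  have hτ0 : 0 < τ := by linarith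
  have hT : 0 < T := by linarith
  set S := slab n T ∩ cone n R with hS
  have hSm : MeasurableSet S := measurableSet_slab_inter_cone n T R
  set μ := (volume : Measure (ℝ × Space n)).restrict S with hμ
  have hρc := hρ.smooth.continuous
  have hσc : Continuous (cutoffIncrement ρ τ) := by
    unfold cutoffIncrement
    fun_prop
  have hwc := continuous_coneWeight n
  have hσ0 : ∀ z ∈ S, 0 ≤ cutoffIncrement ρ τ z.1 := fun z hz =>
    hρ.increment_nonneg hτ0 (mem_slab_inter_cone hz).1.le
  have m1 : ∀ s, 0 < s → s < T →
      IntegrableOn (fun z => ρ (z.1 / s) * coneWeight n z * |f z| ^ q) S := fun s hs hsT =>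
    hfq.integrableOn_cone hR hT hsT (b := fun t => ρ (t / s)) (by fun_prop)
      fun t ht => hρ.eq_zero _ ((one_le_div hs).2 ht)
  have hdiff : mass n R T ρ (fun z => |f z| ^ q) τ - mass n R T ρ (fun z => |f z| ^ q) (τ / 2)
      = ∫ z, cutoffIncrement ρ τ z.1 * coneWeight n z * |f z| ^ q ∂μ := by
    unfold mass
    rw [← integral_sub (m1 τ hτ0 hτT) (m1 (τ / 2) (by linarith) (by linarith))]
    congr 1
    ext z
    rw [cutoffIncrement]
    ring
  have hintσ : Integrable (fun z => cutoffIncrement ρ τ z.1 * coneWeight n z * |f z| ^ q) μ :=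
    hfq.integrableOn_cone hR hT hτT hσc fun t ht => hρ.increment_eq_zero hτ0 ht
  rw [hdiff]
  refine ⟨setIntegral_nonneg hSm fun z hz => ?_, ?_⟩
  · have h1 := hσ0 z hz
    have h2 := coneWeight_pos n z
    positivity
  -- The weight is split as `w = w^{1/q} w^{1/q'}`, and the cutoff is given to the first factor, which
  -- is possible because `σ^r ≤ σ^{1/q}` for `0 ≤ σ ≤ 1`.
  set F : ℝ × Space n → ℝ := fun z =>
    (cutoffIncrement ρ τ z.1 * coneWeight n z) ^ (1 / q) * |f z| with hFdef
  set E : Set (ℝ × Space n) := Iic τ ×ˢ univ with hEdef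
  have hEm : MeasurableSet E := measurableSet_Iic.prod MeasurableSet.univ
  set G : ℝ × Space n → ℝ := E.indicator fun z => coneWeight n z ^ (1 / q') with hGdef
  have hF0 : ∀ z ∈ S, 0 ≤ F z := fun z hz =>
    mul_nonneg (Real.rpow_nonneg (mul_nonneg (hσ0 z hz) (coneWeight_pos n z).le) _) (abs_nonneg _)
  have hG0 : ∀ z, 0 ≤ G z := fun z =>
    indicator_nonneg (fun z _ => Real.rpow_nonneg (coneWeight_pos n z).le _) z
  have hFq : ∀ z ∈ S, F z ^ q = cutoffIncrement ρ τ z.1 * coneWeight n z * |f z| ^ q := by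
    intro z hz
    have h1 := mul_nonneg (hσ0 z hz) (coneWeight_pos n z).le
    rw [hFdef]
    simp only
    rw [Real.mul_rpow (Real.rpow_nonneg h1 _) (abs_nonneg _), ← Real.rpow_mul h1,
      one_div_mul_cancel hq0.ne', Real.rpow_one]
  have hGq : ∀ z, G z ^ q' = E.indicator (coneWeight n) z := by
    intro z
    by_cases hz : z ∈ E
    · rw [hGdef, indicator_of_mem hz, indicator_of_mem hz, ← Real.rpow_mul (coneWeight_pos n z).le,
        one_div_mul_cancel hq'0.ne', Real.rpow_one]
    · rw [hGdef, indicator_of_notMem hz, indicator_of_notMem hz, Real.zero_rpow hq'0.ne']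
  have hSE : S ∩ E = (Ioc 0 τ ×ˢ univ) ∩ cone n R := by
    ext z
    constructor
    · rintro ⟨⟨⟨h1, -⟩, h2⟩, ⟨h3, -⟩⟩
      exact ⟨⟨⟨h1.1, h3⟩, mem_univ _⟩, h2⟩
    · rintro ⟨⟨h1, -⟩, h2⟩
      exact ⟨⟨⟨⟨h1.1, h1.2.trans_lt hτT⟩, mem_univ _⟩, h2⟩, ⟨h1.2, mem_univ _⟩⟩
  have hGint : Integrable (E.indicator (coneWeight n)) μ := by
    have := integrableOn_coneWeight n R τ
    rw [← hSE, inter_comm, ← integrableOn_indicator_iff hEm] at this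
    exact this
  have hGval : ∫ z, G z ^ q' ∂μ ≤ K * τ ^ (((n : ℝ) - 1) / 2 + 1) := by
    simp only [hGq]
    rw [hμ, setIntegral_indicator hEm, hSE]
    exact hmass τ hτ
  have hfm' : AEStronglyMeasurable f μ :=
    hfm.mono_measure (Measure.restrict_mono inter_subset_left le_rfl)
  have hFm : AEStronglyMeasurable F μ := by
    refine AEStronglyMeasurable.mul ?_ hfm'.norm
    refine Continuous.aestronglyMeasurable ?_
    refine Continuous.rpow_const (by fun_prop) fun _ => Or.inr (by positivity)
  have hGm : AEStronglyMeasurable G μ := by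
    refine AEStronglyMeasurable.indicator (Continuous.aestronglyMeasurable ?_) hEm
    exact hwc.rpow_const fun _ => Or.inr (by positivity)
  have hFL : MemLp F (ENNReal.ofReal q) μ := by
    rw [← integrable_norm_rpow_iff hFm (by simpa using hq0) ENNReal.ofReal_ne_top,
      ENNReal.toReal_ofReal hq0.le]
    refine IntegrableOn.congr_fun hintσ (fun z hz => ?_) hSm
    rw [Real.norm_of_nonneg (hF0 z hz), hFq z hz]
  have hGL : MemLp G (ENNReal.ofReal q') μ := by
    rw [← integrable_norm_rpow_iff hGm (by simpa using hq'0) ENNReal.ofReal_ne_top,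
      ENNReal.toReal_ofReal hq'0.le]
    refine hGint.congr (ae_of_all _ fun z => ?_)
    simp only [Real.norm_of_nonneg (hG0 z), hGq z]
  have := hpq.ennrealOfReal
  have hoelder := integral_mul_le_Lp_mul_Lq_of_nonneg hpq
    ((ae_restrict_iff' hSm).2 (ae_of_all _ hF0)) (ae_of_all μ hG0) hFL hGL
  have hFval : ∫ z, F z ^ q ∂μ = ∫ z, cutoffIncrement ρ τ z.1 * coneWeight n z * |f z| ^ q ∂μ :=
    setIntegral_congr_fun hSm hFq
  rw [hFval, hinv] at hoelder
  set Y := ∫ z, cutoffIncrement ρ τ z.1 * coneWeight n z * |f z| ^ q ∂μ with hY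
  have hY0 : 0 ≤ Y := setIntegral_nonneg hSm fun z hz => by
    have h1 := hσ0 z hz
    have h2 := coneWeight_pos n z
    positivity
  have h1q : 0 ≤ 1 - 1 / q := by rw [← hinv]; positivity
  have hint_left : Integrable
      (fun z => cutoffIncrement ρ τ z.1 ^ r * coneWeight n z * |f z|) μ := by
    refine hf.abs.integrableOn_cone hR hT hτT (b := fun t => cutoffIncrement ρ τ t ^ r)
      (hσc.rpow_const fun _ => Or.inr hr0.le) fun t ht => ?_
    rw [hρ.increment_eq_zero hτ0 ht, Real.zero_rpow hr0.ne']
  calc ∫ z, cutoffIncrement ρ τ z.1 ^ r * coneWeight n z * |f z| ∂μ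
      ≤ ∫ z, F z * G z ∂μ := by
        refine setIntegral_mono_on hint_left (hFL.integrable_mul hGL) hSm fun z hz => ?_
        have hs0 := hσ0 z hz
        have hw0 := coneWeight_pos n z
        by_cases hz' : z ∈ E
        · rw [hGdef, hFdef, indicator_of_mem hz']
          simp only
          rw [Real.mul_rpow hs0 hw0.le]
          have e1 : coneWeight n z = coneWeight n z ^ (1 / q) * coneWeight n z ^ (1 / q') := by
            rw [← Real.rpow_add hw0, hinv, add_sub_cancel, Real.rpow_one]
          have e2 : cutoffIncrement ρ τ z.1 ^ r ≤ cutoffIncrement ρ τ z.1 ^ (1 / q) :=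
            Real.rpow_le_rpow_of_exponent_ge_of_imp hs0 (hρ.increment_le_one _ _) hr
              fun _ h => absurd h (by positivity)
          calc _ ≤ cutoffIncrement ρ τ z.1 ^ (1 / q) * coneWeight n z * |f z| := by gcongr
            _ = cutoffIncrement ρ τ z.1 ^ (1 / q)
                * (coneWeight n z ^ (1 / q) * coneWeight n z ^ (1 / q')) * |f z| := by rw [← e1]
            _ = _ := by ring
        · have hlt : τ ≤ z.1 := by
            by_contra h
            exact hz' ⟨(not_le.1 h).le, mem_univ _⟩
          rw [hρ.increment_eq_zero hτ0 hlt, Real.zero_rpow hr0.ne']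
          simp only [zero_mul]
          exact mul_nonneg (hF0 z hz) (hG0 z)
    _ ≤ Y ^ (1 / q) * (∫ z, G z ^ q' ∂μ) ^ (1 - 1 / q) := hoelder
    _ ≤ Y ^ (1 / q) * (K * τ ^ (((n : ℝ) - 1) / 2 + 1)) ^ (1 - 1 / q) := by
        gcongr
        exact integral_nonneg fun z => Real.rpow_nonneg (hG0 z) _
    _ = _ := by
        rw [Real.mul_rpow hK.le (by positivity), ← Real.rpow_mul hτ0.le]
        ring

/-! ### The system of inequalities for the masses -/

/-- The coupled inequalities satisfied by the masses `X` of `|v_t|^p` and `Y` of `|u_t|^q`, with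
`m = (n-1)/2`: each mass, together with the data, is controlled by the increment of the other mass
over the last dyadic time interval. -/
structure MassSystem (m p q c K ε T : ℝ) (X Y : ℝ → ℝ) : Prop where
  nonneg_fst : ∀ τ, 0 ≤ X τ
  nonneg_snd : ∀ τ, 0 ≤ Y τ
  increment_fst : ∀ τ, 1 ≤ τ → τ < T → 0 ≤ X τ - X (τ / 2)
  increment_snd : ∀ τ, 1 ≤ τ → τ < T → 0 ≤ Y τ - Y (τ / 2)
  le_fst : ∀ τ, 1 ≤ τ → τ < T →
    ε * c + X τ ≤ K * τ ^ ((m + 1) * (1 - 1 / q) - 1) * (Y τ - Y (τ / 2)) ^ (1 / q)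
  le_snd : ∀ τ, 1 ≤ τ → τ < T →
    ε * c + Y τ ≤ K * τ ^ ((m + 1) * (1 - 1 / p) - 1) * (X τ - X (τ / 2)) ^ (1 / p)

lemma MassSystem.swap {m p q c K ε T : ℝ} {X Y : ℝ → ℝ} (h : MassSystem m p q c K ε T X Y) :
    MassSystem m q p c K ε T Y X :=
  ⟨h.nonneg_snd, h.nonneg_fst, h.increment_snd, h.increment_fst, h.le_snd, h.le_fst⟩

/-- Elimination of `Y` from the system. -/
lemma MassSystem.rpow_le {m p q c K ε T : ℝ} {X Y : ℝ → ℝ} (h : MassSystem m p q c K ε T X Y)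
    (hp : 1 < p) (hq : 1 < q) (hc : 0 < c) (hK : 0 < K) (hε : 0 < ε) {τ : ℝ} (hτ : 1 ≤ τ)
    (hτT : τ < T) :
    (ε * c + X τ) ^ (p * q)
      ≤ K ^ (p * q + p) * τ ^ (m * (p * q - 1) - (p + 1)) * (X τ - X (τ / 2)) := by
  have hp0 : 0 < p := by linarith
  have hq0 : 0 < q := by linarith
  have hτ0 : 0 < τ := by linarith
  have hA : 0 ≤ ε * c + X τ := add_nonneg (by positivity) (h.nonneg_fst τ)
  set Δ := X τ - X (τ / 2) with hΔ
  have hΔ0 : 0 ≤ Δ := h.increment_fst τ hτ hτT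
  set DY := Y τ - Y (τ / 2) with hDY
  have hDY0 : 0 ≤ DY := h.increment_snd τ hτ hτT
  have h1 := h.le_fst τ hτ hτT
  have h2 : DY ≤ K * τ ^ ((m + 1) * (1 - 1 / p) - 1) * Δ ^ (1 / p) := by
    have e1 := h.le_snd τ hτ hτT
    have e2 := h.nonneg_snd (τ / 2)
    have e3 : 0 < ε * c := by positivity
    linarith
  have h3 : DY ^ p ≤ K ^ p * τ ^ (((m + 1) * (1 - 1 / p) - 1) * p) * Δ := by
    calc DY ^ p ≤ (K * τ ^ ((m + 1) * (1 - 1 / p) - 1) * Δ ^ (1 / p)) ^ p :=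
          Real.rpow_le_rpow hDY0 h2 hp0.le
      _ = _ := by
          rw [Real.mul_rpow (by positivity) (by positivity), Real.mul_rpow hK.le (by positivity),
            ← Real.rpow_mul hτ0.le, ← Real.rpow_mul hΔ0, one_div_mul_cancel hp0.ne', Real.rpow_one]
  calc (ε * c + X τ) ^ (p * q)
      ≤ (K * τ ^ ((m + 1) * (1 - 1 / q) - 1) * DY ^ (1 / q)) ^ (p * q) :=
        Real.rpow_le_rpow hA h1 (by positivity)
    _ = K ^ (p * q) * τ ^ (((m + 1) * (1 - 1 / q) - 1) * (p * q)) * DY ^ p := by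
        rw [Real.mul_rpow (by positivity) (by positivity), Real.mul_rpow hK.le (by positivity),
          ← Real.rpow_mul hτ0.le, ← Real.rpow_mul hDY0]
        congr 2
        field_simp
    _ ≤ K ^ (p * q) * τ ^ (((m + 1) * (1 - 1 / q) - 1) * (p * q))
          * (K ^ p * τ ^ (((m + 1) * (1 - 1 / p) - 1) * p) * Δ) := by gcongr
    _ = (K ^ (p * q) * K ^ p) * (τ ^ (((m + 1) * (1 - 1 / q) - 1) * (p * q))
          * τ ^ (((m + 1) * (1 - 1 / p) - 1) * p)) * Δ := by ring
    _ = _ := by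
        rw [← Real.rpow_add hK, ← Real.rpow_add hτ0]
        congr 3
        field_simp
        ring

/-- Here a single time `τ` is enough: the increment of `X` is at most `ε c + X`, so that one power of
this quantity cancels. -/
lemma MassSystem.le_of_subcritical {m p q c K ε T γ : ℝ} {X Y : ℝ → ℝ}
    (h : MassSystem m p q c K ε T X Y) (hp : 1 < p) (hq : 1 < q) (hc : 0 < c) (hK : 0 < K)
    (hε : 0 < ε) (hγ : 0 < γ) (hγeq : γ = (p + 1) / (p * q - 1) - m) :
    T ≤ max 1 ((K ^ ((p * q + p) / (p * q - 1)) / c) ^ γ⁻¹ * ε ^ (-γ⁻¹)) := by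
  have hs : 0 < p * q - 1 := by nlinarith
  refine le_of_forall_lt fun τ' hτ' => ?_
  rcases lt_or_ge τ' 1 with h1 | h1
  · exact lt_max_of_lt_left h1
  obtain ⟨τ, hττ, hτT⟩ := exists_between hτ'
  refine lt_max_of_lt_right (hττ.trans_le ?_)
  have hτ : 1 ≤ τ := h1.trans hττ.le
  have hτ0 : 0 < τ := by linarith
  have key := h.rpow_le hp hq hc hK hε hτ hτT
  set A := ε * c + X τ with hA
  have hεc : 0 < ε * c := by positivity
  have hAε : ε * c ≤ A := by linarith [h.nonneg_fst τ]
  have hA0 : 0 < A := lt_of_lt_of_le hεc hAε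
  have hAX : X τ - X (τ / 2) ≤ A := by linarith [h.nonneg_fst (τ / 2)]
  have e1 : m * (p * q - 1) - (p + 1) = -γ * (p * q - 1) := by
    rw [hγeq]; field_simp; ring
  rw [e1] at key
  have h2 : A ^ (p * q - 1) ≤ K ^ (p * q + p) * τ ^ (-γ * (p * q - 1)) := by
    rw [Real.rpow_sub_one hA0.ne', div_le_iff₀ hA0]
    refine key.trans ?_
    gcongr
  have h3 : ε * c ≤ K ^ ((p * q + p) / (p * q - 1)) * τ ^ (-γ) := by
    have h4 : (ε * c) ^ (p * q - 1) ≤ (K ^ ((p * q + p) / (p * q - 1)) * τ ^ (-γ)) ^ (p * q - 1) := by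
      have h5 : (K ^ ((p * q + p) / (p * q - 1)) * τ ^ (-γ)) ^ (p * q - 1)
          = K ^ (p * q + p) * τ ^ (-γ * (p * q - 1)) := by
        rw [Real.mul_rpow (by positivity) (by positivity), ← Real.rpow_mul hK.le,
          ← Real.rpow_mul hτ0.le, div_mul_cancel₀ _ hs.ne']
      rw [h5]
      exact (Real.rpow_le_rpow hεc.le hAε hs.le).trans h2
    exact (Real.rpow_le_rpow_iff hεc.le (by positivity) hs).1 h4
  rw [Real.rpow_neg hτ0.le, ← div_eq_mul_inv, le_div_iff₀ (by positivity)] at h3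
  have h5 : τ ^ γ ≤ K ^ ((p * q + p) / (p * q - 1)) / c * ε⁻¹ := by
    rw [← div_eq_mul_inv, div_div, le_div_iff₀ (by positivity)]
    linarith
  calc τ = (τ ^ γ) ^ γ⁻¹ := by rw [← Real.rpow_mul hτ0.le, mul_inv_cancel₀ hγ.ne', Real.rpow_one]
    _ ≤ (K ^ ((p * q + p) / (p * q - 1)) / c * ε⁻¹) ^ γ⁻¹ := by gcongr
    _ = _ := by
        rw [Real.mul_rpow (by positivity) (by positivity), Real.inv_rpow hε.le, Real.rpow_neg hε.le]

/-- A positive function whose dyadic increments dominate a superlinear power lives only up to an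
exponential time: the quantity `b^{-s}` drops by a fixed amount over every dyadic interval. -/
lemma le_exp_of_rpow_le_increment {b : ℝ → ℝ} {T K s δ : ℝ} (hK : 0 < K) (hs : 0 < s) (hδ : 0 < δ)
    (hb : ∀ τ, δ ≤ b τ)
    (h : ∀ τ, 1 ≤ τ → τ < T → b τ ^ (s + 1) ≤ K * (b τ - b (τ / 2))) :
    T ≤ Real.exp (1 + K / s * δ ^ (-s)) := by
  have hb0 : ∀ τ, 0 < b τ := fun τ => lt_of_lt_of_le hδ (hb τ)
  have step : ∀ τ, 1 ≤ τ → τ < T → b τ ^ (-s) + s / K ≤ b (τ / 2) ^ (-s) := by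
    intro τ hτ hτT
    have h1 := h τ hτ hτT
    set x := b (τ / 2) with hx
    set y := b τ with hy
    have hx0 : 0 < x := hb0 _
    have hy0 : 0 < y := hb0 _
    have hz : 0 < x / y := div_pos hx0 hy0
    -- Bernoulli's inequality for the negative exponent `-s`.
    have h2 : 1 + s * (1 - x / y) ≤ (x / y) ^ (-s) := by
      rw [Real.rpow_def_of_pos hz]
      have e1 := Real.add_one_le_exp (Real.log (x / y) * -s)
      have e2 := Real.log_le_sub_one_of_pos hz
      nlinarith
    have h3 : y ^ s ≤ K * (1 - x / y) := by
      rw [Real.rpow_add_one hy0.ne'] at h1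
      have : K * (1 - x / y) = K * (y - x) / y := by field_simp
      rw [this, le_div_iff₀ hy0]
      exact h1
    have h4 : (x / y) ^ (-s) = x ^ (-s) * y ^ s := by
      rw [Real.div_rpow hx0.le hy0.le, Real.rpow_neg hy0.le, div_inv_eq_mul]
    have hys : 0 < y ^ s := by positivity
    have h5 : s / K * y ^ s ≤ s * (1 - x / y) := by
      rw [div_mul_eq_mul_div, div_le_iff₀ hK]
      nlinarith
    rw [h4] at h2
    have h6 : (y ^ (-s) + s / K) * y ^ s ≤ x ^ (-s) * y ^ s := by
      rw [add_mul, ← Real.rpow_add hy0, neg_add_cancel, Real.rpow_zero]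
      linarith
    exact le_of_mul_le_mul_right h6 hys
  have iter : ∀ N : ℕ, (2 : ℝ) ^ N < T → b (2 ^ N) ^ (-s) + N * (s / K) ≤ b 1 ^ (-s) := by
    intro N
    induction N with
    | zero => intro _; simp
    | succ N ih =>
      intro hN
      have h1 : (2 : ℝ) ^ N < T := by
        refine lt_of_le_of_lt ?_ hN
        exact pow_le_pow_right₀ (by norm_num) (Nat.le_succ N)
      have h2 := step (2 ^ (N + 1)) (one_le_pow₀ (by norm_num)) hN
      have h3 : (2 : ℝ) ^ (N + 1) / 2 = 2 ^ N := by rw [pow_succ]; ring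
      rw [h3] at h2
      have := ih h1
      push_cast
      linarith
  set M := K / s * δ ^ (-s) with hM
  have hM0 : 0 ≤ M := by positivity
  have bound : ∀ N : ℕ, (2 : ℝ) ^ N < T → (N : ℝ) ≤ M := by
    intro N hN
    have h1 := iter N hN
    have h2 : b 1 ^ (-s) ≤ δ ^ (-s) :=
      Real.rpow_le_rpow_of_nonpos hδ (hb 1) (by linarith)
    have h3 : 0 ≤ b (2 ^ N) ^ (-s) := Real.rpow_nonneg (hb0 _).le _
    have h4 : N * (s / K) ≤ δ ^ (-s) := by linarith
    rw [hM, div_mul_eq_mul_div, le_div_iff₀ hs]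
    rw [← mul_div_assoc, div_le_iff₀ hK] at h4
    linarith
  by_contra hcon
  have h1 : (2 : ℝ) ^ (⌊M⌋₊ + 1) < T := by
    refine lt_of_le_of_lt ?_ (not_le.1 hcon)
    have h2 : (2 : ℝ) ≤ Real.exp 1 := by
      have := Real.add_one_le_exp 1
      linarith
    calc (2 : ℝ) ^ (⌊M⌋₊ + 1) ≤ Real.exp 1 ^ (⌊M⌋₊ + 1) := by gcongr
      _ = Real.exp (⌊M⌋₊ + 1) := by rw [← Real.exp_nat_mul]; push_cast; ring_nf
      _ ≤ Real.exp (1 + M) := Real.exp_le_exp.2 (by linarith [Nat.floor_le hM0])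
  have h2 := bound _ h1
  have h3 := Nat.lt_floor_add_one M
  push_cast at h2
  linarith

lemma MassSystem.le_of_critical {m p q c K ε T : ℝ} {X Y : ℝ → ℝ}
    (h : MassSystem m p q c K ε T X Y) (hp : 1 < p) (hq : 1 < q) (hc : 0 < c) (hK : 0 < K)
    (hε : 0 < ε) (hm : (p + 1) / (p * q - 1) - m = 0) :
    T ≤ Real.exp (1 + K ^ (p * q + p) / (p * q - 1) * (ε * c) ^ (-(p * q - 1))) := by
  have hs : 0 < p * q - 1 := by nlinarith
  refine le_exp_of_rpow_le_increment (b := fun τ => ε * c + X τ) (by positivity) hs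
    (by positivity) (fun τ => by linarith [h.nonneg_fst τ]) fun τ hτ hτT => ?_
  have key := h.rpow_le hp hq hc hK hε hτ hτT
  have e1 : m * (p * q - 1) - (p + 1) = 0 := by
    have : m = (p + 1) / (p * q - 1) := by linarith
    rw [this]; field_simp; ring
  rw [e1, Real.rpow_zero, mul_one] at key
  rw [sub_add_cancel, add_sub_add_left_eq_sub]
  exact key

/-- For `p = q` both inequalities are critical, and the dyadic argument applies to the sum
`2 ε c + X + Y` with the power `p` in place of `p²`. -/
lemma MassSystem.le_of_critical_diagonal {m p c K ε T : ℝ} {X Y : ℝ → ℝ}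
    (h : MassSystem m p p c K ε T X Y) (hp : 1 < p) (hc : 0 < c) (hK : 0 < K)
    (hε : 0 < ε) (hm : (p + 1) / (p * p - 1) - m = 0) :
    T ≤ Real.exp (1 + 2 ^ (p - 1) * K ^ p / (p - 1) * (ε * c) ^ (-(p - 1))) := by
  have hs : 0 < p - 1 := by linarith
  have hp0 : 0 < p := by linarith
  have hεc : 0 < ε * c := by positivity
  have e1 : (m + 1) * (1 - 1 / p) - 1 = 0 := by
    have h1 : p * p - 1 = (p + 1) * (p - 1) := by ring
    have h2 : p + 1 ≠ 0 := by linarith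
    have : m = 1 / (p - 1) := by
      rw [h1] at hm
      have : (p + 1) / ((p + 1) * (p - 1)) = 1 / (p - 1) := by field_simp
      linarith
    rw [this]; field_simp; ring
  refine le_exp_of_rpow_le_increment (b := fun τ => (ε * c + X τ) + (ε * c + Y τ)) (by positivity)
    hs hεc (fun τ => by linarith [h.nonneg_fst τ, h.nonneg_snd τ]) fun τ hτ hτT => ?_
  have k1 := h.le_fst τ hτ hτT
  have k2 := h.le_snd τ hτ hτT
  rw [e1, Real.rpow_zero, mul_one] at k1 k2
  have d1 := h.increment_fst τ hτ hτT
  have d2 := h.increment_snd τ hτ hτT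
  have a1 : 0 ≤ ε * c + X τ := by linarith [h.nonneg_fst τ]
  have a2 : 0 ≤ ε * c + Y τ := by linarith [h.nonneg_snd τ]
  have pw : ∀ A d : ℝ, 0 ≤ A → 0 ≤ d → A ≤ K * d ^ (1 / p) → A ^ p ≤ K ^ p * d := by
    intro A d hA hd hle
    calc A ^ p ≤ (K * d ^ (1 / p)) ^ p := by gcongr
      _ = _ := by
          rw [Real.mul_rpow hK.le (by positivity), ← Real.rpow_mul hd, one_div_mul_cancel hp0.ne',
            Real.rpow_one]
  have p1 := pw _ _ a1 d2 k1
  have p2 := pw _ _ a2 d1 k2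
  rw [sub_add_cancel]
  calc ((ε * c + X τ) + (ε * c + Y τ)) ^ p
      ≤ 2 ^ (p - 1) * ((ε * c + X τ) ^ p + (ε * c + Y τ) ^ p) :=
        by
          lift ε * c + X τ to ℝ≥0 using a1 with x
          lift ε * c + Y τ to ℝ≥0 using a2 with y
          exact_mod_cast NNReal.rpow_add_le_mul_rpow_add_rpow x y hp.le
    _ ≤ 2 ^ (p - 1) * (K ^ p * (Y τ - Y (τ / 2)) + K ^ p * (X τ - X (τ / 2))) := by gcongr
    _ = _ := by ring

/-! ### From weak solutions to the inequalities -/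

lemma mass_nonneg {n : ℕ} {R T r B : ℝ} {ρ : ℝ → ℝ} (hρ : IsCutoff r B ρ)
    {N : ℝ × Space n → ℝ} (hN : ∀ z, 0 ≤ N z) (τ : ℝ) : 0 ≤ mass n R T ρ N τ :=
  setIntegral_nonneg (measurableSet_slab_inter_cone n T R) fun z _ =>
    mul_nonneg (mul_nonneg (hρ.nonneg _) (coneWeight_pos n z).le) (hN z)

/-- Weak solutions satisfy the system of inequalities with constants independent of the solution, its
existence time and `ε`. -/
theorem exists_massSystem {n : ℕ} (hn : 3 ≤ n) {p q : ℝ} (hp : 1 < p) (hq : 1 < q)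
    {α₁ β α₂ κ : ℝ} (hα₁ : 0 ≤ α₁) (hβ : 1 < β) (hα₂ : 0 ≤ α₂) (hκ : 1 < κ)
    {D₁ D₂ V₁ V₂ : Space n → ℝ}
    (hD₁ : IsCoefficient D₁ α₁ β) (hD₂ : IsCoefficient D₂ α₁ β)
    (hV₁ : IsCoefficient V₁ α₂ κ) (hV₂ : IsCoefficient V₂ α₂ κ)
    {R : ℝ} (hR : 0 < R) {u₀ u₁ v₀ v₁ : Space n → ℝ}
    (hu₀ : IsDatum R u₀) (hu₁ : IsDatum R u₁) (hv₀ : IsDatum R v₀) (hv₁ : IsDatum R v₁)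
    (hu : u₀ ≠ 0 ∨ u₁ ≠ 0) (hv : v₀ ≠ 0 ∨ v₁ ≠ 0) :
    ∃ c > 0, ∃ K > 0, ∀ ε T : ℝ, 0 < ε →
      T ∈ existenceTimes p q D₁ D₂ V₁ V₂ R u₀ u₁ v₀ v₁ ε →
      ∃ X Y : ℝ → ℝ, MassSystem (((n : ℝ) - 1) / 2) p q c K ε T X Y := by
  have hp0 : 0 < p := by linarith
  have hq0 : 0 < q := by linarith
  -- One cutoff serves both equations, so that the two masses are the same in all estimates.
  set r : ℝ := max (1 / p) (1 / q) with hr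
  have hr0 : 0 < r := lt_max_of_lt_left (by positivity)
  have hr1 : r < 1 := max_lt (by rw [div_lt_one hp0]; exact hp) (by rw [div_lt_one hq0]; exact hq)
  obtain ⟨B, hB, ρ, hρ⟩ := exists_isCutoff hr1
  obtain ⟨c₁, hc₁, K₁, hK₁, E₁⟩ := exists_linear_estimate hn hα₁ hβ hα₂ hκ hD₁ hV₁ hR hu₀ hu₁ hu
    hr0 hB.le hρ
  obtain ⟨c₂, hc₂, K₂, hK₂, E₂⟩ := exists_linear_estimate hn hα₁ hβ hα₂ hκ hD₂ hV₂ hR hv₀ hv₁ hv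
    hr0 hB.le hρ
  obtain ⟨L₁, hL₁, H₁⟩ := exists_hoelder_estimate (n := n) (by omega) hR hq (le_max_right _ _) hρ
  obtain ⟨L₂, hL₂, H₂⟩ := exists_hoelder_estimate (n := n) (by omega) hR hp (le_max_left _ _) hρ
  refine ⟨min c₁ c₂, lt_min hc₁ hc₂, max (K₁ * L₁) (K₂ * L₂), lt_max_of_lt_left (by positivity), ?_⟩
  rintro ε T hε ⟨hT, u, ut, gu, v, vt, gv, sol⟩
  set m : ℝ := ((n : ℝ) - 1) / 2 with hm
  set X := mass n R T ρ fun z => |vt z| ^ p with hX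
  set Y := mass n R T ρ fun z => |ut z| ^ q with hY
  have nX : ∀ z, 0 ≤ |vt z| ^ p := fun z => by positivity
  have nY : ∀ z, 0 ≤ |ut z| ^ q := fun z => by positivity
  have hoelder_u := fun τ (h1 : 1 ≤ τ) (h2 : τ < T) => H₁ T τ ut h1 h2 sol.energy_u.cont_time.1
    sol.energy_u.cont_time.integrableUpToZero sol.equation_v.integrableUpToZero
  have hoelder_v := fun τ (h1 : 1 ≤ τ) (h2 : τ < T) => H₂ T τ vt h1 h2 sol.energy_v.cont_time.1
    sol.energy_v.cont_time.integrableUpToZero sol.equation_u.integrableUpToZero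
  have comb : ∀ {τ a b c K L Z I Δ e s : ℝ}, 1 ≤ τ → 0 < K → 0 < L → 0 ≤ Δ → b ≤ c →
      ε * c + Z ≤ K / τ * I → I ≤ L * τ ^ e * Δ ^ s → K * L ≤ a →
      ε * b + Z ≤ a * τ ^ (e - 1) * Δ ^ s := by
    intro τ a b c K L Z I Δ e s hτ hK hL hΔ hbc h1 h2 h3
    have hτ0 : 0 < τ := by linarith
    calc ε * b + Z ≤ ε * c + Z := by gcongr
      _ ≤ K / τ * I := h1
      _ ≤ K / τ * (L * τ ^ e * Δ ^ s) := by gcongr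
      _ = K * L * τ ^ (e - 1) * Δ ^ s := by rw [Real.rpow_sub_one hτ0.ne']; ring
      _ ≤ a * τ ^ (e - 1) * Δ ^ s := by gcongr
  refine ⟨X, Y, mass_nonneg hρ nX, mass_nonneg hρ nY, fun τ h1 h2 => (hoelder_v τ h1 h2).1,
    fun τ h1 h2 => (hoelder_u τ h1 h2).1, fun τ h1 h2 => ?_, fun τ h1 h2 => ?_⟩
  · exact comb h1 hK₁ hL₁ (hoelder_u τ h1 h2).1 (min_le_left _ _)
      (E₁ T τ ε u ut gu _ h1 h2 nX sol.energy_u sol.initial_u sol.speed_u sol.equation_u)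
      (hoelder_u τ h1 h2).2 (le_max_left _ _)
  · exact comb h1 hK₂ hL₂ (hoelder_v τ h1 h2).1 (min_le_right _ _)
      (E₂ T τ ε v vt gv _ h1 h2 nY sol.energy_v sol.initial_v sol.speed_v sol.equation_v)
      (hoelder_v τ h1 h2).2 (le_max_right _ _)

lemma lifespan_le {n : ℕ} {p q : ℝ} {D₁ D₂ V₁ V₂ : Space n → ℝ} {R : ℝ}
    {u₀ u₁ v₀ v₁ : Space n → ℝ} {ε b : ℝ}
    (h : ∀ T ∈ existenceTimes p q D₁ D₂ V₁ V₂ R u₀ u₁ v₀ v₁ ε, T ≤ b) :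
    lifespan p q D₁ D₂ V₁ V₂ R u₀ u₁ v₀ v₁ ε ≤ ENNReal.ofReal b :=
  iSup₂_le fun T hT => ENNReal.ofReal_le_ofReal (h T hT)

/-- The bound `exp (1 + A (ε c)^{-s})` is of the form `exp (C ε^{-s})` for `ε < 1`. -/
lemma exp_one_add_le {A c s ε : ℝ} (hc : 0 < c) (hs : 0 < s) (hε : 0 < ε) (hε1 : ε < 1) :
    Real.exp (1 + A * (ε * c) ^ (-s)) ≤ Real.exp ((1 + A * c ^ (-s)) * ε ^ (-s)) := by
  rw [Real.mul_rpow hε.le hc.le]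
  have h1 : 1 ≤ ε ^ (-s) := Real.one_le_rpow_of_pos_of_le_one_of_nonpos hε hε1.le (by linarith)
  gcongr
  nlinarith

end DampedWave
end

theorem theorem1p2 (n : ℕ) (hn : 3 ≤ n) (p q : ℝ) (hp : 1 < p) (hq : 1 < q)
    (hΓ : 0 ≤ gammaGG n p q)
    (α₁ β α₂ κ : ℝ) (hα₁ : 0 ≤ α₁) (hβ : 1 < β) (hα₂ : 0 ≤ α₂) (hκ : 2 < κ)
    (D₁ D₂ V₁ V₂ : Space n → ℝ)
    (hD₁ : IsCoefficient D₁ α₁ β) (hD₂ : IsCoefficient D₂ α₁ β)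
    (hV₁ : IsCoefficient V₁ α₂ κ) (hV₂ : IsCoefficient V₂ α₂ κ)
    (R : ℝ) (hR : 0 < R) (u₀ u₁ v₀ v₁ : Space n → ℝ)
    (hu₀ : IsDatum R u₀) (hu₁ : IsDatum R u₁) (hv₀ : IsDatum R v₀) (hv₁ : IsDatum R v₁)
    (hu : u₀ ≠ 0 ∨ u₁ ≠ 0) (hv : v₀ ≠ 0 ∨ v₁ ≠ 0) :
    (∀ ε : ℝ, 0 < ε → lifespan p q D₁ D₂ V₁ V₂ R u₀ u₁ v₀ v₁ ε < ⊤) ∧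
    ∃ ε₀ : ℝ, 0 < ε₀ ∧ ∃ C : ℝ, 0 < C ∧ ∀ ε : ℝ, 0 < ε → ε < ε₀ →
      (0 < gammaGG n p q →
        lifespan p q D₁ D₂ V₁ V₂ R u₀ u₁ v₀ v₁ ε
          ≤ ENNReal.ofReal (C * ε ^ (-(gammaGG n p q)⁻¹))) ∧
      (gammaGG n p q = 0 → p ≠ q →
        lifespan p q D₁ D₂ V₁ V₂ R u₀ u₁ v₀ v₁ ε
          ≤ ENNReal.ofReal (Real.exp (C * ε ^ (-(p * q - 1))))) ∧
      (gammaGG n p q = 0 → p = q →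
        lifespan p q D₁ D₂ V₁ V₂ R u₀ u₁ v₀ v₁ ε
          ≤ ENNReal.ofReal (Real.exp (C * ε ^ (-(p - 1))))) := by
  obtain ⟨c, hc, K, hK, sys⟩ := exists_massSystem hn hp hq hα₁ hβ hα₂ (by linarith : 1 < κ)
    hD₁ hD₂ hV₁ hV₂ hR hu₀ hu₁ hv₀ hv₁ hu hv
  have hpq : 0 < p * q - 1 := by nlinarith
  set m : ℝ := ((n : ℝ) - 1) / 2 with hm
  set Γ := gammaGG n p q with hΓdef
  have hΓeq : Γ = max ((p + 1) / (p * q - 1)) ((q + 1) / (p * q - 1)) - m := rfl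
  -- By symmetry, let `P ≥ Q` be the two exponents; then `(P + 1) / (P Q - 1)` is the larger quotient.
  obtain ⟨P, Q, hP, hQ, hPQ, hΓP, sysP⟩ : ∃ P Q : ℝ, 1 < P ∧ 1 < Q ∧ P * Q = p * q ∧
      Γ = (P + 1) / (P * Q - 1) - m ∧ ∀ ε T : ℝ, 0 < ε →
        T ∈ existenceTimes p q D₁ D₂ V₁ V₂ R u₀ u₁ v₀ v₁ ε →
        ∃ X Y : ℝ → ℝ, MassSystem m P Q c K ε T X Y := by
    rcases le_total q p with h | h
    · refine ⟨p, q, hp, hq, rfl, ?_, sys⟩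
      rw [hΓeq, max_eq_left]
      gcongr
    · refine ⟨q, p, hq, hp, mul_comm q p, ?_, fun ε T hε hT => ?_⟩
      · rw [hΓeq, max_eq_right, mul_comm q p]
        gcongr
      · obtain ⟨X, Y, h⟩ := sys ε T hε hT
        exact ⟨Y, X, h.swap⟩
  set C₁ := (K ^ ((P * Q + P) / (P * Q - 1)) / c) ^ Γ⁻¹ with hC₁
  set C₂ := K ^ (P * Q + P) / (P * Q - 1) with hC₂
  set C₃ := 2 ^ (p - 1) * K ^ p / (p - 1) with hC₃
  have hPQ0 : 0 < P * Q - 1 := by rw [hPQ]; exact hpq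
  have hp1 : 0 < p - 1 := by linarith
  have hC₁0 : 0 ≤ C₁ := by positivity
  have hC₂0 : 0 ≤ C₂ := by positivity
  have hC₃0 : 0 ≤ C₃ := by positivity
  have sub : 0 < Γ → ∀ ε, 0 < ε → lifespan p q D₁ D₂ V₁ V₂ R u₀ u₁ v₀ v₁ ε
      ≤ ENNReal.ofReal (max 1 (C₁ * ε ^ (-Γ⁻¹))) := fun hpos ε hε =>
    lifespan_le fun T hT => by
      obtain ⟨X, Y, h⟩ := sysP ε T hε hT
      exact h.le_of_subcritical hP hQ hc hK hε hpos hΓP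
  have crit : Γ = 0 → ∀ ε, 0 < ε → lifespan p q D₁ D₂ V₁ V₂ R u₀ u₁ v₀ v₁ ε
      ≤ ENNReal.ofReal (Real.exp (1 + C₂ * (ε * c) ^ (-(p * q - 1)))) := fun h0 ε hε =>
    lifespan_le fun T hT => by
      obtain ⟨X, Y, h⟩ := sysP ε T hε hT
      have := h.le_of_critical hP hQ hc hK hε (hΓP ▸ h0)
      rwa [hPQ, ← hPQ, ← hC₂, hPQ] at this
  have diag : Γ = 0 → p = q → ∀ ε, 0 < ε → lifespan p q D₁ D₂ V₁ V₂ R u₀ u₁ v₀ v₁ ε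
      ≤ ENNReal.ofReal (Real.exp (1 + C₃ * (ε * c) ^ (-(p - 1)))) := fun h0 hpq' ε hε =>
    lifespan_le fun T hT => by
      obtain ⟨X, Y, h⟩ := sys ε T hε hT
      subst hpq'
      refine h.le_of_critical_diagonal hp hc hK hε ?_
      rw [← h0, hΓeq, max_self]
  -- For `ε < 1` every negative power of `ε` is at least `1`, which absorbs the constants `1`.
  refine ⟨fun ε hε => ?_, 1, one_pos,
    (1 + C₁) + (1 + C₂ * c ^ (-(p * q - 1))) + (1 + C₃ * c ^ (-(p - 1))), by positivity,
    fun ε hε hε1 => ⟨fun hpos => ?_, fun h0 _ => ?_, fun h0 hpq' => ?_⟩⟩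
  · rcases hΓ.eq_or_lt with h0 | hpos
    · exact (crit h0.symm ε hε).trans_lt ENNReal.ofReal_lt_top
    · exact (sub hpos ε hε).trans_lt ENNReal.ofReal_lt_top
  · refine (sub hpos ε hε).trans (ENNReal.ofReal_le_ofReal ?_)
    have h1 : 1 ≤ ε ^ (-Γ⁻¹) :=
      Real.one_le_rpow_of_pos_of_le_one_of_nonpos hε hε1.le (by
        have := inv_pos.2 hpos
        linarith)
    have h2 : 0 ≤ C₂ * c ^ (-(p * q - 1)) := by positivity
    have h3 : 0 ≤ C₃ * c ^ (-(p - 1)) := by positivity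
    refine max_le ?_ ?_
    · nlinarith
    · exact mul_le_mul_of_nonneg_right (by linarith) (by positivity)
  · refine (crit h0 ε hε).trans (ENNReal.ofReal_le_ofReal ((exp_one_add_le hc hpq hε hε1).trans ?_))
    have h3 : 0 ≤ C₃ * c ^ (-(p - 1)) := by positivity
    exact Real.exp_le_exp.2 (mul_le_mul_of_nonneg_right (by linarith) (by positivity))
  · refine (diag h0 hpq' ε hε).trans
      (ENNReal.ofReal_le_ofReal ((exp_one_add_le hc hp1 hε hε1).trans ?_))
    have h2 : 0 ≤ C₂ * c ^ (-(p * q - 1)) := by positivity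
    exact Real.exp_le_exp.2 (mul_le_mul_of_nonneg_right (by linarith) (by positivity))
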